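/- **Lemma 4.1.** Let $H$ be a separable complex Hilbert space, let $(e^{-tA})_{t\ge 0}$ be a bounded $C_0$ semigroup on $H$ with generator $-A$, and give $D(A)$ the graph norm. Let $H_0$ be a complex Hilbert space of finite dimension $m$, and let $B:H_0\to D(A)$ and $C:D(A)\to H_0$ be bounded linear operators. Suppose that $K_C(A)\le 1$ and $K_{B^\dagger}(A^\dagger)\le 1$, that is, $$\int_0^\infty\|Ce^{-sA}\xi\|^2\,ds\le\|\xi\|^2\quad(\xi\in D(A)),\qquad \int_0^\infty\|B^\dagger e^{-sA^\dagger}\eta\|^2\,ds\le\|\eta\|^2\quad(\eta\in H),$$ where $B^\dagger:H\to H_0$ is the adjoint of $B:H_0\to H$. Put $\phi(x)=Ce^{-xA}B$. For $x>0$ let $R_x$ be the bounded operator on $H$ with $R_x\xi=\int_x^\infty e^{-yA}BCe^{-yA}\xi\,dy$ for $\xi\in D(A)$ (a norm convergent improper integral). Let $\lambda\in\mathbb C$ with $|\lambda|<1$. (i) For each $x>0$ the operator $R_x$ exists and is unique, $I+\lambda R_x$ is invertible, and for $0<x\le y$ the operator $$T_\lambda(x,y)=-\lambda Ce^{-xA}(I+\lambda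 R_x)^{-1}e^{-yA}B$$ on $H_0$ is well defined, since $e^{-xA}(I+\lambda R_x)^{-1}e^{-yA}B$ maps $H_0$ into $D(A)$. For each $x>0$ the function $T_\lambda(x,\cdot)$ belongs to $L^2(x,\infty)$ and satisfies, with an absolutely convergent integral, $$T_\lambda(x,y)+\lambda\phi(x+y)+\lambda\int_x^\infty T_\lambda(x,z)\phi(z+y)\,dz=0\qquad(0<x\le y),$$ and it is the unique solution in $L^2(x,\infty)$: a function in $L^2(x,\infty)$ that satisfies the equation for almost every $y>x$ equals $T_\lambda(x,y)$ for almost every $y>x$, and one that satisfies it for every $y>x$ equals $T_\lambda(x,y)$ for every $y>x$. The kernel $T_\lambda$ is continuous on $\{0<x\le y\}$, the function $x\mapsto T_\lambda(x,x)$ is locally absolutely continuous on $(0,\infty)$, and with $q(x)=-2\frac{d}{dx}T_\lambda(x,x)$, which is locally integrable on $(0,\infty)$, $$\frac{\partial^2T_\lambda}{\partial x^2}-\frac{\partial^2T_\lambda}{\partial y^2}-q(x)T_\lambda(x,y)=0\qquad(0<x<y)$$ in the sense of distributions. If moreover $\phi$ is twice continuously differentiable on $(0,\infty)$, then $x\mapsto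 T_\lambda(x,x)$ is $C^1$ on $(0,\infty)$, $T_\lambda$ is $C^2$ on $\{0<x<y\}$, and the differential equation holds pointwise. (ii) Suppose further that $m=1$ and that for all $x>0$ the operators $\Theta_x,\Xi_x:L^2((0,\infty);H_0)\to H$ are Hilbert–Schmidt, where $\Theta_x^\dagger$ is the continuous extension to $H$ of $\xi\mapsto Ce^{-(x+t)A}\xi$ $(\xi\in D(A))$ and $\Xi_xf=\int_0^\infty e^{-(x+t)A}Bf(t)\,dt$ (weakly). Let $\Gamma_{\phi_{(x)}}$ be the Hankel integral operator on $L^2(0,\infty)$ with scalar kernel $\phi(2x+s+t)$. Then the Fredholm series $$\det(I+\lambda\Gamma_{\phi_{(x)}})=\sum_{n=0}^\infty\frac{\lambda^n}{n!}\int_{(0,\infty)^n}\det\bigl[\phi(2x+t_i+t_j)\bigr]_{i,j=1}^n\,dt_1\cdots dt_n$$ converges absolutely for every $x>0$, its sum is non-zero and has a differentiable logarithm on $(0,\infty)$, and $$T_\lambda(x,x)=\frac{d}{dx}\log\det(I+\lambda\Gamma_{\phi_{(x)}})\qquad(x>0).$$ -/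

import Mathlib

open Set Filter Topology MeasureTheory
open scoped ContDiff

noncomputable section

/-- A linear system `(-A, B, C)` with state space `H` and finite-dimensional output space `H₀`.
`S t` stands for `e^{-tA}`; only its values for `t ≥ 0` matter. -/
structure LinearSystem (H H₀ : Type*)
    [NormedAddCommGroup H] [InnerProductSpace ℂ H]
    [NormedAddCommGroup H₀] [InnerProductSpace ℂ H₀] where
  /-- the semigroup `t ↦ e^{-tA}` -/
  S : ℝ → H →L[ℂ] H
  /-- the operator `A`, with domain `D(A)`; the generator of the semigroup is `-A` -/
  A : H →ₗ.[ℂ] H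
  /-- the input operator `H₀ → D(A)` -/
  B : H₀ →ₗ[ℂ] A.domain
  /-- the output operator `D(A) → H₀` -/
  C : A.domain →ₗ[ℂ] H₀
  S_zero : S 0 = 1
  S_add : ∀ s t : ℝ, 0 ≤ s → 0 ≤ t → S (s + t) = S s * S t
  S_tendsto : ∀ ξ : H, Tendsto (fun t : ℝ => S t ξ) (𝓝[>] 0) (𝓝 ξ)
  S_bounded : ∃ M : ℝ, ∀ t : ℝ, 0 ≤ t → ‖S t‖ ≤ M
  /-- `ξ ∈ D(A)` and `Aξ = η` exactly when `(ξ - e^{-tA}ξ)/t → η` as `t → 0+`. -/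
  generator : ∀ ξ η : H,
    (ξ, η) ∈ A.graph ↔ Tendsto (fun t : ℝ => t⁻¹ • (ξ - S t ξ)) (𝓝[>] 0) (𝓝 η)
  /-- `C` is bounded for the graph norm of `D(A)`. -/
  C_bounded : ∃ K : ℝ, ∀ ξ : A.domain, ‖C ξ‖ ≤ K * √(‖(ξ : H)‖ ^ 2 + ‖A ξ‖ ^ 2)

/-- A bounded operator between Hilbert spaces is Hilbert-Schmidt if the squares of the norms of the
images of the vectors of some orthonormal basis are summable (this does not depend on the basis). -/
def IsHilbertSchmidt {E F : Type*} [NormedAddCommGroup E] [InnerProductSpace ℂ E]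
    [NormedAddCommGroup F] [InnerProductSpace ℂ F] (L : E →L[ℂ] F) : Prop :=
  ∃ (w : Set E) (b : HilbertBasis w ℂ E), Summable fun i => ‖L (b i)‖ ^ 2

/-- The `n`-th term of the Fredholm series of `det (I + λ K)`, where `K` is the integral operator
on `L²(μ)` with kernel `k`:
`(λ^n / n!) ∫ ⋯ ∫ det [k(t_i, t_j)]_{i,j = 1, …, n} dμ(t_1) ⋯ dμ(t_n)`. -/
def fredholmTerm (μ : Measure ℝ) (k : ℝ → ℝ → ℂ) (lam : ℂ) (n : ℕ) : ℂ :=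
  lam ^ n / (n.factorial : ℂ) *
    ∫ t : Fin n → ℝ, Matrix.det (Matrix.of fun i j => k (t i) (t j)) ∂(Measure.pi fun _ => μ)

/-- The Fredholm determinant `det (I + λ K)` of the integral operator `K` on `L²(μ)` with
kernel `k`. -/
def fredholmDet (μ : Measure ℝ) (k : ℝ → ℝ → ℂ) (lam : ℂ) : ℂ :=
  ∑' n : ℕ, fredholmTerm μ k lam n

/-- The Fredholm series is well defined: all its integrals converge absolutely, and so does the
series. -/
def FredholmConvergent (μ : Measure ℝ) (k : ℝ → ℝ → ℂ) (lam : ℂ) : Prop :=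
  (∀ n : ℕ, Integrable (fun t : Fin n → ℝ => Matrix.det (Matrix.of fun i j => k (t i) (t j)))
    (Measure.pi fun _ => μ)) ∧
  Summable fun n : ℕ => ‖fredholmTerm μ k lam n‖

namespace LinearSystem

variable {H H₀ : Type*}
  [NormedAddCommGroup H] [InnerProductSpace ℂ H] [CompleteSpace H]
  [NormedAddCommGroup H₀] [InnerProductSpace ℂ H₀] [CompleteSpace H₀] [FiniteDimensional ℂ H₀]

open Classical in
/-- `C ξ` for a vector `ξ` of `H`; it is set to `0` outside `D(A)`. -/
def applyC (sys : LinearSystem H H₀) (ξ : H) : H₀ :=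
  if h : ξ ∈ sys.A.domain then sys.C ⟨ξ, h⟩ else 0

/-- `B` as a bounded operator `H₀ → H`. -/
def inputOp (sys : LinearSystem H H₀) : H₀ →L[ℂ] H :=
  LinearMap.toContinuousLinearMap (sys.A.domain.subtype ∘ₗ sys.B)

open Classical in
/-- The operator `C L` on `H₀`, for `L : H₀ → H` with range in `D(A)`
(set to `0` if the range is not in `D(A)`). -/
def compC (sys : LinearSystem H H₀) (L : H₀ →L[ℂ] H) : H₀ →L[ℂ] H₀ :=
  if h : ∀ u, L u ∈ sys.A.domain then
    LinearMap.toContinuousLinearMap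
      (sys.C ∘ₗ LinearMap.codRestrict sys.A.domain (L : H₀ →ₗ[ℂ] H) h)
  else 0

/-- `φ(x) = C e^{-xA} B`. -/
def phi (sys : LinearSystem H H₀) (x : ℝ) : H₀ →L[ℂ] H₀ :=
  sys.compC (sys.S x ∘L sys.inputOp)

/-- `∫_0^∞ ‖C e^{-sA} ξ‖² ds ≤ K² ‖ξ‖²`: `C` is admissible for `e^{-sA}` with constant `K`. As
usual the inequality is required on the dense subspace `D(A)`, where `C e^{-sA} ξ` is defined; it
says that `ξ ↦ C e^{-sA} ξ` extends to an operator `H → L²((0,∞); H₀)` of norm at most `K`. -/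
def ObservationBound (sys : LinearSystem H H₀) (K : NNReal) : Prop :=
  ∀ ξ ∈ sys.A.domain, ∫⁻ s in Ioi (0 : ℝ), ‖sys.applyC (sys.S s ξ)‖ₑ ^ 2 ≤ K ^ 2 * ‖ξ‖ₑ ^ 2

/-- `∫_0^∞ ‖B† e^{-sA†} η‖² ds ≤ K² ‖η‖²`: `B†` is admissible for `e^{-sA†}` with constant `K`. -/
def ControlBound (sys : LinearSystem H H₀) (K : NNReal) : Prop :=
  ∀ η : H, ∫⁻ s in Ioi (0 : ℝ),
    ‖ContinuousLinearMap.adjoint sys.inputOp (ContinuousLinearMap.adjoint (sys.S s) η)‖ₑ ^ 2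
      ≤ K ^ 2 * ‖η‖ₑ ^ 2

/-- `R ξ = ∫_x^∞ e^{-yA} B C e^{-yA} ξ dy`, a norm convergent improper integral for `ξ` in the
dense subspace `D(A)`. -/
def IsR (sys : LinearSystem H H₀) (x : ℝ) (R : H →L[ℂ] H) : Prop :=
  ∀ ξ ∈ sys.A.domain, Tendsto
    (fun N : ℝ => ∫ y in x..N, sys.S y (sys.inputOp (sys.applyC (sys.S y ξ)))) atTop (𝓝 (R ξ))

open Classical in
/-- The bounded operator `R_x` on `H` (set to `0` if there is none). -/
def R (sys : LinearSystem H H₀) (x : ℝ) : H →L[ℂ] H :=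
  if h : ∃ R, sys.IsR x R then h.choose else 0

/-- The operator `e^{-xA} (I + λ R_x)⁻¹ e^{-yA} B : H₀ → H`. -/
def preT (sys : LinearSystem H H₀) (lam : ℂ) (x y : ℝ) : H₀ →L[ℂ] H :=
  sys.S x ∘L Ring.inverse (1 + lam • sys.R x) ∘L sys.S y ∘L sys.inputOp

/-- `T_λ(x, y) = -λ C e^{-xA} (I + λ R_x)⁻¹ e^{-yA} B`. -/
def T (sys : LinearSystem H H₀) (lam : ℂ) (x y : ℝ) : H₀ →L[ℂ] H₀ :=
  -lam • sys.compC (sys.preT lam x y)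

/-- `q(x) = -2 (d/dx) T_λ(x, x)`. -/
def q (sys : LinearSystem H H₀) (lam : ℂ) (x : ℝ) : H₀ →L[ℂ] H₀ :=
  (-2 : ℂ) • deriv (fun s : ℝ => sys.T lam s s) x

/-- The Gelfand-Levitan equation at `(x, y)` for the function `F = F(x, ·)`:
`F(y) + λ φ(x + y) + λ ∫_x^∞ F(z) φ(z + y) dz = 0`, with absolutely convergent integral. -/
def GelfandLevitanAt (sys : LinearSystem H H₀) (lam : ℂ) (x y : ℝ) (F : ℝ → H₀ →L[ℂ] H₀) : Prop :=
  IntegrableOn (fun z => F z ∘L sys.phi (z + y)) (Ioi x) ∧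
  F y + lam • sys.phi (x + y) + lam • ∫ z in Ioi x, F z ∘L sys.phi (z + y) = 0

/-- `L = Θ_x`: the bounded operator `L²((0,∞); H₀) → H` whose adjoint is the continuous extension
of `ξ ↦ C e^{-(x+t)A} ξ`, `ξ ∈ D(A)`. -/
def IsTheta (sys : LinearSystem H H₀) (x : ℝ)
    (L : Lp H₀ 2 (volume.restrict (Ioi (0 : ℝ))) →L[ℂ] H) : Prop :=
  ∀ ξ ∈ sys.A.domain, (ContinuousLinearMap.adjoint L ξ : ℝ → H₀)
    =ᵐ[volume.restrict (Ioi (0 : ℝ))] fun t => sys.applyC (sys.S (x + t) ξ)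

/-- `L = Ξ_x`, `Ξ_x f = ∫_0^∞ e^{-(x+t)A} B f(t) dt` in the weak sense: the adjoint of `L` is
`η ↦ B† e^{-(x+t)A†} η`. -/
def IsXi (sys : LinearSystem H H₀) (x : ℝ)
    (L : Lp H₀ 2 (volume.restrict (Ioi (0 : ℝ))) →L[ℂ] H) : Prop :=
  ∀ η : H, (ContinuousLinearMap.adjoint L η : ℝ → H₀)
    =ᵐ[volume.restrict (Ioi (0 : ℝ))] fun t =>
      ContinuousLinearMap.adjoint sys.inputOp (ContinuousLinearMap.adjoint (sys.S (x + t)) η)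

/-- The scalar kernel `φ_{(x)}(s + t) = φ(2x + s + t)` of the Hankel operator `Γ_{φ_{(x)}}` on
`L²(0,∞)` when `H₀` is one-dimensional (the scalar by which an operator acts is its trace). -/
def hankelKernel (sys : LinearSystem H H₀) (x s t : ℝ) : ℂ :=
  LinearMap.trace ℂ H₀ (sys.phi (2 * x + s + t) : H₀ →ₗ[ℂ] H₀)

/-- `det (I + λ Γ_{φ_{(x)}})`, for one-dimensional `H₀`. -/
def hankelDet (sys : LinearSystem H H₀) (lam : ℂ) (x : ℝ) : ℂ :=
  fredholmDet (volume.restrict (Ioi (0 : ℝ))) (sys.hankelKernel x) lam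

end LinearSystem

end

set_option linter.unusedSectionVars false
set_option linter.unusedVariables false

/-! The two admissibility bounds say that the output map `obs`, ξ ↦ C e^{-sA} ξ, from H to L²(0,∞)
and the input map `ctrl`, f ↦ ∫ e^{-sA} B f(s) ds, back to H are contractions, even after
composition with the semigroup. Hence `R₀ = ctrl ∘L obs` and R_x = e^{-xA} R₀ e^{-xA} have norm at
most one, and for |λ| < 1 the operator I + λ R_x has an inverse N. For the kernel built from N the
Gelfand-Levitan equation is the identity N + λ N R_x = I (`gelfandLevitan_T`). A square integrable
solution of the homogeneous equation defines an operator on H that vanishes on the range of I + λ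
R_x, hence is zero (`integral_comp_phi_eq_zero`).

The difficulty is that C is unbounded. Because its range is finite-dimensional, C = C₀ + C₁ A on
D(A) with bounded C₀ and C₁ (`exists_C_eq`), and C e^{-yA} R₀ has a bounded extension given by the
bilinear pairing `G` (`applyC_S_R₀`). Together with the Lyapunov equation A R₀ + R₀ A = BC
(`R₀_mem_graph`) this shows that N preserves D(A), with a formula for A N that involves the inverse
for -λ (`N_mem_graph`).

Write T_λ = -λ K_λ. The Leibniz rule `G_add_G` yields the first-order system ∂_x K_λ - ∂_y K_{-λ} =
p K_λ, ∂_x K_{-λ} - ∂_y K_λ = -p K_{-λ}, where p(x) = λ (K_λ(x,x) + K_{-λ}(x,x)). Elimination of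
K_{-λ} leaves a wave equation with potential p' + p², which is q by the Miura identity
`smul_Kdiag_add`. In general φ is only absolutely continuous, with square integrable derivative, so
the elimination is carried out against test functions (`integral_wave_smul`). The remainder J in
K_λ(x,y) = φ(x+y) - λ J(x,y) is always C¹; if φ is C² then so is J, and the equation holds pointwise
(`wave_T`).

In the scalar case the Hilbert-Schmidt hypotheses give |φ(s+t)| ≤ w(s) w(t) with w square integrable
(`exists_hankelBound`), so Hadamard's inequality makes the series of the Fredholm determinant D(x)
and of the first minor converge. Ordering each integral by its least variable gives D' = -λ times
the diagonal minor (`fredholmSum_eq`). Fredholm's first relation and the uniqueness for the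
Gelfand-Levitan equation identify -λ times the minor with D(x) T_λ(x,x) (`fredholmMinor_diag`). So
D' = D T_λ(x,x) and D tends to 1 at infinity: D has no zero, and the formula for its logarithm
follows. -/

/-- Right averages of a function that is continuous on `[0, ∞)` converge to its value. -/
theorem tendsto_inv_smul_integral {E : Type*} [NormedAddCommGroup E] [NormedSpace ℝ E]
    [CompleteSpace E] {f : ℝ → E} (hf : ContinuousOn f (Ici 0)) {t : ℝ} (ht : 0 ≤ t) :
    Tendsto (fun h : ℝ => h⁻¹ • ∫ s in t..(t + h), f s) (𝓝[>] 0) (𝓝 (f t)) := by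
  have h1 : HasDerivWithinAt (fun u => ∫ s in t..u, f s) (f t) (Ici t) t := by
    refine intervalIntegral.integral_hasDerivWithinAt_right (by simp) (t := Ioi t) ?_ ?_
    · exact (hf.mono (Ioi_subset_Ici_self.trans (Ici_subset_Ici.2 ht)))
        |>.stronglyMeasurableAtFilter_nhdsWithin measurableSet_Ioi t
    · exact (hf t ht).mono (Ioi_subset_Ici_self.trans (Ici_subset_Ici.2 ht))
  have h2 := (hasDerivWithinAt_iff_tendsto_slope' (by simp)).1 (h1.mono Ioi_subset_Ici_self)
  have h3 : Tendsto (fun h : ℝ => t + h) (𝓝[>] 0) (𝓝[>] t) := by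
    refine tendsto_nhdsWithin_iff.2 ⟨?_, ?_⟩
    · have : Tendsto (fun h : ℝ => t + h) (𝓝 0) (𝓝 (t + 0)) := by
        exact (continuous_const.add continuous_id).tendsto 0
      rw [add_zero] at this
      exact this.mono_left nhdsWithin_le_nhds
    · filter_upwards [self_mem_nhdsWithin] with h hh
      simpa using hh
  refine (h2.comp h3).congr fun h => ?_
  simp [slope_def_module]

/-- A bounded family of operators that converges at a point converges along vectors converging to
that point. -/
theorem tendsto_clm_apply_of_bounded {𝕜 E F α : Type*} [NontriviallyNormedField 𝕜]
    [NormedAddCommGroup E] [NormedSpace 𝕜 E] [NormedAddCommGroup F] [NormedSpace 𝕜 F]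
    {l : Filter α} {L : α → E →L[𝕜] F} {g : α → E} {ξ : E} {η : F} {M : ℝ}
    (hM : ∀ᶠ a in l, ‖L a‖ ≤ M) (hL : Tendsto (fun a => L a ξ) l (𝓝 η))
    (hg : Tendsto g l (𝓝 ξ)) : Tendsto (fun a => L a (g a)) l (𝓝 η) := by
  have h1 : Tendsto (fun a => L a (g a - ξ)) l (𝓝 0) := by
    have h2 : Tendsto (fun a => M * ‖g a - ξ‖) l (𝓝 0) := by
      have := (tendsto_iff_norm_sub_tendsto_zero.1 hg).const_mul M
      simpa using this
    refine squeeze_zero_norm' ?_ h2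
    filter_upwards [hM] with a ha
    exact (L a).le_of_opNorm_le ha _
  have := h1.add hL
  simp only [zero_add] at this
  refine this.congr fun a => ?_
  simp

/-! ### Strongly continuous semigroups and their generators. -/

namespace LinearSystem

variable {H H₀ : Type*}
  [NormedAddCommGroup H] [InnerProductSpace ℂ H]
  [NormedAddCommGroup H₀] [InnerProductSpace ℂ H₀]
  (sys : LinearSystem H H₀)

theorem exists_bound : ∃ M : ℝ, 0 < M ∧ ∀ t : ℝ, 0 ≤ t → ‖sys.S t‖ ≤ M := by
  obtain ⟨M, hM⟩ := sys.S_bounded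
  exact ⟨max M 1, by positivity, fun t ht => (hM t ht).trans (le_max_left _ _)⟩

theorem S_add_apply {s t : ℝ} (hs : 0 ≤ s) (ht : 0 ≤ t) (ξ : H) :
    sys.S (s + t) ξ = sys.S s (sys.S t ξ) := by
  rw [sys.S_add s t hs ht]; rfl

theorem S_comm_apply {s t : ℝ} (hs : 0 ≤ s) (ht : 0 ≤ t) (ξ : H) :
    sys.S s (sys.S t ξ) = sys.S t (sys.S s ξ) := by
  rw [← sys.S_add_apply hs ht, ← sys.S_add_apply ht hs, add_comm]

theorem S_zero_apply (ξ : H) : sys.S 0 ξ = ξ := by rw [sys.S_zero]; rfl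

/-- Right continuity at 0 spreads to all times, from both sides, because the operator of the earlier
time factors out of the difference at the cost of the uniform bound `M`. -/
theorem continuousOn_S (ξ : H) : ContinuousOn (fun t => sys.S t ξ) (Ici 0) := by
  obtain ⟨M, hM0, hM⟩ := sys.exists_bound
  have h0 : Tendsto (fun t => ‖sys.S t ξ - ξ‖) (𝓝[≥] 0) (𝓝 0) := by
    have h1 : ContinuousWithinAt (fun t => sys.S t ξ) (Ioi 0) 0 := by
      have := sys.S_tendsto ξ
      simpa [ContinuousWithinAt, sys.S_zero_apply] using this
    have h2 := continuousWithinAt_Ioi_iff_Ici.1 h1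
    have h3 : Tendsto (fun t => sys.S t ξ) (𝓝[≥] 0) (𝓝 ξ) := by
      simpa [ContinuousWithinAt, sys.S_zero_apply] using h2
    exact tendsto_iff_norm_sub_tendsto_zero.1 h3
  have key : ∀ s t : ℝ, 0 ≤ s → 0 ≤ t →
      ‖sys.S t ξ - sys.S s ξ‖ ≤ M * ‖sys.S |t - s| ξ - ξ‖ := by
    have aux : ∀ s t : ℝ, 0 ≤ s → s ≤ t →
        ‖sys.S t ξ - sys.S s ξ‖ ≤ M * ‖sys.S |t - s| ξ - ξ‖ := by
      intro s t hs hst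
      have e : sys.S t ξ - sys.S s ξ = sys.S s (sys.S |t - s| ξ - ξ) := by
        rw [abs_of_nonneg (sub_nonneg.2 hst), map_sub,
          ← sys.S_add_apply hs (sub_nonneg.2 hst), add_sub_cancel]
      rw [e]
      exact (sys.S s).le_of_opNorm_le (hM s hs) _
    intro s t hs ht
    rcases le_total s t with h | h
    · exact aux s t hs h
    · rw [norm_sub_rev, abs_sub_comm]; exact aux t s ht h
  intro t ht
  rw [ContinuousWithinAt, tendsto_iff_norm_sub_tendsto_zero]
  have habs : Tendsto (fun s : ℝ => |s - t|) (𝓝[Ici 0] t) (𝓝[≥] 0) := by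
    refine tendsto_nhdsWithin_iff.2 ⟨?_, .of_forall fun s => mem_Ici.2 (abs_nonneg _)⟩
    have : Tendsto (fun s : ℝ => |s - t|) (𝓝 t) (𝓝 |t - t|) := by
      exact (continuous_abs.comp (continuous_id.sub continuous_const)).tendsto t
    simp only [sub_self, abs_zero] at this
    exact this.mono_left nhdsWithin_le_nhds
  have h4 := (h0.comp habs).const_mul M
  simp only [mul_zero] at h4
  refine squeeze_zero' (.of_forall fun _ => norm_nonneg _) ?_ h4
  filter_upwards [self_mem_nhdsWithin] with s hs
  exact key t s ht hs

theorem tendsto_S_apply {α : Type*} {l : Filter α} {f : α → ℝ} {g : α → H} {t : ℝ} {ξ : H}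
    (ht : 0 ≤ t) (hf : Tendsto f l (𝓝 t)) (hf0 : ∀ᶠ a in l, 0 ≤ f a) (hg : Tendsto g l (𝓝 ξ)) :
    Tendsto (fun a => sys.S (f a) (g a)) l (𝓝 (sys.S t ξ)) := by
  obtain ⟨M, hM0, hM⟩ := sys.exists_bound
  refine tendsto_clm_apply_of_bounded (M := M) (hf0.mono fun a ha => hM _ ha) ?_ hg
  exact (sys.continuousOn_S ξ t ht).tendsto.comp (tendsto_nhdsWithin_iff.2 ⟨hf, hf0⟩)

theorem continuousOn_S_apply {X : Type*} [TopologicalSpace X] {s : Set X} {f : X → ℝ} {g : X → H}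
    (hf : ContinuousOn f s) (hf0 : ∀ x ∈ s, 0 ≤ f x) (hg : ContinuousOn g s) :
    ContinuousOn (fun x => sys.S (f x) (g x)) s := fun x hx =>
  sys.tendsto_S_apply (hf0 x hx) (hf x hx)
    (by filter_upwards [self_mem_nhdsWithin] with y hy using hf0 y hy) (hg x hx)

theorem S_mem_graph {ξ η : H} (h : (ξ, η) ∈ sys.A.graph) {t : ℝ} (ht : 0 ≤ t) :
    (sys.S t ξ, sys.S t η) ∈ sys.A.graph := by
  rw [sys.generator] at h ⊢
  refine (((sys.S t).continuous.tendsto η).comp h).congr' ?_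
  filter_upwards [self_mem_nhdsWithin] with s hs
  rw [Function.comp_apply, ← Complex.coe_smul, map_smul, map_sub, Complex.coe_smul,
    sys.S_comm_apply ht (le_of_lt hs)]

theorem hasDerivWithinAt_S {ξ η : H} (h : (ξ, η) ∈ sys.A.graph) {t : ℝ} (ht : 0 ≤ t) :
    HasDerivWithinAt (fun s => sys.S s ξ) (-sys.S t η) (Ioi t) t := by
  have h1 := (sys.generator _ _).1 (sys.S_mem_graph h ht)
  rw [hasDerivWithinAt_iff_tendsto_slope' (by simp)]
  have h3 : Tendsto (fun s : ℝ => s - t) (𝓝[>] t) (𝓝[>] 0) := by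
    refine tendsto_nhdsWithin_iff.2 ⟨?_, ?_⟩
    · have : Tendsto (fun h : ℝ => h - t) (𝓝 t) (𝓝 (t - t)) := by
        exact (continuous_id.sub continuous_const).tendsto t
      rw [sub_self] at this
      exact this.mono_left nhdsWithin_le_nhds
    · filter_upwards [self_mem_nhdsWithin] with h hh
      simpa using hh
  refine (h1.comp h3).neg.congr' ?_
  filter_upwards [self_mem_nhdsWithin] with s hs
  have hs' : t < s := hs
  rw [Function.comp_apply, ← sys.S_add_apply (sub_nonneg.2 hs'.le) ht, sub_add_cancel,
    slope_def_module, ← smul_neg, neg_sub]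

theorem intervalIntegrable_S (ξ : H) {a b : ℝ} (ha : 0 ≤ a) (hb : 0 ≤ b) :
    IntervalIntegrable (fun s => sys.S s ξ) volume a b :=
  ((sys.continuousOn_S ξ).mono fun x hx => (le_min ha hb).trans hx.1).intervalIntegrable

variable [CompleteSpace H]

theorem integral_S {ξ η : H} (h : (ξ, η) ∈ sys.A.graph) {a b : ℝ} (ha : 0 ≤ a) (hb : 0 ≤ b) :
    ∫ s in a..b, sys.S s η = sys.S a ξ - sys.S b ξ := by
  have := intervalIntegral.integral_eq_sub_of_hasDeriv_right (a := a) (b := b)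
    (f := fun s => sys.S s ξ) (f' := fun s => -sys.S s η)
    ((sys.continuousOn_S ξ).mono fun x hx => (le_min ha hb).trans hx.1)
    (fun x hx => sys.hasDerivWithinAt_S h ((le_min ha hb).trans hx.1.le))
    (sys.intervalIntegrable_S η ha hb).neg
  rw [intervalIntegral.integral_neg] at this
  rw [← neg_inj, this, neg_sub]

/-- The generator controls right difference quotients only. The left ones come from the integral
formula `integral_S`, whose integrand is continuous. -/
theorem hasDerivAt_S {ξ η : H} (h : (ξ, η) ∈ sys.A.graph) {t : ℝ} (ht : 0 < t) :
    HasDerivAt (fun s => sys.S s ξ) (-sys.S t η) t := by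
  have hc : ContinuousAt (fun s => sys.S s η) t :=
    (sys.continuousOn_S η).continuousAt (Ici_mem_nhds ht)
  have h1 : HasDerivAt (fun u => ∫ s in t..u, sys.S s η) (sys.S t η) t :=
    intervalIntegral.integral_hasDerivAt_right (by simp)
      (((sys.continuousOn_S η).mono Ioi_subset_Ici_self).stronglyMeasurableAtFilter isOpen_Ioi t ht)
      hc
  refine ((h1.neg).const_add (sys.S t ξ)).congr_of_eventuallyEq ?_
  filter_upwards [Ioi_mem_nhds ht] with s hs
  change sys.S s ξ = sys.S t ξ + -∫ r in t..s, sys.S r η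
  rw [sys.integral_S h ht.le (le_of_lt hs)]
  abel

/-- The average `h⁻¹ ∫_0^h S(s) ds`. -/
noncomputable def avg (h : ℝ) : H →L[ℂ] H :=
  if hh : 0 ≤ h then
    LinearMap.mkContinuousOfExistsBound
      { toFun := fun ξ => h⁻¹ • ∫ s in (0:ℝ)..h, sys.S s ξ
        map_add' := fun ξ η => by
          simp only [map_add]
          rw [intervalIntegral.integral_add (sys.intervalIntegrable_S ξ le_rfl hh)
            (sys.intervalIntegrable_S η le_rfl hh), smul_add]
        map_smul' := fun c ξ => by
          simp only [map_smul, RingHom.id_apply]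
          rw [intervalIntegral.integral_smul, smul_comm] }
      (by
        obtain ⟨M, hM0, hM⟩ := sys.exists_bound
        refine ⟨‖h⁻¹‖ * (M * |h - 0|), fun ξ => ?_⟩
        simp only [LinearMap.coe_mk, AddHom.coe_mk, norm_smul]
        rw [mul_assoc]
        refine mul_le_mul_of_nonneg_left ?_ (norm_nonneg _)
        rw [mul_right_comm]
        refine intervalIntegral.norm_integral_le_of_norm_le_const fun s hs => ?_
        rw [uIoc_of_le hh] at hs
        exact (sys.S s).le_of_opNorm_le (hM s hs.1.le) ξ)
  else 0

theorem avg_apply {h : ℝ} (hh : 0 ≤ h) (ξ : H) :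
    sys.avg h ξ = h⁻¹ • ∫ s in (0:ℝ)..h, sys.S s ξ := by
  rw [avg, dif_pos hh]; rfl

theorem tendsto_avg (ξ : H) : Tendsto (fun h => sys.avg h ξ) (𝓝[>] 0) (𝓝 ξ) := by
  have := tendsto_inv_smul_integral (sys.continuousOn_S ξ) le_rfl
  rw [sys.S_zero_apply] at this
  refine this.congr' ?_
  filter_upwards [self_mem_nhdsWithin] with h hh
  rw [sys.avg_apply (le_of_lt hh), zero_add]

theorem S_integral {a b t : ℝ} (ha : 0 ≤ a) (hb : 0 ≤ b) (ht : 0 ≤ t) (ξ : H) :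
    sys.S t (∫ s in a..b, sys.S s ξ) = ∫ s in (a + t)..(b + t), sys.S s ξ := by
  rw [← (sys.S t).intervalIntegral_comp_comm (sys.intervalIntegrable_S ξ ha hb),
    ← intervalIntegral.integral_comp_add_right]
  refine intervalIntegral.integral_congr fun s hs => ?_
  have hs0 : 0 ≤ s := (le_min ha hb).trans hs.1
  rw [add_comm, sys.S_add_apply ht hs0]

/-- Telescoping: I - S(r) applied to ∫_0^h leaves ∫_0^r - ∫_h^{h+r}, whose averages converge as r →
0. Averaging thus moves any vector into the domain; this gives its density and, later, bounded
approximations of C. -/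
theorem avg_mem_graph {h : ℝ} (hh : 0 < h) (ξ : H) :
    (sys.avg h ξ, h⁻¹ • (ξ - sys.S h ξ)) ∈ sys.A.graph := by
  have key : ((∫ s in (0:ℝ)..h, sys.S s ξ), ξ - sys.S h ξ) ∈ sys.A.graph := by
    rw [sys.generator]
    have h1 := tendsto_inv_smul_integral (sys.continuousOn_S ξ) le_rfl
    have h2 := tendsto_inv_smul_integral (sys.continuousOn_S ξ) hh.le
    rw [sys.S_zero_apply] at h1
    refine (h1.sub h2).congr' ?_
    filter_upwards [self_mem_nhdsWithin] with r hr
    have hr0 : (0:ℝ) ≤ r := le_of_lt hr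
    rw [sys.S_integral le_rfl hh.le hr0, ← smul_sub]
    congr 1
    have i := fun {a b : ℝ} (ha : 0 ≤ a) (hb : 0 ≤ b) => sys.intervalIntegrable_S ξ ha hb
    rw [zero_add, sub_eq_sub_iff_add_eq_add,
      intervalIntegral.integral_add_adjacent_intervals (i hr0 le_rfl |>.symm) (i hr0 (by positivity)),
      intervalIntegral.integral_add_adjacent_intervals (i le_rfl hh.le) (i hh.le (by positivity))]
  rw [sys.avg_apply hh.le]
  have := sys.A.graph.smul_mem ((h⁻¹ : ℝ) : ℂ) key
  rwa [Prod.smul_mk, Complex.coe_smul, Complex.coe_smul] at this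

theorem avg_S {h t : ℝ} (hh : 0 ≤ h) (ht : 0 ≤ t) (ξ : H) :
    sys.avg h (sys.S t ξ) = sys.S t (sys.avg h ξ) := by
  rw [sys.avg_apply hh, sys.avg_apply hh, ← Complex.coe_smul, ← Complex.coe_smul, map_smul,
    ← (sys.S t).intervalIntegral_comp_comm (sys.intervalIntegrable_S ξ le_rfl hh)]
  congr 1
  refine intervalIntegral.integral_congr fun s hs => ?_
  rw [uIcc_of_le hh] at hs
  exact sys.S_comm_apply hs.1 ht ξ

theorem mem_domain_of_mem_graph {ξ η : H} (h : (ξ, η) ∈ sys.A.graph) : ξ ∈ sys.A.domain :=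
  LinearPMap.mem_domain_of_mem_graph h

theorem dense_domain : Dense (sys.A.domain : Set H) := by
  intro ξ
  refine mem_closure_of_tendsto (sys.tendsto_avg ξ) ?_
  filter_upwards [self_mem_nhdsWithin] with h hh
  exact sys.mem_domain_of_mem_graph (sys.avg_mem_graph hh ξ)

theorem mem_graph_unique {ξ η η' : H} (h : (ξ, η) ∈ sys.A.graph) (h' : (ξ, η') ∈ sys.A.graph) :
    η = η' :=
  tendsto_nhds_unique ((sys.generator _ _).1 h) ((sys.generator _ _).1 h')

theorem exists_mem_graph {ξ : H} (h : ξ ∈ sys.A.domain) : ∃ η, (ξ, η) ∈ sys.A.graph :=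
  ⟨sys.A ⟨ξ, h⟩, sys.A.mem_graph ⟨ξ, h⟩⟩

end LinearSystem

/-! ### Square integrable functions, and operators on a finite-dimensional space. -/

/-- Lebesgue measure on the half line `(0, ∞)`. -/
noncomputable abbrev halfLine : Measure ℝ := volume.restrict (Ioi (0 : ℝ))

theorem measurePreserving_add_halfLine (x : ℝ) :
    MeasurePreserving (fun t => t + x) halfLine (volume.restrict (Ioi x)) := by
  have h := (measurePreserving_add_right volume x).restrict_preimage (measurableSet_Ioi (a := x))
  have e : (fun t : ℝ => t + x) ⁻¹' Ioi x = Ioi 0 := by ext t; simp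
  rwa [e] at h

theorem eLpNorm_two_le {α E : Type*} [MeasurableSpace α] {μ : Measure α} [NormedAddCommGroup E]
    {f : α → E} {c : ENNReal} (h : ∫⁻ a, ‖f a‖ₑ ^ 2 ∂μ ≤ c ^ 2) : eLpNorm f 2 μ ≤ c := by
  rw [eLpNorm_eq_lintegral_rpow_enorm_toReal two_ne_zero ENNReal.ofNat_ne_top]
  simp only [ENNReal.toReal_ofNat, ENNReal.rpow_two]
  calc _ ≤ (c ^ 2) ^ (1 / (2 : ℝ)) := ENNReal.rpow_le_rpow h (by norm_num)
    _ = c := by rw [← ENNReal.rpow_natCast, ← ENNReal.rpow_mul]; norm_num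

theorem lintegral_enorm_sq_eq {α E : Type*} [MeasurableSpace α] {μ : Measure α}
    [NormedAddCommGroup E] {f : α → E} : ∫⁻ a, ‖f a‖ₑ ^ 2 ∂μ = eLpNorm f 2 μ ^ 2 := by
  rw [eLpNorm_eq_lintegral_rpow_enorm_toReal two_ne_zero ENNReal.ofNat_ne_top,
    ← ENNReal.rpow_two, ← ENNReal.rpow_mul]
  simp

theorem norm_toLp_two_le {α E : Type*} [MeasurableSpace α] {μ : Measure α} [NormedAddCommGroup E]
    {f : α → E} (hf : MemLp f 2 μ) {c : ℝ} (hc : 0 ≤ c)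
    (h : ∫⁻ a, ‖f a‖ₑ ^ 2 ∂μ ≤ ENNReal.ofReal c ^ 2) : ‖hf.toLp f‖ ≤ c := by
  rw [Lp.norm_toLp]
  exact ENNReal.toReal_le_of_le_ofReal hc (eLpNorm_two_le h)

theorem memLp_two_of_lintegral_le {α E : Type*} [MeasurableSpace α] {μ : Measure α}
    [NormedAddCommGroup E] {f : α → E} (hf : AEStronglyMeasurable f μ) {c : ENNReal}
    (hc : c ≠ ⊤) (h : ∫⁻ a, ‖f a‖ₑ ^ 2 ∂μ ≤ c ^ 2) : MemLp f 2 μ :=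
  ⟨hf, (eLpNorm_two_le h).trans_lt hc.lt_top⟩

section FiniteDim

variable {E F G α : Type*} [NormedAddCommGroup E] [InnerProductSpace ℂ E] [FiniteDimensional ℂ E]
  [NormedAddCommGroup F] [NormedSpace ℂ F]
  [NormedAddCommGroup G] [NormedSpace ℂ G]

/-- The operator `v ↦ ⟪e_j, v⟫ w`, as a linear function of `w`. -/
noncomputable def dyad (F : Type*) [NormedAddCommGroup F] [NormedSpace ℂ F]
    (j : Fin (Module.finrank ℂ E)) : F →L[ℂ] E →L[ℂ] F :=
  ContinuousLinearMap.smulRightL ℂ E F (innerSL ℂ (stdOrthonormalBasis ℂ E j))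

theorem dyad_apply (j : Fin (Module.finrank ℂ E)) (w : F) (v : E) :
    dyad F j w v = inner ℂ (stdOrthonormalBasis ℂ E j) v • w := rfl

/-- Expansion over an orthonormal basis. It reduces limits, derivatives and integrability of
operators on a finite-dimensional space to those of their values at vectors. -/
theorem sum_dyad (X : E →L[ℂ] F) :
    ∑ j, dyad F j (X (stdOrthonormalBasis ℂ E j)) = X := by
  ext v
  conv_rhs => rw [← (stdOrthonormalBasis ℂ E).sum_repr' v, map_sum]
  rw [sum_apply]
  simp only [dyad_apply, map_smul]

theorem tendsto_clm_of_apply {l : Filter α} {f : α → E →L[ℂ] F} {X : E →L[ℂ] F}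
    (h : ∀ u, Tendsto (fun a => f a u) l (𝓝 (X u))) : Tendsto f l (𝓝 X) := by
  have : Tendsto (fun a => ∑ j, dyad F j (f a (stdOrthonormalBasis ℂ E j))) l
      (𝓝 (∑ j, dyad F j (X (stdOrthonormalBasis ℂ E j)))) :=
    tendsto_finsetSum _ fun j _ => ((dyad F j).continuous.tendsto _).comp (h _)
  simpa only [sum_dyad] using this

theorem hasDerivAt_clm_of_apply {f : ℝ → E →L[ℂ] F} {f' : E →L[ℂ] F} {x : ℝ}
    (h : ∀ u, HasDerivAt (fun s => f s u) (f' u) x) : HasDerivAt f f' x := by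
  rw [hasDerivAt_iff_tendsto_slope]
  refine tendsto_clm_of_apply fun u => ?_
  have := hasDerivAt_iff_tendsto_slope.1 (h u)
  refine this.congr fun y => ?_
  simp [slope_def_module]

theorem memLp_clm_of_apply [MeasurableSpace α] {μ : Measure α} {p : ENNReal} {f : α → E →L[ℂ] F}
    (h : ∀ u, MemLp (fun a => f a u) p μ) : MemLp f p μ := by
  have : MemLp (fun a => ∑ j, dyad F j (f a (stdOrthonormalBasis ℂ E j))) p μ :=
    memLp_finsetSum (f := fun j a => dyad F j (f a (stdOrthonormalBasis ℂ E j))) _ fun j _ =>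
      ContinuousLinearMap.comp_memLp' (dyad F j) (h (stdOrthonormalBasis ℂ E j))
  simpa only [sum_dyad] using this

theorem MeasureTheory.MemLp.integrable_clm_apply [MeasurableSpace α] {μ : Measure α}
    {f : α → F →L[ℂ] G} {g : α → F} (hf : MemLp f 2 μ) (hg : MemLp g 2 μ) :
    Integrable (fun a => f a (g a)) μ :=
  memLp_one_iff_integrable.1
    ((ContinuousLinearMap.id ℂ (F →L[ℂ] G)).memLp_of_bilin 1 hf hg)

theorem MeasureTheory.MemLp.integrable_clm_comp {F' : Type*} [NormedAddCommGroup F']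
    [NormedSpace ℂ F'] [MeasurableSpace α] {μ : Measure α}
    {f : α → F →L[ℂ] G} {g : α → F' →L[ℂ] F} (hf : MemLp f 2 μ) (hg : MemLp g 2 μ) :
    Integrable (fun a => f a ∘L g a) μ :=
  memLp_one_iff_integrable.1
    ((ContinuousLinearMap.compL ℂ F' F G).memLp_of_bilin 1 hf hg)

end FiniteDim

/-! ### The observation and control operators. -/

namespace LinearSystem

variable {H H₀ : Type*}
  [NormedAddCommGroup H] [InnerProductSpace ℂ H] [CompleteSpace H]
  [NormedAddCommGroup H₀] [InnerProductSpace ℂ H₀] [CompleteSpace H₀] [FiniteDimensional ℂ H₀]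
  (sys : LinearSystem H H₀)

/-- C is bounded on the graph of A, a subspace of H × H, and has finite-dimensional range, so it
extends boundedly to the whole product. The components of the extension replace C by two bounded
operators, at the price of carrying Aξ along with ξ. -/
theorem exists_C_eq : ∃ C₀ C₁ : H →L[ℂ] H₀, ∀ ξ η : H, (ξ, η) ∈ sys.A.graph →
    sys.applyC ξ = C₀ ξ + C₁ η := by
  have hdom : ∀ z : sys.A.graph, (z : H × H).1 ∈ sys.A.domain := fun z =>
    LinearPMap.mem_domain_of_mem_graph z.2
  obtain ⟨K, hK⟩ := sys.C_bounded
  let f : sys.A.graph →ₗ[ℂ] H₀ :=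
    sys.C ∘ₗ LinearMap.codRestrict sys.A.domain (LinearMap.fst ℂ H H ∘ₗ sys.A.graph.subtype) hdom
  have hA : ∀ z : sys.A.graph, sys.A ⟨_, hdom z⟩ = (z : H × H).2 := fun z =>
    sys.mem_graph_unique (sys.A.mem_graph _) z.2
  let f' : sys.A.graph →L[ℂ] H₀ := LinearMap.mkContinuousOfExistsBound f (by
    -- H × H carries the maximum norm, and the graph norm is at most twice that; `K` could be
    -- negative, hence the absolute value.
    refine ⟨|K| * 2, fun z => (hK _).trans ?_⟩
    have h1 : ‖(z : H × H).1‖ ≤ ‖z‖ := norm_fst_le (z : H × H)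
    have h2 : ‖(z : H × H).2‖ ≤ ‖z‖ := norm_snd_le (z : H × H)
    have h3 : √(‖(z : H × H).1‖ ^ 2 + ‖(z : H × H).2‖ ^ 2) ≤ 2 * ‖z‖ := by
      refine Real.sqrt_le_iff.2 ⟨by positivity, ?_⟩
      nlinarith [norm_nonneg (z : H × H).1, norm_nonneg (z : H × H).2]
    have h4 : √(‖(z : H × H).1‖ ^ 2 + ‖sys.A ⟨_, hdom z⟩‖ ^ 2) ≤ 2 * ‖z‖ := by rw [hA]; exact h3
    calc K * √(‖(z : H × H).1‖ ^ 2 + ‖sys.A ⟨_, hdom z⟩‖ ^ 2)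
        ≤ |K| * (2 * ‖z‖) := by gcongr; exact le_abs_self K
      _ = _ := by ring)
  obtain ⟨g, hg⟩ := f'.exist_extension_of_finiteDimensional_range
  refine ⟨g ∘L ContinuousLinearMap.inl ℂ H H, g ∘L ContinuousLinearMap.inr ℂ H H,
    fun ξ η h => ?_⟩
  have h1 : g (ξ, η) = f' ⟨(ξ, η), h⟩ := by rw [hg]; rfl
  have h2 : f' ⟨(ξ, η), h⟩ = sys.applyC ξ := by
    rw [applyC, dif_pos (sys.mem_domain_of_mem_graph h)]; rfl
  rw [← h2, ← h1, ContinuousLinearMap.comp_apply, ContinuousLinearMap.comp_apply, ← map_add]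
  simp

/-- The first component of a bounded extension of `C` from the graph of `A` to `H × H`. -/
noncomputable def C₀ : H →L[ℂ] H₀ := sys.exists_C_eq.choose

/-- The second component of a bounded extension of `C` from the graph of `A` to `H × H`. -/
noncomputable def C₁ : H →L[ℂ] H₀ := sys.exists_C_eq.choose_spec.choose

theorem applyC_eq {ξ η : H} (h : (ξ, η) ∈ sys.A.graph) :
    sys.applyC ξ = sys.C₀ ξ + sys.C₁ η :=
  sys.exists_C_eq.choose_spec.choose_spec ξ η h

theorem applyC_S {ξ η : H} (h : (ξ, η) ∈ sys.A.graph) {s : ℝ} (hs : 0 ≤ s) :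
    sys.applyC (sys.S s ξ) = sys.C₀ (sys.S s ξ) + sys.C₁ (sys.S s η) :=
  sys.applyC_eq (sys.S_mem_graph h hs)

theorem continuousOn_CS {ξ η : H} : ContinuousOn
    (fun s => sys.C₀ (sys.S s ξ) + sys.C₁ (sys.S s η)) (Ici 0) :=
  (sys.C₀.continuous.comp_continuousOn (sys.continuousOn_S ξ)).add
    (sys.C₁.continuous.comp_continuousOn (sys.continuousOn_S η))

theorem continuousOn_applyC_S {ξ η : H} (h : (ξ, η) ∈ sys.A.graph) :
    ContinuousOn (fun s => sys.applyC (sys.S s ξ)) (Ici 0) :=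
  sys.continuousOn_CS.congr fun _ hs => sys.applyC_S h hs

/-- `C` and `B` are both admissible with constant `1`. -/
class IsContractive (sys : LinearSystem H H₀) : Prop where
  observationBound : sys.ObservationBound 1
  controlBound : sys.ControlBound 1

theorem memLp_CS [hs : sys.IsContractive] {ξ η : H} (h : (ξ, η) ∈ sys.A.graph) :
    MemLp (fun s => sys.C₀ (sys.S s ξ) + sys.C₁ (sys.S s η)) 2 halfLine := by
  refine memLp_two_of_lintegral_le (c := ‖ξ‖ₑ) ?_ enorm_ne_top ?_
  · exact (sys.continuousOn_CS.mono Ioi_subset_Ici_self).aestronglyMeasurable measurableSet_Ioi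
  · have := hs.observationBound ξ (sys.mem_domain_of_mem_graph h)
    simp only [ENNReal.coe_one, one_pow, one_mul] at this
    refine le_trans (le_of_eq ?_) this
    refine setLIntegral_congr_fun measurableSet_Ioi fun s hs => ?_
    simp only [sys.applyC_S h (le_of_lt hs)]

/-- Admissibility makes the output map a contraction on the dense domain, so it extends to all of H.
A pointwise formula remains available on the domain only. -/
theorem exists_obs [hs : sys.IsContractive] : ∃ L : H →L[ℂ] Lp H₀ 2 halfLine,
    ∀ ξ η : H, (ξ, η) ∈ sys.A.graph →
      L ξ =ᵐ[halfLine] fun s => sys.C₀ (sys.S s ξ) + sys.C₁ (sys.S s η) := by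
  let f : sys.A.domain →ₗ[ℂ] Lp H₀ 2 halfLine :=
    { toFun := fun ξ => (sys.memLp_CS (sys.A.mem_graph ξ)).toLp
      map_add' := fun ξ η => by
        rw [← MemLp.toLp_add]
        refine MemLp.toLp_congr _ _ (.of_forall fun s => ?_)
        simp only [Submodule.coe_add, LinearPMap.map_add, map_add, Pi.add_apply]
        abel
      map_smul' := fun c ξ => by
        rw [RingHom.id_apply, ← MemLp.toLp_const_smul]
        refine MemLp.toLp_congr _ _ (.of_forall fun s => ?_)
        simp only [SetLike.val_smul, LinearPMap.map_smul, map_smul, Pi.smul_apply, smul_add] }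
  have hd : DenseRange sys.A.domain.subtype := by
    rw [DenseRange, Submodule.coe_subtype, Subtype.range_coe]
    exact sys.dense_domain
  have hb : ∀ ξ, ‖f ξ‖ ≤ 1 * ‖sys.A.domain.subtype ξ‖ := fun ξ => by
    rw [one_mul]
    refine norm_toLp_two_le (sys.memLp_CS (sys.A.mem_graph ξ)) (norm_nonneg _) ?_
    have := hs.observationBound ξ ξ.2
    simp only [ENNReal.coe_one, one_pow, one_mul] at this
    rw [Submodule.subtype_apply, ofReal_norm]
    refine le_trans (le_of_eq ?_) this
    refine setLIntegral_congr_fun measurableSet_Ioi fun s hs => ?_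
    simp only [sys.applyC_S (sys.A.mem_graph ξ) (le_of_lt hs)]
  refine ⟨f.extendOfNorm sys.A.domain.subtype, fun ξ η h => ?_⟩
  have h1 := f.extendOfNorm_eq hd ⟨1, hb⟩ ⟨ξ, sys.mem_domain_of_mem_graph h⟩
  have h2 : sys.A ⟨ξ, sys.mem_domain_of_mem_graph h⟩ = η :=
    sys.mem_graph_unique (sys.A.mem_graph _) h
  rw [Submodule.subtype_apply] at h1
  rw [h1]
  refine (MemLp.coeFn_toLp (sys.memLp_CS (sys.A.mem_graph ⟨ξ, _⟩))).trans (.of_forall fun s => ?_)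
  simp only [h2]

/-- The observation operator `H → L²((0,∞); H₀)` extending `ξ ↦ C S(·) ξ`. -/
noncomputable def obs [sys.IsContractive] : H →L[ℂ] Lp H₀ 2 halfLine := sys.exists_obs.choose

section

variable [sys.IsContractive]

theorem obs_ae {ξ η : H} (h : (ξ, η) ∈ sys.A.graph) :
    sys.obs ξ =ᵐ[halfLine] fun s => sys.C₀ (sys.S s ξ) + sys.C₁ (sys.S s η) :=
  sys.exists_obs.choose_spec ξ η h

theorem obs_ae_applyC {ξ η : H} (h : (ξ, η) ∈ sys.A.graph) :
    sys.obs ξ =ᵐ[halfLine] fun s => sys.applyC (sys.S s ξ) := by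
  filter_upwards [sys.obs_ae h, ae_restrict_mem measurableSet_Ioi] with s hs hs0
  rw [hs, sys.applyC_S h (le_of_lt hs0)]

end

theorem continuousOn_S_comp {H₁ : Type*} [NormedAddCommGroup H₁] [InnerProductSpace ℂ H₁]
    [FiniteDimensional ℂ H₁] (X : H₁ →L[ℂ] H) :
    ContinuousOn (fun s => sys.S s ∘L X) (Ici 0) :=
  continuousOn_clm_apply.2 fun u => sys.continuousOn_S (X u)

theorem adjoint_apply_adjoint_S (s : ℝ) (η : H) :
    ContinuousLinearMap.adjoint sys.inputOp (ContinuousLinearMap.adjoint (sys.S s) η)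
      = ContinuousLinearMap.adjoint (sys.S s ∘L sys.inputOp) η := by
  rw [ContinuousLinearMap.adjoint_comp]; rfl

/-- The operator `S s ∘L inputOp` starts from a finite-dimensional space, so strong continuity in
`s` is norm continuity, and this survives taking adjoints. -/
theorem continuousOn_ctrlAdj (η : H) : ContinuousOn (fun s =>
    ContinuousLinearMap.adjoint sys.inputOp (ContinuousLinearMap.adjoint (sys.S s) η)) (Ici 0) := by
  simp only [adjoint_apply_adjoint_S]
  exact ((ContinuousLinearMap.adjoint (𝕜 := ℂ) (E := H₀) (F := H)).continuous.comp_continuousOn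
    (sys.continuousOn_S_comp sys.inputOp)).clm_apply continuousOn_const

theorem memLp_ctrlAdj [hs : sys.IsContractive] (η : H) : MemLp (fun s =>
    ContinuousLinearMap.adjoint sys.inputOp (ContinuousLinearMap.adjoint (sys.S s) η))
    2 halfLine := by
  refine memLp_two_of_lintegral_le (c := ‖η‖ₑ) ?_ enorm_ne_top ?_
  · exact ((sys.continuousOn_ctrlAdj η).mono Ioi_subset_Ici_self).aestronglyMeasurable
      measurableSet_Ioi
  · simpa using hs.controlBound η

/-- The operator `η ↦ B† S(·)† η` from `H` to `L²((0,∞); H₀)`. -/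
noncomputable def ctrlAdj [hs : sys.IsContractive] : H →L[ℂ] Lp H₀ 2 halfLine :=
  LinearMap.mkContinuous
    { toFun := fun η => (sys.memLp_ctrlAdj η).toLp
      map_add' := fun ξ η => by
        rw [← MemLp.toLp_add]
        refine MemLp.toLp_congr _ _ (.of_forall fun s => ?_)
        simp only [map_add, Pi.add_apply]
      map_smul' := fun c ξ => by
        rw [RingHom.id_apply, ← MemLp.toLp_const_smul]
        refine MemLp.toLp_congr _ _ (.of_forall fun s => ?_)
        simp only [map_smul, Pi.smul_apply] } 1 fun η => by
      rw [one_mul]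
      refine norm_toLp_two_le (sys.memLp_ctrlAdj η) (norm_nonneg _) ?_
      rw [ofReal_norm]
      simpa using hs.controlBound η

variable [hcon : sys.IsContractive]

theorem ctrlAdj_ae (η : H) : sys.ctrlAdj η =ᵐ[halfLine] fun s =>
    ContinuousLinearMap.adjoint sys.inputOp (ContinuousLinearMap.adjoint (sys.S s) η) :=
  (sys.memLp_ctrlAdj η).coeFn_toLp

/-- The control operator `f ↦ ∫_0^∞ S(s) B f(s) ds` from `L²((0,∞); H₀)` to `H`. -/
noncomputable def ctrl : Lp H₀ 2 halfLine →L[ℂ] H :=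
  ContinuousLinearMap.adjoint sys.ctrlAdj

/-- Observing S(x)ξ is observing ξ from time x on, so the integral of the squared output shrinks to
(x,∞). Density removes the restriction to the domain. -/
theorem norm_obs_S_le {x : ℝ} (hx : 0 ≤ x) (ξ : H) : ‖sys.obs (sys.S x ξ)‖ ≤ ‖ξ‖ := by
  refine sys.dense_domain.induction (P := fun ξ => ‖sys.obs (sys.S x ξ)‖ ≤ ‖ξ‖) ?_ ?_ ξ
  · intro v hv
    obtain ⟨η, h⟩ := sys.exists_mem_graph hv
    rw [Lp.norm_def]
    refine ENNReal.toReal_le_of_le_ofReal (norm_nonneg _) (eLpNorm_two_le ?_)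
    rw [ofReal_norm]
    have := hcon.observationBound v hv
    simp only [ENNReal.coe_one, one_pow, one_mul] at this
    refine le_trans ?_ this
    calc ∫⁻ s, ‖sys.obs (sys.S x v) s‖ₑ ^ 2 ∂halfLine
        = ∫⁻ s, ‖sys.applyC (sys.S (s + x) v)‖ₑ ^ 2 ∂halfLine := by
          refine lintegral_congr_ae ?_
          filter_upwards [sys.obs_ae_applyC (sys.S_mem_graph h hx),
            ae_restrict_mem measurableSet_Ioi] with s hs hs0
          rw [hs, sys.S_add_apply (le_of_lt hs0) hx]
      _ = ∫⁻ s in Ioi x, ‖sys.applyC (sys.S s v)‖ₑ ^ 2 :=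
          (measurePreserving_add_halfLine x).lintegral_comp_emb
            (measurableEmbedding_addRight x) (fun s => ‖sys.applyC (sys.S s v)‖ₑ ^ 2)
      _ ≤ _ := lintegral_mono_set (Ioi_subset_Ioi hx)
  · exact isClosed_le (by fun_prop) (by fun_prop)

theorem adjoint_S_add {s x : ℝ} (hs : 0 ≤ s) (hx : 0 ≤ x) (η : H) :
    ContinuousLinearMap.adjoint (sys.S s) (ContinuousLinearMap.adjoint (sys.S x) η)
      = ContinuousLinearMap.adjoint (sys.S (s + x)) η := by
  rw [add_comm, sys.S_add x s hx hs, ContinuousLinearMap.mul_def, ContinuousLinearMap.adjoint_comp]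
  rfl

/-- The dual of `norm_obs_S_le`: the adjoint of S(x) `ctrl` is η ↦ B† S(·+x)† η, again a truncation
of a contraction. -/
theorem norm_S_ctrl_le {x : ℝ} (hx : 0 ≤ x) (f : Lp H₀ 2 halfLine) :
    ‖sys.S x (sys.ctrl f)‖ ≤ ‖f‖ := by
  have h1 : ∀ η, ‖sys.ctrlAdj (ContinuousLinearMap.adjoint (sys.S x) η)‖ ≤ 1 * ‖η‖ := fun η => by
    rw [Lp.norm_def, one_mul]
    refine ENNReal.toReal_le_of_le_ofReal (norm_nonneg _) (eLpNorm_two_le ?_)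
    rw [ofReal_norm]
    have := hcon.controlBound η
    simp only [ENNReal.coe_one, one_pow, one_mul] at this
    refine le_trans ?_ this
    calc _ = ∫⁻ s, ‖ContinuousLinearMap.adjoint sys.inputOp
            (ContinuousLinearMap.adjoint (sys.S (s + x)) η)‖ₑ ^ 2 ∂halfLine := by
          refine lintegral_congr_ae ?_
          filter_upwards [sys.ctrlAdj_ae (ContinuousLinearMap.adjoint (sys.S x) η),
            ae_restrict_mem measurableSet_Ioi] with s hs hs0
          rw [hs, sys.adjoint_S_add (le_of_lt hs0) hx]
      _ = ∫⁻ s in Ioi x, ‖ContinuousLinearMap.adjoint sys.inputOp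
            (ContinuousLinearMap.adjoint (sys.S s) η)‖ₑ ^ 2 :=
          (measurePreserving_add_halfLine x).lintegral_comp_emb
            (measurableEmbedding_addRight x) (fun s => ‖ContinuousLinearMap.adjoint sys.inputOp
            (ContinuousLinearMap.adjoint (sys.S s) η)‖ₑ ^ 2)
      _ ≤ _ := lintegral_mono_set (Ioi_subset_Ioi hx)
  have h2 : ‖sys.ctrlAdj ∘L ContinuousLinearMap.adjoint (sys.S x)‖ ≤ 1 :=
    ContinuousLinearMap.opNorm_le_bound _ zero_le_one h1
  have h3 : sys.S x ∘L sys.ctrl =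
      ContinuousLinearMap.adjoint (sys.ctrlAdj ∘L ContinuousLinearMap.adjoint (sys.S x)) := by
    rw [ContinuousLinearMap.adjoint_comp, ContinuousLinearMap.adjoint_adjoint]; rfl
  have h4 : ‖sys.S x ∘L sys.ctrl‖ ≤ 1 := by
    rw [h3, LinearIsometryEquiv.norm_map]; exact h2
  simpa using (sys.S x ∘L sys.ctrl).le_of_opNorm_le h4 f

variable {F : Type*} [NormedAddCommGroup F] [InnerProductSpace ℂ F] [CompleteSpace F]
  [FiniteDimensional ℂ F]

/-- The adjoint of L S(s) B is B† S(s)† L†, whose values at vectors are square integrable by the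
control bound; passing to adjoints preserves norms. -/
theorem memLp_comp_S_input (L : H →L[ℂ] F) :
    MemLp (fun s => L ∘L sys.S s ∘L sys.inputOp) 2 halfLine := by
  have h1 : MemLp (fun s => ContinuousLinearMap.adjoint (L ∘L sys.S s ∘L sys.inputOp))
      2 halfLine := by
    refine memLp_clm_of_apply fun u => ?_
    refine (sys.memLp_ctrlAdj (ContinuousLinearMap.adjoint L u)).ae_eq (.of_forall fun s => ?_)
    simp only [ContinuousLinearMap.adjoint_comp, ContinuousLinearMap.comp_apply]
  refine (memLp_congr_norm h1.1 ?_ (.of_forall fun s => ?_)).1 h1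
  · refine ContinuousOn.aestronglyMeasurable ?_ measurableSet_Ioi
    exact (continuousOn_const.clm_comp (sys.continuousOn_S_comp sys.inputOp)).mono
      Ioi_subset_Ici_self
  · exact LinearIsometryEquiv.norm_map _ _

theorem integrable_comp_S_input (L : H →L[ℂ] F) {f : ℝ → H₀} (hf : MemLp f 2 halfLine) :
    Integrable (fun s => L (sys.S s (sys.inputOp (f s)))) halfLine :=
  (sys.memLp_comp_S_input L).integrable_clm_apply hf

/-- The integral defining `ctrl` converges only weakly. After composition with an operator into a
finite-dimensional space it is an absolutely convergent integral. -/
theorem apply_ctrl (L : H →L[ℂ] F) (f : Lp H₀ 2 halfLine) :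
    L (sys.ctrl f) = ∫ s, L (sys.S s (sys.inputOp (f s))) ∂halfLine := by
  refine ext_inner_left ℂ fun u => ?_
  rw [← integral_inner (sys.integrable_comp_S_input L (Lp.memLp f)),
    ← ContinuousLinearMap.adjoint_inner_left, ctrl, ContinuousLinearMap.adjoint_inner_right,
    L2.inner_def]
  refine integral_congr_ae ?_
  filter_upwards [sys.ctrlAdj_ae (ContinuousLinearMap.adjoint L u)] with s hs
  rw [hs, ContinuousLinearMap.adjoint_inner_left, ContinuousLinearMap.adjoint_inner_left,
    ContinuousLinearMap.adjoint_inner_left]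

end LinearSystem

/-! ### The operator `R₀`, its Lyapunov equation, and the pairing `G`. -/

theorem integral_halfLine_sub_shift {E : Type*} [NormedAddCommGroup E] [NormedSpace ℝ E]
    {f : ℝ → E} (hf : Integrable f halfLine) {h : ℝ} (hh : 0 ≤ h) :
    ∫ s, f s ∂halfLine - ∫ s, f (s + h) ∂halfLine = ∫ s in (0 : ℝ)..h, f s := by
  rw [(measurePreserving_add_halfLine h).integral_comp (measurableEmbedding_addRight h)]
  rw [sub_eq_iff_eq_add]
  have hf' : IntegrableOn f (Ioi 0) := hf
  rw [intervalIntegral.integral_of_le hh, ← setIntegral_union (Ioc_disjoint_Ioi le_rfl)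
    measurableSet_Ioi (hf'.mono_set Ioc_subset_Ioi_self) (hf'.mono_set (Ioi_subset_Ioi hh)),
    Ioc_union_Ioi_eq_Ioi hh]

theorem tendsto_clm_apply {α 𝕜 E F : Type*} [NontriviallyNormedField 𝕜]
    [NormedAddCommGroup E] [NormedSpace 𝕜 E] [NormedAddCommGroup F] [NormedSpace 𝕜 F]
    {l : Filter α} {L : α → E →L[𝕜] F} {L₀ : E →L[𝕜] F} {g : α → E} {ξ : E}
    (hL : Tendsto L l (𝓝 L₀)) (hg : Tendsto g l (𝓝 ξ)) :
    Tendsto (fun a => L a (g a)) l (𝓝 (L₀ ξ)) :=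
  (isBoundedBilinearMap_apply.continuous.tendsto (L₀, ξ)).comp (hL.prodMk_nhds hg)

namespace LinearSystem

variable {H H₀ : Type*}
  [NormedAddCommGroup H] [InnerProductSpace ℂ H] [CompleteSpace H]
  [NormedAddCommGroup H₀] [InnerProductSpace ℂ H₀] [CompleteSpace H₀] [FiniteDimensional ℂ H₀]
  (sys : LinearSystem H H₀) [hcon : sys.IsContractive]

/-- The operator `∫_0^∞ S(s) B C S(s) ds`. -/
noncomputable def R₀ : H →L[ℂ] H := sys.ctrl ∘L sys.obs

theorem R₀_apply (ξ : H) : sys.R₀ ξ = sys.ctrl (sys.obs ξ) := rfl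

theorem norm_S_R₀_S_le {x y : ℝ} (hx : 0 ≤ x) (hy : 0 ≤ y) (ξ : H) :
    ‖sys.S x (sys.R₀ (sys.S y ξ))‖ ≤ ‖ξ‖ :=
  (sys.norm_S_ctrl_le hx _).trans (sys.norm_obs_S_le hy ξ)

/-- R₀ is an integral over (0,∞) and S(h) R₀ S(h) is the same integral over (h,∞). The comparison is
made weakly, against a vector `ζ`, where both sides are genuine integrals. -/
theorem R₀_sub_shift {ξ η : H} (hξ : (ξ, η) ∈ sys.A.graph) {h : ℝ} (hh : 0 ≤ h) :
    sys.R₀ ξ - sys.S h (sys.R₀ (sys.S h ξ))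
      = ∫ s in (0 : ℝ)..h, sys.S s (sys.inputOp (sys.applyC (sys.S s ξ))) := by
  have hcont : ContinuousOn (fun s => sys.S s (sys.inputOp (sys.applyC (sys.S s ξ)))) (Ici 0) :=
    sys.continuousOn_S_apply continuousOn_id (fun _ h => h)
      (sys.inputOp.continuous.comp_continuousOn (sys.continuousOn_applyC_S hξ))
  have hii : IntervalIntegrable (fun s => sys.S s (sys.inputOp (sys.applyC (sys.S s ξ)))) volume
      0 h := (hcont.mono fun x hx => by rw [uIcc_of_le hh] at hx; exact hx.1).intervalIntegrable
  refine ext_inner_left ℂ fun ζ => ?_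
  rw [← innerSL_apply_apply, ← innerSL_apply_apply,
    ← (innerSL ℂ ζ).intervalIntegral_comp_comm hii, map_sub]
  have e1 : innerSL ℂ ζ (sys.R₀ ξ)
      = ∫ s, innerSL ℂ ζ (sys.S s (sys.inputOp (sys.applyC (sys.S s ξ)))) ∂halfLine := by
    rw [R₀_apply, sys.apply_ctrl]
    refine integral_congr_ae ?_
    filter_upwards [sys.obs_ae_applyC hξ] with s hs
    rw [hs]
  have e2 : innerSL ℂ ζ (sys.S h (sys.R₀ (sys.S h ξ))) = ∫ s, innerSL ℂ ζ
      (sys.S (s + h) (sys.inputOp (sys.applyC (sys.S (s + h) ξ)))) ∂halfLine := by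
    rw [R₀_apply, ← ContinuousLinearMap.comp_apply, sys.apply_ctrl]
    refine integral_congr_ae ?_
    filter_upwards [sys.obs_ae_applyC (sys.S_mem_graph hξ hh),
      ae_restrict_mem measurableSet_Ioi] with s hs hs0
    rw [hs, ContinuousLinearMap.comp_apply, ← sys.S_add_apply hh (le_of_lt hs0),
      ← sys.S_add_apply (le_of_lt hs0) hh, add_comm h s]
  rw [e1, e2]
  refine integral_halfLine_sub_shift (f := fun s =>
    innerSL ℂ ζ (sys.S s (sys.inputOp (sys.applyC (sys.S s ξ))))) ?_ hh
  refine (sys.integrable_comp_S_input (innerSL ℂ ζ) (Lp.memLp (sys.obs ξ))).congr ?_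
  filter_upwards [sys.obs_ae_applyC hξ] with s hs
  rw [hs]

theorem continuousOn_SBCS {ξ η : H} (hξ : (ξ, η) ∈ sys.A.graph) :
    ContinuousOn (fun s => sys.S s (sys.inputOp (sys.applyC (sys.S s ξ)))) (Ici 0) :=
  sys.continuousOn_S_apply continuousOn_id (fun _ h => h)
    (sys.inputOp.continuous.comp_continuousOn (sys.continuousOn_applyC_S hξ))

/-- The Lyapunov equation `A R₀ + R₀ A = B C` on the domain of `A`. -/
theorem R₀_mem_graph {ξ η : H} (hξ : (ξ, η) ∈ sys.A.graph) :
    (sys.R₀ ξ, sys.inputOp (sys.applyC ξ) - sys.R₀ η) ∈ sys.A.graph := by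
  rw [sys.generator]
  have h1 := tendsto_inv_smul_integral (sys.continuousOn_SBCS hξ) le_rfl
  have h2 : Tendsto (fun h : ℝ => sys.S h (sys.R₀ (h⁻¹ • (ξ - sys.S h ξ)))) (𝓝[>] 0)
      (𝓝 (sys.S 0 (sys.R₀ η))) := by
    refine sys.tendsto_S_apply le_rfl (tendsto_id.mono_left nhdsWithin_le_nhds)
      (by filter_upwards [self_mem_nhdsWithin] with h hh using le_of_lt hh) ?_
    exact (sys.R₀.continuous.tendsto η).comp ((sys.generator _ _).1 hξ)
  simp only [sys.S_zero_apply] at h1 h2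
  -- R₀ξ - S(h)R₀ξ = (R₀ξ - S(h)R₀S(h)ξ) - S(h)R₀(ξ - S(h)ξ): the first bracket is an integral over
  -- (0,h), the second term is governed by the generator.
  refine (h1.sub h2).congr' ?_
  filter_upwards [self_mem_nhdsWithin] with h hh
  have hh0 : 0 ≤ h := le_of_lt hh
  rw [zero_add, ← sys.R₀_sub_shift hξ hh0, ← Complex.coe_smul, ← Complex.coe_smul,
    ← Complex.coe_smul, map_smul, map_smul, ← smul_sub, map_sub, map_sub]
  congr 1
  abel

theorem R_sub_R {ξ η : H} (hξ : (ξ, η) ∈ sys.A.graph) {x y : ℝ} (hx : 0 ≤ x) (hxy : x ≤ y) :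
    sys.S x (sys.R₀ (sys.S x ξ)) - sys.S y (sys.R₀ (sys.S y ξ))
      = ∫ s in x..y, sys.S s (sys.inputOp (sys.applyC (sys.S s ξ))) := by
  obtain ⟨h, rfl⟩ : ∃ h, y = x + h := ⟨y - x, by ring⟩
  have hh : 0 ≤ h := by linarith
  have h1 := congrArg (sys.S x) (sys.R₀_sub_shift (sys.S_mem_graph hξ hx) hh)
  have hii : IntervalIntegrable
      (fun s => sys.S s (sys.inputOp (sys.applyC (sys.S s (sys.S x ξ))))) volume
      0 h := ((sys.continuousOn_SBCS (sys.S_mem_graph hξ hx)).mono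
        fun x hx => by rw [uIcc_of_le hh] at hx; exact hx.1).intervalIntegrable
  rw [map_sub, ← sys.S_add_apply hx hh, ← sys.S_add_apply hh hx, add_comm h x,
    ← (sys.S x).intervalIntegral_comp_comm hii] at h1
  rw [h1]
  have h2 := intervalIntegral.integral_comp_add_left (a := 0) (b := h)
    (fun s => sys.S s (sys.inputOp (sys.applyC (sys.S s ξ)))) x
  rw [add_zero] at h2
  rw [← h2]
  refine intervalIntegral.integral_congr fun s hs => ?_
  rw [uIcc_of_le hh] at hs
  rw [← sys.S_add_apply hx hs.1, ← sys.S_add_apply hs.1 hx, add_comm s x]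

/-- The square of this norm is the tail over (N,∞) of a convergent integral. -/
theorem tendsto_norm_obs_S {ξ η : H} (hξ : (ξ, η) ∈ sys.A.graph) :
    Tendsto (fun N => ‖sys.obs (sys.S N ξ)‖) atTop (𝓝 0) := by
  have hint : Integrable (fun s => (inner ℂ (sys.applyC (sys.S s ξ)) (sys.applyC (sys.S s ξ)) : ℂ))
      halfLine := by
    refine (L2.integrable_inner (𝕜 := ℂ) (sys.obs ξ) (sys.obs ξ)).congr ?_
    filter_upwards [sys.obs_ae_applyC hξ] with s hs
    rw [hs]
  have h1 := intervalIntegral_tendsto_integral_Ioi 0 hint tendsto_id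
  have h2 : Tendsto (fun N => (((‖sys.obs (sys.S N ξ)‖ ^ 2 : ℝ)) : ℂ)) atTop (𝓝 0) := by
    have h3 := (tendsto_const_nhds (x := ∫ s, (inner ℂ (sys.applyC (sys.S s ξ))
      (sys.applyC (sys.S s ξ)) : ℂ) ∂halfLine)).sub h1
    rw [sub_self] at h3
    refine h3.congr' ?_
    filter_upwards [eventually_ge_atTop 0] with N hN
    rw [id, ← integral_halfLine_sub_shift hint hN, sub_sub_cancel, Complex.ofReal_pow,
      ← Complex.coe_algebraMap, ← inner_self_eq_norm_sq_to_K (𝕜 := ℂ), L2.inner_def]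
    refine integral_congr_ae ?_
    filter_upwards [sys.obs_ae_applyC (sys.S_mem_graph hξ hN),
      ae_restrict_mem measurableSet_Ioi] with s hs hs0
    rw [hs, ← sys.S_add_apply (le_of_lt hs0) hN]
  have h4 := (Complex.continuous_re.tendsto 0).comp h2
  have h5 := (Real.continuous_sqrt.tendsto _).comp h4
  simp only [Complex.zero_re, Real.sqrt_zero] at h5
  refine h5.congr fun N => ?_
  simp only [Function.comp_apply, Complex.ofReal_re]
  exact Real.sqrt_sq (norm_nonneg _)

/-- The observation operator applied to operators `H₀ → H`. -/
noncomputable def obsOp : (H₀ →L[ℂ] H) →L[ℂ] Lp (H₀ →L[ℂ] H₀) 2 halfLine :=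
  ∑ j, ContinuousLinearMap.compLpL 2 halfLine (dyad H₀ j) ∘L sys.obs ∘L
    ContinuousLinearMap.apply ℂ H (stdOrthonormalBasis ℂ H₀ j)

theorem obsOp_ae {X Y : H₀ →L[ℂ] H} (h : ∀ u, (X u, Y u) ∈ sys.A.graph) :
    sys.obsOp X =ᵐ[halfLine] fun s => sys.C₀ ∘L sys.S s ∘L X + sys.C₁ ∘L sys.S s ∘L Y := by
  have h1 : ∀ j, ((dyad H₀ j).compLp (sys.obs (X (stdOrthonormalBasis ℂ H₀ j))))
      =ᵐ[halfLine] fun s => dyad H₀ j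
        ((sys.C₀ ∘L sys.S s ∘L X + sys.C₁ ∘L sys.S s ∘L Y) (stdOrthonormalBasis ℂ H₀ j)) := by
    intro j
    filter_upwards [(dyad H₀ j).coeFn_compLp (sys.obs (X (stdOrthonormalBasis ℂ H₀ j))),
      sys.obs_ae (h (stdOrthonormalBasis ℂ H₀ j))] with s h1 h2
    rw [h1, h2]; rfl
  have h2 : sys.obsOp X = ∑ j, (dyad H₀ j).compLp (sys.obs (X (stdOrthonormalBasis ℂ H₀ j))) := by
    rw [obsOp, sum_apply]; rfl
  rw [h2]
  refine (Lp.coeFn_finsetSum _ _).trans ?_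
  filter_upwards [ae_all_iff.2 h1] with s hs
  rw [Finset.sum_apply, Finset.sum_congr rfl fun j _ => hs j]
  exact sum_dyad _

/-- The bilinear expression `∫_0^∞ C S(s) X C S(s) w ds` as an operator in `w`, depending linearly
on `X : H₀ → H`. -/
noncomputable def G : (H₀ →L[ℂ] H) →L[ℂ] H →L[ℂ] H₀ :=
  (ContinuousLinearMap.compL ℂ H (Lp H₀ 2 halfLine) H₀).flip sys.obs ∘L
    (ContinuousLinearMap.lpPairing halfLine 2 2 (ContinuousLinearMap.id ℂ (H₀ →L[ℂ] H₀))) ∘L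
      sys.obsOp

theorem G_apply (X : H₀ →L[ℂ] H) (w : H) :
    sys.G X w = ∫ s, sys.obsOp X s (sys.obs w s) ∂halfLine :=
  ContinuousLinearMap.lpPairing_eq_integral _ _ _

theorem G_sub_shift {X Y : H₀ →L[ℂ] H} (hX : ∀ u, (X u, Y u) ∈ sys.A.graph) {ξ η : H}
    (hξ : (ξ, η) ∈ sys.A.graph) {h : ℝ} (hh : 0 ≤ h) :
    sys.G X ξ - sys.G (sys.S h ∘L X) (sys.S h ξ) = ∫ s in (0 : ℝ)..h,
      (sys.C₀ ∘L sys.S s ∘L X + sys.C₁ ∘L sys.S s ∘L Y)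
        (sys.C₀ (sys.S s ξ) + sys.C₁ (sys.S s η)) := by
  have hh' : ∀ u, ((sys.S h ∘L X) u, (sys.S h ∘L Y) u) ∈ sys.A.graph :=
    fun u => sys.S_mem_graph (hX u) hh
  rw [G_apply, G_apply]
  rw [← integral_halfLine_sub_shift (f := fun s =>
    (sys.C₀ ∘L sys.S s ∘L X + sys.C₁ ∘L sys.S s ∘L Y)
        (sys.C₀ (sys.S s ξ) + sys.C₁ (sys.S s η))) ?_ hh]
  · congr 1
    · refine integral_congr_ae ?_
      filter_upwards [sys.obsOp_ae hX, sys.obs_ae hξ] with s h1 h2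
      rw [h1, h2]
    · refine integral_congr_ae ?_
      filter_upwards [sys.obsOp_ae hh', sys.obs_ae (sys.S_mem_graph hξ hh),
        ae_restrict_mem measurableSet_Ioi] with s h1 h2 hs0
      rw [h1, h2, sys.S_add s h (le_of_lt hs0) hh]
      rfl
  · refine ((Lp.memLp (sys.obsOp X)).integrable_clm_apply (Lp.memLp (sys.obs ξ))).congr ?_
    filter_upwards [sys.obsOp_ae hX, sys.obs_ae hξ] with s h1 h2
    rw [h1, h2]

/-- Finite dimension of `H₀` turns pointwise into norm convergence, which is what the continuity of
`G` and `obsOp` asks for. -/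
theorem tendsto_generator_comp {X Y : H₀ →L[ℂ] H} (hX : ∀ u, (X u, Y u) ∈ sys.A.graph) :
    Tendsto (fun h : ℝ => ((h⁻¹ : ℝ) : ℂ) • (X - sys.S h ∘L X)) (𝓝[>] 0) (𝓝 Y) := by
  refine tendsto_clm_of_apply fun u => ?_
  refine ((sys.generator _ _).1 (hX u)).congr fun h => ?_
  simp [-Complex.ofReal_inv, Complex.coe_smul]

/-- The Leibniz rule for the pairing: the left side is the integral of minus the derivative of C
S(s)X C S(s)ξ, so only the boundary value at s = 0 remains. It is proved by dividing `G_sub_shift`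
by h. It is the rule that moves A from one factor of the pairing to the other. -/
theorem G_add_G {X Y : H₀ →L[ℂ] H} (hX : ∀ u, (X u, Y u) ∈ sys.A.graph) {ξ η : H}
    (hξ : (ξ, η) ∈ sys.A.graph) :
    sys.G X η + sys.G Y ξ = (sys.C₀ ∘L X + sys.C₁ ∘L Y) (sys.C₀ ξ + sys.C₁ η) := by
  have hc : ContinuousOn (fun s => (sys.C₀ ∘L sys.S s ∘L X + sys.C₁ ∘L sys.S s ∘L Y)
        (sys.C₀ (sys.S s ξ) + sys.C₁ (sys.S s η))) (Ici 0) :=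
    ((continuousOn_const.clm_comp (sys.continuousOn_S_comp X)).add
      (continuousOn_const.clm_comp (sys.continuousOn_S_comp Y))).clm_apply sys.continuousOn_CS
  have h1 := tendsto_inv_smul_integral hc le_rfl
  have e0 : ∀ Z : H₀ →L[ℂ] H, sys.S 0 ∘L Z = Z := fun Z => by
    ext u; simp [sys.S_zero_apply]
  simp only [sys.S_zero_apply, e0] at h1
  refine tendsto_nhds_unique ?_ h1
  have hS : Tendsto (fun h : ℝ => sys.S h ∘L X) (𝓝[>] 0) (𝓝 X) :=
    tendsto_clm_of_apply fun u => sys.S_tendsto _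
  have h2 : Tendsto (fun h : ℝ => sys.G (((h⁻¹ : ℝ) : ℂ) • (X - sys.S h ∘L X)) ξ) (𝓝[>] 0)
      (𝓝 (sys.G Y ξ)) :=
    tendsto_clm_apply ((sys.G.continuous.tendsto Y).comp (sys.tendsto_generator_comp hX))
      tendsto_const_nhds
  have h3 : Tendsto (fun h : ℝ => sys.G (sys.S h ∘L X) (h⁻¹ • (ξ - sys.S h ξ))) (𝓝[>] 0)
      (𝓝 (sys.G X η)) :=
    tendsto_clm_apply ((sys.G.continuous.tendsto X).comp hS) ((sys.generator _ _).1 hξ)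
  -- The two factors are shifted one at a time: G(X)ξ - G(S(h)X)S(h)ξ = G(S(h)X)(ξ - S(h)ξ) + G(X -
  -- S(h)X)ξ.
  refine (h3.add h2).congr' ?_
  filter_upwards [self_mem_nhdsWithin] with h hh
  rw [zero_add, ← sys.G_sub_shift hX hξ (le_of_lt hh), ← Complex.coe_smul, ← Complex.coe_smul,
    map_smul, map_smul, smul_apply, ← smul_add]
  congr 1
  rw [map_sub, map_sub, sub_apply]
  abel

/-- The bounded operator `C h⁻¹ ∫_0^h S(s) ds`. -/
noncomputable def avgC (h : ℝ) : H →L[ℂ] H₀ :=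
  sys.C₀ ∘L sys.avg h + sys.C₁ ∘L (((h⁻¹ : ℝ) : ℂ) • (1 - sys.S h))

/-- A bounded operator passes under the weak integral of `ctrl`, and averaging brings S(y)B into the
domain, where `obsOp` is known almost everywhere. -/
theorem avgC_S_R₀ {h y : ℝ} (hh : 0 < h) (hy : 0 ≤ y) (w : H) :
    sys.avgC h (sys.S y (sys.R₀ w)) = sys.G (sys.avg h ∘L sys.S y ∘L sys.inputOp) w := by
  rw [R₀_apply, ← ContinuousLinearMap.comp_apply, sys.apply_ctrl, G_apply]
  have hX : ∀ u, ((sys.avg h ∘L sys.S y ∘L sys.inputOp) u,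
      ((((h⁻¹ : ℝ) : ℂ) • (1 - sys.S h)) ∘L sys.S y ∘L sys.inputOp) u) ∈ sys.A.graph := fun u => by
    have := sys.avg_mem_graph hh (sys.S y (sys.inputOp u))
    rwa [← Complex.coe_smul] at this
  refine integral_congr_ae ?_
  filter_upwards [sys.obsOp_ae hX, ae_restrict_mem measurableSet_Ioi] with s h1 hs0
  rw [h1]
  have hs : 0 ≤ s := le_of_lt hs0
  simp only [avgC, ContinuousLinearMap.comp_apply, add_apply,
    smul_apply, sub_apply, one_apply_eq_self,
    map_smul, map_sub]
  rw [sys.S_comm_apply hy hs, sys.avg_S hh.le hs, sys.S_comm_apply hh.le hs]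

/-- C cannot be taken under the integral, but the bounded approximations `avgC h` can, and both
sides converge. The right side is defined and bounded for every `w`, so it is the bounded extension
of w ↦ C S(y) R₀ w. -/
theorem applyC_S_R₀ {y : ℝ} (hy : 0 ≤ y) {w : H} (hw : sys.S y (sys.R₀ w) ∈ sys.A.domain) :
    sys.applyC (sys.S y (sys.R₀ w)) = sys.G (sys.S y ∘L sys.inputOp) w := by
  obtain ⟨ζ, hζ⟩ := sys.exists_mem_graph hw
  have h1 : Tendsto (fun h => sys.avgC h (sys.S y (sys.R₀ w))) (𝓝[>] 0)
      (𝓝 (sys.applyC (sys.S y (sys.R₀ w)))) := by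
    rw [sys.applyC_eq hζ]
    refine (((sys.C₀.continuous.tendsto _).comp (sys.tendsto_avg _)).add
      ((sys.C₁.continuous.tendsto _).comp ((sys.generator _ _).1 hζ))).congr fun h => ?_
    simp [avgC, -Complex.ofReal_inv, Complex.coe_smul]
  have h2 : Tendsto (fun h => sys.avg h ∘L sys.S y ∘L sys.inputOp) (𝓝[>] 0)
      (𝓝 (sys.S y ∘L sys.inputOp)) := tendsto_clm_of_apply fun u => sys.tendsto_avg _
  have h3 := tendsto_clm_apply ((sys.G.continuous.tendsto _).comp h2) (tendsto_const_nhds (x := w))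
  refine tendsto_nhds_unique h1 (h3.congr' ?_)
  filter_upwards [self_mem_nhdsWithin] with h hh
  exact (sys.avgC_S_R₀ hh hy w).symm

end LinearSystem

/-! ### The inverse of I + λ R_x and the domain of A. -/

namespace LinearSystem

variable {H H₀ : Type*}
  [NormedAddCommGroup H] [InnerProductSpace ℂ H] [CompleteSpace H]
  [NormedAddCommGroup H₀] [InnerProductSpace ℂ H₀] [CompleteSpace H₀] [FiniteDimensional ℂ H₀]
  (sys : LinearSystem H H₀) [hcon : sys.IsContractive]

omit hcon in
theorem applyC_add {ξ η : H} (hξ : ξ ∈ sys.A.domain) (hη : η ∈ sys.A.domain) :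
    sys.applyC (ξ + η) = sys.applyC ξ + sys.applyC η := by
  rw [applyC, applyC, applyC, dif_pos hξ, dif_pos hη, dif_pos (sys.A.domain.add_mem hξ hη),
    ← map_add]
  rfl

omit hcon in
theorem applyC_smul (c : ℂ) {ξ : H} (hξ : ξ ∈ sys.A.domain) :
    sys.applyC (c • ξ) = c • sys.applyC ξ := by
  rw [applyC, applyC, dif_pos hξ, dif_pos (sys.A.domain.smul_mem c hξ), ← map_smul]
  rfl

/-- The operator `R_x = S(x) R₀ S(x)`. -/
noncomputable def Rop (x : ℝ) : H →L[ℂ] H := sys.S x ∘L sys.R₀ ∘L sys.S x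

theorem Rop_apply (x : ℝ) (ξ : H) : sys.Rop x ξ = sys.S x (sys.R₀ (sys.S x ξ)) := rfl

theorem norm_S_Rop_le {h x : ℝ} (hh : 0 ≤ h) (hx : 0 ≤ x) (ξ : H) :
    ‖sys.S h (sys.Rop x ξ)‖ ≤ ‖ξ‖ := by
  rw [Rop_apply, ← sys.S_add_apply hh hx]
  exact sys.norm_S_R₀_S_le (by positivity) hx ξ

theorem norm_Rop_le {x : ℝ} (hx : 0 ≤ x) (ξ : H) : ‖sys.Rop x ξ‖ ≤ ‖ξ‖ :=
  sys.norm_S_R₀_S_le hx hx ξ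

/-- The integral up to N equals R_xξ - R_Nξ, and the last term is bounded by the norm of `obs (S N
ξ)`, which tends to 0. -/
theorem isR_Rop {x : ℝ} (hx : 0 ≤ x) : sys.IsR x (sys.Rop x) := by
  intro ξ hξ
  obtain ⟨η, h⟩ := sys.exists_mem_graph hξ
  have h1 : Tendsto (fun N => sys.Rop N ξ) atTop (𝓝 0) := by
    refine squeeze_zero_norm' ?_ (sys.tendsto_norm_obs_S h)
    filter_upwards [eventually_ge_atTop 0] with N hN
    exact sys.norm_S_ctrl_le hN _
  have h2 := (tendsto_const_nhds (x := sys.Rop x ξ)).sub h1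
  rw [sub_zero] at h2
  refine h2.congr' ?_
  filter_upwards [eventually_ge_atTop x] with N hN
  exact sys.R_sub_R h hx hN

omit hcon in
theorem IsR.unique {x : ℝ} {R R' : H →L[ℂ] H} (h : sys.IsR x R) (h' : sys.IsR x R') : R = R' := by
  refine ContinuousLinearMap.coeFn_injective
    (R.continuous.ext_on sys.dense_domain R'.continuous fun ξ hξ => ?_)
  exact tendsto_nhds_unique (h ξ hξ) (h' ξ hξ)

theorem isR_R {x : ℝ} (hx : 0 ≤ x) : sys.IsR x (sys.R x) := by
  have h : ∃ R, sys.IsR x R := ⟨_, sys.isR_Rop hx⟩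
  rw [R, dif_pos h]
  exact h.choose_spec

theorem R_eq_Rop {x : ℝ} (hx : 0 ≤ x) : sys.R x = sys.Rop x :=
  IsR.unique sys (sys.isR_R hx) (sys.isR_Rop hx)

/-- The resolvent operator `(I + λ R_x)⁻¹`. -/
noncomputable def N (lam : ℂ) (x : ℝ) : H →L[ℂ] H := Ring.inverse (1 + lam • sys.Rop x)

variable {lam : ℂ} (hlam : ‖lam‖ < 1)

include hlam in
theorem isUnit_one_add_Rop {x : ℝ} (hx : 0 ≤ x) : IsUnit (1 + lam • sys.Rop x) := by
  have h : ‖-(lam • sys.Rop x)‖ < 1 := by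
    rw [norm_neg, norm_smul]
    refine lt_of_le_of_lt ?_ hlam
    refine mul_le_of_le_one_right (norm_nonneg _) ?_
    refine ContinuousLinearMap.opNorm_le_bound _ zero_le_one fun ξ => ?_
    rw [one_mul]
    exact sys.norm_Rop_le hx ξ
  have := isUnit_one_sub_of_norm_lt_one h
  rwa [sub_neg_eq_add] at this

include hlam in
theorem N_add {x : ℝ} (hx : 0 ≤ x) (ξ : H) :
    sys.N lam x ξ + lam • sys.Rop x (sys.N lam x ξ) = ξ := by
  have h := Ring.mul_inverse_cancel _ (sys.isUnit_one_add_Rop hlam hx)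
  have := DFunLike.congr_fun h ξ
  simpa [N] using this

include hlam in
theorem N_comm_add {x : ℝ} (hx : 0 ≤ x) (ξ : H) :
    sys.N lam x (ξ + lam • sys.Rop x ξ) = ξ := by
  have h := Ring.inverse_mul_cancel _ (sys.isUnit_one_add_Rop hlam hx)
  have := DFunLike.congr_fun h ξ
  simpa [N] using this

theorem norm_le_of_contraction {L : H →L[ℂ] H} (hL : ∀ ξ, ‖L ξ‖ ≤ ‖ξ‖) (ξ : H) :
    (1 - ‖lam‖) * ‖ξ‖ ≤ ‖ξ - lam • L ξ‖ := by
  have h1 : ‖lam • L ξ‖ ≤ ‖lam‖ * ‖ξ‖ := by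
    rw [norm_smul]; exact mul_le_mul_of_nonneg_left (hL ξ) (norm_nonneg _)
  have h2 := norm_sub_norm_le ξ (lam • L ξ)
  linarith

include hlam in
theorem norm_N_le {x : ℝ} (hx : 0 ≤ x) : ‖sys.N lam x‖ ≤ (1 - ‖lam‖)⁻¹ := by
  have h0 : 0 < 1 - ‖lam‖ := by linarith
  refine ContinuousLinearMap.opNorm_le_bound _ (inv_nonneg.2 h0.le) fun ξ => ?_
  have h1 := norm_le_of_contraction (lam := -lam) (sys.norm_Rop_le hx) (sys.N lam x ξ)
  rw [norm_neg, neg_smul, sub_neg_eq_add, sys.N_add hlam hx] at h1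
  rw [inv_mul_eq_div, le_div_iff₀ h0]
  linarith

theorem Rop_mem_graph {x : ℝ} (hx : 0 ≤ x) {ξ η : H} (h : (ξ, η) ∈ sys.A.graph) :
    (sys.Rop x ξ, sys.S x (sys.inputOp (sys.applyC (sys.S x ξ))) - sys.Rop x η)
      ∈ sys.A.graph := by
  have := sys.S_mem_graph (sys.R₀_mem_graph (sys.S_mem_graph h hx)) hx
  rwa [map_sub] at this

theorem applyC_S_Rop {s x : ℝ} (hs : 0 ≤ s) (hx : 0 ≤ x) {ξ : H} (hξ : ξ ∈ sys.A.domain) :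
    sys.applyC (sys.S s (sys.Rop x ξ))
      = sys.G (sys.S (s + x) ∘L sys.inputOp) (sys.S x ξ) := by
  obtain ⟨η, h⟩ := sys.exists_mem_graph hξ
  have h1 := sys.mem_domain_of_mem_graph (sys.S_mem_graph (sys.Rop_mem_graph hx h) hs)
  rw [Rop_apply, ← sys.S_add_apply hs hx] at h1 ⊢
  exact sys.applyC_S_R₀ (by positivity) h1

omit hcon in
theorem continuousOn_S_add_comp {x : ℝ} (hx : 0 ≤ x) (X : H₀ →L[ℂ] H) :
    ContinuousOn (fun s => sys.S (s + x) ∘L X) (Ici 0) :=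
  continuousOn_clm_apply.2 fun u => sys.continuousOn_S_apply (by fun_prop)
    (fun s hs => add_nonneg hs hx) continuousOn_const

theorem continuousOn_SBG {x : ℝ} (hx : 0 ≤ x) : ContinuousOn (fun s =>
    (sys.S s ∘L sys.inputOp) ∘L sys.G (sys.S (s + x) ∘L sys.inputOp) ∘L sys.S x) (Ici 0) :=
  (sys.continuousOn_S_comp _).clm_comp
    ((sys.G.continuous.comp_continuousOn (sys.continuousOn_S_add_comp hx _)).clm_comp
      continuousOn_const)

/-- For ξ in the domain this is `R_sub_R` at R_xξ. Writing the integrand with `G` makes both sides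
bounded in ξ, so density gives it for every ξ; it is needed at N b before N b is known to lie in the
domain. -/
theorem Rop_sub_Rop_Rop {x h : ℝ} (hx : 0 ≤ x) (hh : 0 ≤ h) (ξ : H) :
    sys.Rop x (sys.Rop x ξ) - sys.Rop (x + h) (sys.Rop x ξ) = ∫ s in x..(x + h),
      sys.S s (sys.inputOp (sys.G (sys.S (s + x) ∘L sys.inputOp) (sys.S x ξ))) := by
  have hii : IntervalIntegrable (fun s =>
      (sys.S s ∘L sys.inputOp) ∘L sys.G (sys.S (s + x) ∘L sys.inputOp) ∘L sys.S x) volume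
      x (x + h) := by
    refine ((sys.continuousOn_SBG hx).mono fun s hs => ?_).intervalIntegrable
    rw [uIcc_of_le (by linarith)] at hs
    exact hx.trans hs.1
  have key : ∀ ξ, (∫ s in x..(x + h),
      sys.S s (sys.inputOp (sys.G (sys.S (s + x) ∘L sys.inputOp) (sys.S x ξ))))
      = (∫ s in x..(x + h), (sys.S s ∘L sys.inputOp) ∘L
          sys.G (sys.S (s + x) ∘L sys.inputOp) ∘L sys.S x) ξ := fun ξ => by
    rw [ContinuousLinearMap.intervalIntegral_apply hii]; rfl
  rw [key]
  refine sys.dense_domain.induction (P := fun ξ => sys.Rop x (sys.Rop x ξ) -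
    sys.Rop (x + h) (sys.Rop x ξ) = (∫ s in x..(x + h), (sys.S s ∘L sys.inputOp) ∘L
          sys.G (sys.S (s + x) ∘L sys.inputOp) ∘L sys.S x) ξ) ?_ ?_ ξ
  · intro v hv
    obtain ⟨η, hη⟩ := sys.exists_mem_graph hv
    rw [← key, Rop_apply, sys.Rop_apply (x + h),
      sys.R_sub_R (sys.Rop_mem_graph hx hη) hx (by linarith)]
    refine intervalIntegral.integral_congr fun s hs => ?_
    rw [uIcc_of_le (by linarith)] at hs
    simp only [sys.applyC_S_Rop (hx.trans hs.1) hx hv]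
  · exact isClosed_eq (by fun_prop) (by fun_prop)

-- The Lyapunov equation gives A(I + λR_x) = (I - λR_x)A + λ S(x)BCS(x), so A N b must be the
-- inverse for -λ applied to A b - λ S(x)BCS(x) N b. The term CS(x) N b is written through `G`, so
-- as not to presuppose that N b is in the domain. For the proof, the difference quotients of v = N
-- b solve a linear equation with operator I - λS(h)R_x, which is bounded below by 1 - |λ| uniformly
-- in h; convergence of the right sides therefore forces convergence of the quotients.
include hlam in
theorem N_mem_graph {x : ℝ} (hx : 0 ≤ x) {b β : H} (hb : (b, β) ∈ sys.A.graph) :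
    (sys.N lam x b, sys.N (-lam) x (β - lam • sys.S x (sys.inputOp (sys.applyC (sys.S x b)
      - lam • sys.G (sys.S (x + x) ∘L sys.inputOp) (sys.S x (sys.N lam x b))))))
      ∈ sys.A.graph := by
  have hlam' : ‖-lam‖ < 1 := by rwa [norm_neg]
  set v := sys.N lam x b with hv
  set r := β - lam • sys.S x (sys.inputOp (sys.applyC (sys.S x b)
      - lam • sys.G (sys.S (x + x) ∘L sys.inputOp) (sys.S x v))) with hr
  set z := sys.N (-lam) x r with hz
  have hvb : v + lam • sys.Rop x v = b := sys.N_add hlam hx b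
  have hzr : z - lam • sys.Rop x z = r := by
    have := sys.N_add hlam' hx r
    rwa [neg_smul, ← sub_eq_add_neg] at this
  rw [sys.generator]
  -- Substitute v = b - λR_x v: the part with b is handled in the domain, the part with R_x v by
  -- `Rop_sub_Rop_Rop`.
  have hE : Tendsto (fun h : ℝ => h⁻¹ • (sys.Rop x v - sys.Rop (x + h) v)) (𝓝[>] 0)
      (𝓝 (sys.S x (sys.inputOp (sys.applyC (sys.S x b)
        - lam • sys.G (sys.S (x + x) ∘L sys.inputOp) (sys.S x v))))) := by
    have h1 := tendsto_inv_smul_integral (sys.continuousOn_SBCS hb) hx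
    have h2 := tendsto_inv_smul_integral (f := fun s =>
      sys.S s (sys.inputOp (sys.G (sys.S (s + x) ∘L sys.inputOp) (sys.S x v))))
      ((sys.continuousOn_SBG hx).clm_apply continuousOn_const) hx
    rw [map_sub, map_sub, map_smul, map_smul]
    refine (h1.sub (h2.const_smul lam)).congr' ?_
    filter_upwards [self_mem_nhdsWithin] with h hh
    have hh0 : 0 ≤ h := le_of_lt hh
    rw [← sys.R_sub_R hb hx (by linarith), ← sys.Rop_sub_Rop_Rop hx hh0, smul_comm lam,
      ← smul_sub, ← Rop_apply, ← Rop_apply]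
    congr 1
    have e : v = b - lam • sys.Rop x v := by rw [← hvb]; abel
    conv_rhs => rw [e]
    simp only [map_sub, map_smul, smul_sub]
    abel
  have h0 : 0 < 1 - ‖lam‖ := by linarith
  have hbase : Tendsto (fun h : ℝ => (h⁻¹ • (b - sys.S h b)
      - lam • (h⁻¹ • (sys.Rop x v - sys.Rop (x + h) v)))
      - (z - lam • sys.S h (sys.Rop x z))) (𝓝[>] 0) (𝓝 0) := by
    have h3 : Tendsto (fun h : ℝ => z - lam • sys.S h (sys.Rop x z)) (𝓝[>] 0) (𝓝 r) := by
      rw [← hzr]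
      exact tendsto_const_nhds.sub ((sys.S_tendsto _).const_smul lam)
    have := (((sys.generator _ _).1 hb).sub (hE.const_smul lam)).sub h3
    rwa [← hr, sub_self] at this
  rw [tendsto_iff_norm_sub_tendsto_zero]
  have h4 := (hbase.norm).const_mul (1 - ‖lam‖)⁻¹
  rw [norm_zero, mul_zero] at h4
  refine squeeze_zero' (.of_forall fun _ => norm_nonneg _) ?_ h4
  filter_upwards [self_mem_nhdsWithin] with h hh
  have hh0 : 0 ≤ h := le_of_lt hh
  -- The lower bound applied to the difference quotient of `v` minus its expected limit `z`.
  have h5 := norm_le_of_contraction (lam := lam) (L := sys.S h ∘L sys.Rop x)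
    (fun ξ => sys.norm_S_Rop_le hh0 hx ξ) (h⁻¹ • (v - sys.S h v) - z)
  rw [inv_mul_eq_div, le_div_iff₀ h0, mul_comm]
  refine h5.trans (le_of_eq ?_)
  congr 1
  have h6 : v - sys.S h v - lam • sys.S h (sys.Rop x (v - sys.S h v))
      = (b - sys.S h b) - lam • (sys.Rop x v - sys.Rop (x + h) v) := by
    have e1 : sys.Rop (x + h) v = sys.S h (sys.Rop x (sys.S h v)) := by
      rw [Rop_apply, Rop_apply, sys.S_add_apply hx hh0, add_comm, sys.S_add_apply hh0 hx,
        sys.S_comm_apply hx hh0, sys.S_comm_apply hh0 hx v]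
    rw [e1]
    rw [← hvb]
    simp only [map_sub, map_add, map_smul, smul_sub]
    abel
  have ec : ∀ w : H, h⁻¹ • w = ((h⁻¹ : ℝ) : ℂ) • w := fun w => (Complex.coe_smul _ _).symm
  simp only [ec]
  rw [ContinuousLinearMap.comp_apply, map_sub (sys.Rop x), map_sub (sys.S h), map_smul, map_smul,
    smul_sub lam, smul_comm lam, smul_comm lam, sub_sub_sub_comm, ← smul_sub, ← smul_sub, h6]

-- Apply CS(x) to b = N b + λ R_x N b; both summands are now known to lie in the domain. The right
-- side is bounded in N b apart from the harmless term in b.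
include hlam in
theorem applyC_S_N {x : ℝ} (hx : 0 ≤ x) {b : H} (hb : b ∈ sys.A.domain) :
    sys.applyC (sys.S x (sys.N lam x b)) = sys.applyC (sys.S x b)
      - lam • sys.G (sys.S (x + x) ∘L sys.inputOp) (sys.S x (sys.N lam x b)) := by
  obtain ⟨β, hb⟩ := sys.exists_mem_graph hb
  have h1 := sys.N_mem_graph hlam hx hb
  have h2 := sys.mem_domain_of_mem_graph h1
  rw [← sys.applyC_S_Rop hx hx h2]
  have h3 := sys.S_mem_graph (sys.Rop_mem_graph hx h1) hx
  have h4 := sys.S_mem_graph h1 hx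
  have e : sys.S x b = sys.S x (sys.N lam x b) + lam • sys.S x (sys.Rop x (sys.N lam x b)) := by
    rw [← map_smul, ← map_add, sys.N_add hlam hx]
  rw [e, sys.applyC_add (sys.mem_domain_of_mem_graph h4)
    (sys.A.domain.smul_mem _ (sys.mem_domain_of_mem_graph h3)),
    sys.applyC_smul _ (sys.mem_domain_of_mem_graph h3), add_sub_cancel_right]

end LinearSystem

/-! ### The Gelfand-Levitan equation: existence and uniqueness. -/

theorem setIntegral_Ioi_eq_halfLine {E : Type*} [NormedAddCommGroup E] [NormedSpace ℝ E]
    (f : ℝ → E) (x : ℝ) : ∫ z in Ioi x, f z = ∫ t, f (t + x) ∂halfLine :=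
  ((measurePreserving_add_halfLine x).integral_comp (measurableEmbedding_addRight x) f).symm

theorem MeasureTheory.MemLp.comp_add_halfLine {E : Type*} [NormedAddCommGroup E] {f : ℝ → E}
    {x : ℝ} {p : ENNReal} (hf : MemLp f p (volume.restrict (Ioi x))) :
    MemLp (fun t => f (t + x)) p halfLine :=
  hf.comp_measurePreserving (measurePreserving_add_halfLine x)

theorem MeasureTheory.MemLp.clm_apply_const {α E F : Type*} [MeasurableSpace α] {μ : Measure α}
    [NormedAddCommGroup E] [NormedSpace ℂ E] [NormedAddCommGroup F] [NormedSpace ℂ F]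
    {p : ENNReal} {f : α → E →L[ℂ] F} (hf : MemLp f p μ) (u : E) :
    MemLp (fun a => f a u) p μ :=
  (ContinuousLinearMap.apply ℂ F u).comp_memLp' hf

theorem MeasureTheory.MemLp.restrict_Ioi {E : Type*} [NormedAddCommGroup E] {f : ℝ → E}
    {x : ℝ} {p : ENNReal} (hf : MemLp f p halfLine) (hx : 0 ≤ x) :
    MemLp f p (volume.restrict (Ioi x)) :=
  hf.mono_measure (Measure.restrict_mono (Ioi_subset_Ioi hx) le_rfl)

namespace LinearSystem

variable {H H₀ : Type*}
  [NormedAddCommGroup H] [InnerProductSpace ℂ H] [CompleteSpace H]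
  [NormedAddCommGroup H₀] [InnerProductSpace ℂ H₀] [CompleteSpace H₀] [FiniteDimensional ℂ H₀]
  (sys : LinearSystem H H₀)

/-- The operator `A B`. -/
noncomputable def AB : H₀ →L[ℂ] H :=
  LinearMap.toContinuousLinearMap (sys.A.toFun ∘ₗ sys.B)

theorem inputOp_mem_graph (u : H₀) : (sys.inputOp u, sys.AB u) ∈ sys.A.graph :=
  sys.A.mem_graph (sys.B u)

theorem S_inputOp_mem_graph {x : ℝ} (hx : 0 ≤ x) (u : H₀) :
    ((sys.S x ∘L sys.inputOp) u, (sys.S x ∘L sys.AB) u) ∈ sys.A.graph :=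
  sys.S_mem_graph (sys.inputOp_mem_graph u) hx

theorem S_inputOp_mem_domain {x : ℝ} (hx : 0 ≤ x) (u : H₀) :
    sys.S x (sys.inputOp u) ∈ sys.A.domain :=
  sys.mem_domain_of_mem_graph (sys.S_inputOp_mem_graph hx u)

theorem compC_apply {L : H₀ →L[ℂ] H} (h : ∀ u, L u ∈ sys.A.domain) (u : H₀) :
    sys.compC L u = sys.applyC (L u) := by
  rw [compC, dif_pos h, applyC, dif_pos (h u)]; rfl

theorem phi_apply {x : ℝ} (hx : 0 ≤ x) (u : H₀) :
    sys.phi x u = sys.applyC (sys.S x (sys.inputOp u)) :=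
  sys.compC_apply (sys.S_inputOp_mem_domain hx) u

theorem phi_eq {x : ℝ} (hx : 0 ≤ x) :
    sys.phi x = sys.C₀ ∘L sys.S x ∘L sys.inputOp + sys.C₁ ∘L sys.S x ∘L sys.AB := by
  ext u
  rw [sys.phi_apply hx]
  exact sys.applyC_eq (sys.S_inputOp_mem_graph hx u)

theorem continuousOn_phi : ContinuousOn sys.phi (Ici 0) :=
  ((continuousOn_const.clm_comp (sys.continuousOn_S_comp _)).add
    (continuousOn_const.clm_comp (sys.continuousOn_S_comp _))).congr fun _ hx => sys.phi_eq hx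

variable [hcon : sys.IsContractive]

theorem obsOp_S_inputOp_ae {x : ℝ} (hx : 0 ≤ x) :
    sys.obsOp (sys.S x ∘L sys.inputOp) =ᵐ[halfLine] fun t => sys.phi (t + x) := by
  filter_upwards [sys.obsOp_ae (sys.S_inputOp_mem_graph hx),
    ae_restrict_mem measurableSet_Ioi] with t ht ht0
  rw [ht, sys.phi_eq (add_nonneg (le_of_lt ht0) hx), sys.S_add t x (le_of_lt ht0) hx]
  rfl

theorem obs_S_inputOp_ae {x : ℝ} (hx : 0 ≤ x) (u : H₀) :
    sys.obs (sys.S x (sys.inputOp u)) =ᵐ[halfLine] fun t => sys.phi (t + x) u := by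
  filter_upwards [sys.obs_ae_applyC (sys.S_inputOp_mem_graph hx u),
    ae_restrict_mem measurableSet_Ioi] with t ht ht0
  rw [sys.phi_apply (add_nonneg (le_of_lt ht0) hx), sys.S_add_apply (le_of_lt ht0) hx]
  exact ht

theorem memLp_phi {x : ℝ} (hx : 0 ≤ x) : MemLp (fun t => sys.phi (t + x)) 2 halfLine :=
  (Lp.memLp (sys.obsOp (sys.S x ∘L sys.inputOp))).ae_eq (sys.obsOp_S_inputOp_ae hx)

theorem G_S_inputOp {x y : ℝ} (hx : 0 ≤ x) (hy : 0 ≤ y) (u : H₀) :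
    sys.G (sys.S x ∘L sys.inputOp) (sys.S y (sys.inputOp u))
      = ∫ t, sys.phi (t + x) (sys.phi (t + y) u) ∂halfLine := by
  rw [G_apply]
  refine integral_congr_ae ?_
  filter_upwards [sys.obsOp_S_inputOp_ae hx, sys.obs_S_inputOp_ae hy u] with t h1 h2
  rw [h1, h2]

theorem apply_R₀_S_inputOp (L : H →L[ℂ] H₀) {y : ℝ} (hy : 0 ≤ y) (u : H₀) :
    L (sys.R₀ (sys.S y (sys.inputOp u)))
      = ∫ t, L (sys.S t (sys.inputOp (sys.phi (t + y) u))) ∂halfLine := by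
  rw [R₀_apply, sys.apply_ctrl]
  refine integral_congr_ae ?_
  filter_upwards [sys.obs_S_inputOp_ae hy u] with t h1
  rw [h1]

/-- The operator `∫_0^∞ φ(2x + t) C S(x + t) dt`, which extends `C S(x) R_x`. -/
noncomputable def Gx (x : ℝ) : H →L[ℂ] H₀ := sys.G (sys.S (x + x) ∘L sys.inputOp) ∘L sys.S x

/-- The operator `∫_0^∞ φ(2x + t) C S(x + t) dt (1 + λ R_x)⁻¹ S(y) B`. -/
noncomputable def J (lam : ℂ) (x y : ℝ) : H₀ →L[ℂ] H₀ :=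
  sys.Gx x ∘L sys.N lam x ∘L sys.S y ∘L sys.inputOp

/-- The operator `C S(x) (1 + λ R_x)⁻¹ S(y) B`. -/
noncomputable def K (lam : ℂ) (x y : ℝ) : H₀ →L[ℂ] H₀ := sys.phi (x + y) - lam • sys.J lam x y

variable {lam : ℂ} (hlam : ‖lam‖ < 1)

theorem preT_eq {x y : ℝ} (hx : 0 ≤ x) (u : H₀) :
    sys.preT lam x y u = sys.S x (sys.N lam x (sys.S y (sys.inputOp u))) := by
  rw [preT, sys.R_eq_Rop hx]; rfl

include hlam in
theorem preT_mem_domain {x y : ℝ} (hx : 0 ≤ x) (hy : 0 ≤ y) (u : H₀) :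
    sys.preT lam x y u ∈ sys.A.domain := by
  rw [sys.preT_eq hx]
  exact sys.mem_domain_of_mem_graph
    (sys.S_mem_graph (sys.N_mem_graph hlam hx (sys.S_inputOp_mem_graph hy u)) hx)

include hlam in
theorem applyC_S_N_S_inputOp {x y : ℝ} (hx : 0 ≤ x) (hy : 0 ≤ y) (u : H₀) :
    sys.applyC (sys.S x (sys.N lam x (sys.S y (sys.inputOp u)))) = sys.K lam x y u := by
  rw [sys.applyC_S_N hlam hx (sys.S_inputOp_mem_domain hy u), ← sys.S_add_apply hx hy,
    ← sys.phi_apply (add_nonneg hx hy)]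
  rfl

include hlam in
theorem T_eq {x y : ℝ} (hx : 0 ≤ x) (hy : 0 ≤ y) : sys.T lam x y = -lam • sys.K lam x y := by
  rw [T]
  congr 1
  ext u
  rw [sys.compC_apply (sys.preT_mem_domain hlam hx hy), sys.preT_eq hx,
    sys.applyC_S_N_S_inputOp hlam hx hy]

theorem memLp_K {x : ℝ} (hx : 0 ≤ x) : MemLp (sys.K lam x) 2 halfLine := by
  have h1 : MemLp (fun y => sys.phi (x + y)) 2 halfLine := by
    simpa only [add_comm] using sys.memLp_phi hx
  have h2 := sys.memLp_comp_S_input (sys.Gx x ∘L sys.N lam x)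
  exact h1.sub (h2.const_smul lam)

include hlam in
theorem memLp_T {x : ℝ} (hx : 0 ≤ x) : MemLp (sys.T lam x) 2 (volume.restrict (Ioi x)) := by
  refine ((sys.memLp_K (lam := lam) hx).restrict_Ioi hx |>.const_smul (-lam)).ae_eq ?_
  filter_upwards [ae_restrict_mem measurableSet_Ioi] with y hy
  exact (sys.T_eq hlam hx (hx.trans (le_of_lt hy))).symm

theorem integrable_comp_phi {x y : ℝ} (hx : 0 ≤ x) (hy : 0 ≤ y) {F : ℝ → H₀ →L[ℂ] H₀}
    (hF : MemLp F 2 (volume.restrict (Ioi x))) :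
    IntegrableOn (fun z => F z ∘L sys.phi (z + y)) (Ioi x) :=
  hF.integrable_clm_comp ((sys.memLp_phi hy).restrict_Ioi hx)

theorem integral_comp_phi_apply {x y : ℝ} (hx : 0 ≤ x) (hy : 0 ≤ y) {F : ℝ → H₀ →L[ℂ] H₀}
    (hF : MemLp F 2 (volume.restrict (Ioi x))) (u : H₀) :
    (∫ z in Ioi x, F z ∘L sys.phi (z + y)) u
      = ∫ t, F (t + x) (sys.phi (t + (x + y)) u) ∂halfLine := by
  rw [ContinuousLinearMap.integral_apply (sys.integrable_comp_phi hx hy hF),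
    setIntegral_Ioi_eq_halfLine]
  simp only [ContinuousLinearMap.comp_apply, add_assoc]

-- For b = S(y)Bu the function t ↦ φ(t+x+y)u is the output of S(x)b, so integrating T(x,·) against
-- it assembles `ctrl` and `obs` into R_x: the integral is -λ(Gx b - λ Gx N R_x b). The equation
-- then reduces to N b + λ N R_x b = b.
include hlam in
theorem gelfandLevitan_T {x y : ℝ} (hx : 0 ≤ x) (hy : 0 ≤ y) :
    sys.GelfandLevitanAt lam x y (sys.T lam x) := by
  refine ⟨sys.integrable_comp_phi hx hy (sys.memLp_T hlam hx), ?_⟩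
  ext u
  have hxy : 0 ≤ x + y := by positivity
  set b := sys.S y (sys.inputOp u) with hb
  have h1 : (∫ z in Ioi x, sys.T lam x z ∘L sys.phi (z + y)) u
      = -lam • (sys.Gx x b - lam • sys.Gx x (sys.N lam x (sys.Rop x b))) := by
    rw [sys.integral_comp_phi_apply hx hy (sys.memLp_T hlam hx)]
    have e1 : sys.Gx x b = ∫ t, sys.phi (t + (x + x)) (sys.phi (t + (x + y)) u) ∂halfLine := by
      rw [← sys.G_S_inputOp (by positivity) hxy, sys.S_add_apply hx hy]; rfl
    have e2 : sys.Gx x (sys.N lam x (sys.Rop x b)) = ∫ t, (sys.Gx x ∘L sys.N lam x ∘L sys.S x)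
        (sys.S t (sys.inputOp (sys.phi (t + (x + y)) u))) ∂halfLine := by
      rw [← sys.apply_R₀_S_inputOp _ hxy, sys.S_add_apply hx hy]; rfl
    have i1 : Integrable (fun t => sys.phi (t + (x + x)) (sys.phi (t + (x + y)) u)) halfLine :=
      (sys.memLp_phi (by positivity)).integrable_clm_apply
        ((sys.memLp_phi hxy).clm_apply_const u)
    have i2 := sys.integrable_comp_S_input (sys.Gx x ∘L sys.N lam x ∘L sys.S x)
        ((sys.memLp_phi hxy).clm_apply_const u)
    have i3 : Integrable (fun t => lam • (sys.Gx x ∘L sys.N lam x ∘L sys.S x)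
        (sys.S t (sys.inputOp (sys.phi (t + (x + y)) u)))) halfLine := i2.smul lam
    rw [e1, e2, ← integral_smul lam, ← integral_sub i1 i3, ← integral_smul]
    refine integral_congr_ae ?_
    filter_upwards [ae_restrict_mem measurableSet_Ioi] with t ht
    have ht0 : 0 ≤ t := le_of_lt ht
    rw [sys.T_eq hlam hx (by positivity), K, add_left_comm]
    simp only [smul_apply, sub_apply, J, ContinuousLinearMap.comp_apply]
    rw [add_comm t x, sys.S_add_apply hx ht0]
  have h2 := sys.N_comm_add hlam hx b
  simp only [add_apply, smul_apply, zero_apply, h1, sys.T_eq hlam hx hy, K, sub_apply]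
  have h3 : sys.J lam x y u = sys.Gx x (sys.N lam x b) := rfl
  rw [map_add, map_smul] at h2
  have h4 := congrArg (sys.Gx x) h2
  rw [map_add, map_smul] at h4
  rw [h3, ← h4]
  module

/-- The homogeneous Gelfand-Levitan equation has only the zero solution in `L²`. -/
theorem integral_comp_phi_eq_zero (hlam : ‖lam‖ < 1) {x : ℝ} (hx : 0 ≤ x) {D : ℝ → H₀ →L[ℂ] H₀}
    (hD : MemLp D 2 (volume.restrict (Ioi x)))
    (h : ∀ᵐ y ∂(volume.restrict (Ioi x)), D y + lam • ∫ z in Ioi x, D z ∘L sys.phi (z + y) = 0)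
    {y : ℝ} (hy : 0 ≤ y) : ∫ z in Ioi x, D z ∘L sys.phi (z + y) = 0 := by
  let F := hD.comp_add_halfLine.toLp
  have hF : F =ᵐ[halfLine] fun t => D (t + x) := hD.comp_add_halfLine.coeFn_toLp
  -- `W` pairs `D` with the output of any vector of H, so that the integral of `D` against φ(·+y) is
  -- W S(y) B.
  let W : H →L[ℂ] H₀ := ContinuousLinearMap.lpPairing halfLine 2 2
    (ContinuousLinearMap.id ℂ (H₀ →L[ℂ] H₀)) F ∘L sys.obs ∘L sys.S x
  have hW : ∀ w, W w = ∫ t, D (t + x) (sys.obs (sys.S x w) t) ∂halfLine := fun w => by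
    have h1 : W w = ∫ t, F t (sys.obs (sys.S x w) t) ∂halfLine :=
      ContinuousLinearMap.lpPairing_eq_integral _ _ _
    rw [h1]
    refine integral_congr_ae ?_
    filter_upwards [hF] with t ht
    rw [ht]
  have hWB : ∀ y : ℝ, 0 ≤ y → ∫ z in Ioi x, D z ∘L sys.phi (z + y)
      = W ∘L sys.S y ∘L sys.inputOp := fun y hy => by
    ext u
    have e : (W ∘L sys.S y ∘L sys.inputOp) u = W (sys.S y (sys.inputOp u)) := rfl
    rw [sys.integral_comp_phi_apply hx hy hD, e, hW, ← sys.S_add_apply hx hy]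
    refine integral_congr_ae ?_
    filter_upwards [sys.obs_S_inputOp_ae (add_nonneg hx hy) u] with t ht
    rw [ht]
  have h0 : ∀ᵐ t ∂halfLine, D (t + x) + lam • W ∘L sys.S (t + x) ∘L sys.inputOp = 0 := by
    have := (measurePreserving_add_halfLine x).quasiMeasurePreserving.ae h
    filter_upwards [this, ae_restrict_mem measurableSet_Ioi] with t ht ht0
    rwa [hWB _ (add_nonneg (le_of_lt ht0) hx)] at ht
  -- Integrating the equation D = -λ W S(·)B against the output of S(x)w gives W = -λ W R_x. As I +
  -- λ R_x is onto, `W` vanishes.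
  have h1 : ∀ w, W (w + lam • sys.Rop x w) = 0 := fun w => by
    have e : W (sys.Rop x w) = ∫ t, (W ∘L sys.S x) (sys.S t (sys.inputOp
        (sys.obs (sys.S x w) t))) ∂halfLine := by
      rw [← sys.apply_ctrl]; rfl
    rw [map_add, map_smul, e, hW, ← integral_smul, ← integral_add]
    · refine integral_eq_zero_of_ae ?_
      filter_upwards [h0, ae_restrict_mem measurableSet_Ioi] with t ht ht0
      have := DFunLike.congr_fun ht (sys.obs (sys.S x w) t)
      rw [add_comm t x, sys.S_add x t hx (le_of_lt ht0)] at this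
      rw [add_comm t x]
      exact this
    · exact hD.comp_add_halfLine.integrable_clm_apply (Lp.memLp _)
    · exact (sys.integrable_comp_S_input _ (Lp.memLp _)).smul lam
  have h2 : W = 0 := by
    ext w
    have := h1 (sys.N lam x w)
    rwa [sys.N_add hlam hx] at this
  rw [hWB y hy, h2, ContinuousLinearMap.zero_comp]

-- The difference from T solves the homogeneous equation almost everywhere, which kills its integral
-- term for every y ≥ 0. Hence F and T agree at each single y where F satisfies the equation, and
-- one lemma serves both forms of uniqueness.
include hlam in
theorem eq_T_of_gelfandLevitan {x : ℝ} (hx : 0 ≤ x) {F : ℝ → H₀ →L[ℂ] H₀}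
    (hF : MemLp F 2 (volume.restrict (Ioi x)))
    (h : ∀ᵐ y ∂(volume.restrict (Ioi x)), sys.GelfandLevitanAt lam x y F) {y : ℝ} (hy : 0 ≤ y)
    (hFy : sys.GelfandLevitanAt lam x y F) : F y = sys.T lam x y := by
  have key : ∀ y : ℝ, 0 ≤ y → sys.GelfandLevitanAt lam x y F → (F y - sys.T lam x y)
      + lam • ∫ z in Ioi x, (F z - sys.T lam x z) ∘L sys.phi (z + y) = 0 := fun y hy hFy => by
    have h1 := (sys.gelfandLevitan_T hlam hx hy)
    have e : ∫ z in Ioi x, (F z - sys.T lam x z) ∘L sys.phi (z + y)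
        = (∫ z in Ioi x, F z ∘L sys.phi (z + y)) - ∫ z in Ioi x, sys.T lam x z ∘L sys.phi (z + y) :=
      by
        rw [← integral_sub hFy.1 h1.1]
        simp only [ContinuousLinearMap.sub_comp]
    rw [e]
    have := congrArg₂ (· - ·) hFy.2 h1.2
    simp only [sub_zero] at this
    rw [← this]
    module
  have h0 := sys.integral_comp_phi_eq_zero hlam hx (hF.sub (sys.memLp_T hlam hx)) (by
    filter_upwards [h, ae_restrict_mem measurableSet_Ioi] with y h1 h2
    exact key y (hx.trans (le_of_lt h2)) h1) hy
  have h1 := key y hy hFy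
  simp only [Pi.sub_apply] at h0
  rw [h0, smul_zero, add_zero] at h1
  exact sub_eq_zero.1 h1

end LinearSystem

/-! ### Primitives of locally integrable functions on (0,∞). -/

section Primitive

variable {E F G : Type*} [NormedAddCommGroup E] [NormedSpace ℝ E]
  [NormedAddCommGroup F] [NormedSpace ℝ F] [NormedAddCommGroup G] [NormedSpace ℝ G]

/-- `f` is a primitive on `(0, ∞)` of the locally integrable function `g`. -/
def IsPrimitive (f g : ℝ → E) : Prop :=
  ∀ ⦃a b : ℝ⦄, 0 < a → a ≤ b → IntervalIntegrable g volume a b ∧ ∫ t in a..b, g t = f b - f a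

namespace IsPrimitive

variable {f g f₁ g₁ : ℝ → E}

theorem congr (h : IsPrimitive f g) (hf : ∀ x, 0 < x → f₁ x = f x)
    (hg : ∀ᵐ x ∂(volume.restrict (Ioi 0)), g₁ x = g x) : IsPrimitive f₁ g₁ := by
  intro a b ha hab
  obtain ⟨h1, h2⟩ := h ha hab
  have h3 : g =ᵐ[volume.restrict (uIoc a b)] g₁ := by
    rw [uIoc_of_le hab]
    have := ae_restrict_of_ae_restrict_of_subset
      (Ioc_subset_Ioi_self.trans (Ioi_subset_Ioi ha.le) : Ioc a b ⊆ Ioi 0) hg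
    filter_upwards [this] with x hx
    exact hx.symm
  refine ⟨h1.congr_ae h3, ?_⟩
  rw [hf b (ha.trans_le hab), hf a ha, ← h2]
  refine intervalIntegral.integral_congr_ae_restrict h3.symm

theorem add (h : IsPrimitive f g) (h₁ : IsPrimitive f₁ g₁) :
    IsPrimitive (fun x => f x + f₁ x) (fun x => g x + g₁ x) := by
  intro a b ha hab
  obtain ⟨h1, h2⟩ := h ha hab
  obtain ⟨h3, h4⟩ := h₁ ha hab
  refine ⟨h1.add h3, ?_⟩
  rw [intervalIntegral.integral_add h1 h3, h2, h4]
  module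

theorem clm [CompleteSpace E] [CompleteSpace F] (h : IsPrimitive f g) (L : E →L[ℝ] F) :
    IsPrimitive (fun x => L (f x)) (fun x => L (g x)) := by
  intro a b ha hab
  obtain ⟨h1, h2⟩ := h ha hab
  refine ⟨⟨L.integrable_comp h1.1, L.integrable_comp h1.2⟩, ?_⟩
  rw [L.intervalIntegral_comp_comm h1, h2, map_sub]

theorem of_hasDerivAt [CompleteSpace E] (h : ∀ x, 0 < x → HasDerivAt f (g x) x)
    (hg : ContinuousOn g (Ioi 0)) : IsPrimitive f g := by
  intro a b ha hab
  have hs : uIcc a b ⊆ Ioi 0 := by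
    rw [uIcc_of_le hab]
    exact fun x hx => ha.trans_le hx.1
  have h1 : IntervalIntegrable g volume a b := (hg.mono hs).intervalIntegrable
  exact ⟨h1, intervalIntegral.integral_eq_sub_of_hasDerivAt (fun x hx => h x (hs hx)) h1⟩

theorem integral_eq (h : IsPrimitive f g) {a b : ℝ} (ha : 0 < a) (hab : a ≤ b) :
    f b = f a + ∫ t in a..b, g t := by
  rw [(h ha hab).2]; abel

theorem continuousOn [CompleteSpace E] (h : IsPrimitive f g) : ContinuousOn f (Ioi 0) := by
  intro x hx
  have hx : 0 < x := hx
  have h1 : ContinuousOn (fun t => f (x / 2) + ∫ s in (x / 2)..t, g s) (Icc (x / 2) (2 * x)) := by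
    refine continuousOn_const.add ?_
    rw [← uIcc_of_le (by linarith : x / 2 ≤ 2 * x)]
    exact intervalIntegral.continuousOn_primitive_interval'
      (h (by linarith) (by linarith : x / 2 ≤ 2 * x)).1 left_mem_uIcc
  have h2 : ContinuousOn f (Icc (x / 2) (2 * x)) :=
    h1.congr fun t ht => h.integral_eq (by linarith) ht.1
  exact (h2.continuousAt (Icc_mem_nhds (by linarith) (by linarith))).continuousWithinAt

/-- Lebesgue differentiation on countably many intervals that exhaust (0,∞). -/
theorem ae_hasDerivAt [CompleteSpace E] (h : IsPrimitive f g) :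
    ∀ᵐ x ∂(volume.restrict (Ioi 0)), HasDerivAt f (g x) x := by
  have key : ∀ n : ℕ, ∀ᵐ x : ℝ, x ∈ Ioo (1 / ((n : ℝ) + 1)) ((n : ℝ) + 1) →
      HasDerivAt f (g x) x := by
    intro n
    have hn : (0 : ℝ) < 1 / ((n : ℝ) + 1) := by positivity
    by_cases hle : 1 / ((n : ℝ) + 1) ≤ (n : ℝ) + 1
    · filter_upwards [(h hn hle).1.ae_hasDerivAt_integral] with x hx hx'
      have h1 := hx (by rw [uIcc_of_le hle]; exact Ioo_subset_Icc_self hx') (1 / ((n : ℝ) + 1))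
        left_mem_uIcc
      refine (h1.const_add (f (1 / ((n : ℝ) + 1)))).congr_of_eventuallyEq ?_
      filter_upwards [Ioo_mem_nhds hx'.1 hx'.2] with t ht
      exact h.integral_eq hn ht.1.le
    · refine .of_forall fun x hx => absurd (hx.1.trans hx.2).le hle
  rw [ae_restrict_iff' measurableSet_Ioi]
  filter_upwards [ae_all_iff.2 key] with x hx hx0
  have hx0 : 0 < x := hx0
  obtain ⟨n, hn⟩ := exists_nat_gt (max x (1 / x))
  refine hx n ⟨?_, ?_⟩
  · rw [div_lt_comm₀ (by positivity) hx0]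
    linarith [le_max_right x (1 / x)]
  · linarith [le_max_left x (1 / x)]

omit [NormedSpace ℝ E] in
theorem _root_.ContinuousOn.aestronglyMeasurable_and_bound {w : ℝ → E} {a b : ℝ}
    (hw : ContinuousOn w (Icc a b)) : AEStronglyMeasurable w (volume.restrict (Ioc a b)) ∧
      ∃ c, ∀ᵐ t ∂(volume.restrict (Ioc a b)), ‖w t‖ ≤ c := by
  refine ⟨(hw.mono Ioc_subset_Icc_self).aestronglyMeasurable measurableSet_Ioc, ?_⟩
  obtain ⟨c, hc⟩ := isCompact_Icc.exists_bound_of_continuousOn hw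
  exact ⟨c, (ae_restrict_mem measurableSet_Ioc).mono fun t ht => hc t (Ioc_subset_Icc_self ht)⟩

/-- The product rule for primitives. -/
theorem bilin [CompleteSpace E] [CompleteSpace F] [CompleteSpace G] {u v : ℝ → F}
    (h : IsPrimitive f g) (h' : IsPrimitive u v) (L : E →L[ℝ] F →L[ℝ] G) :
    IsPrimitive (fun x => L (f x) (u x)) (fun x => L (g x) (u x) + L (f x) (v x)) := by
  intro a b ha hab
  obtain ⟨g1, g2⟩ := h ha hab
  obtain ⟨v1, v2⟩ := h' ha hab
  have hsub : uIcc a b ⊆ Ioi 0 := by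
    rw [uIcc_of_le hab]
    exact fun x hx => ha.trans_le hx.1
  rw [intervalIntegrable_iff_integrableOn_Ioc_of_le hab] at g1 v1
  have cf : ContinuousOn f (Icc a b) := h.continuousOn.mono (uIcc_of_le hab ▸ hsub)
  have cu : ContinuousOn u (Icc a b) := h'.continuousOn.mono (uIcc_of_le hab ▸ hsub)
  set μ := volume.restrict (Ioc a b) with hμ
  have i1 : Integrable (fun t => L (g t) (u t)) μ := by
    obtain ⟨m, c, hc⟩ := cu.aestronglyMeasurable_and_bound
    refine (g1.norm.const_mul (‖L‖ * c)).mono' (L.aestronglyMeasurable_comp₂ g1.1 m) ?_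
    filter_upwards [hc] with t ht
    calc _ ≤ ‖L‖ * ‖g t‖ * ‖u t‖ := L.le_opNorm₂ _ _
      _ ≤ ‖L‖ * ‖g t‖ * c := by gcongr
      _ = _ := by ring
  have i2 : Integrable (fun t => L (f t) (v t)) μ := by
    obtain ⟨m, c, hc⟩ := cf.aestronglyMeasurable_and_bound
    refine (v1.norm.const_mul (‖L‖ * c)).mono' (L.aestronglyMeasurable_comp₂ m v1.1) ?_
    filter_upwards [hc] with t ht
    calc _ ≤ ‖L‖ * ‖f t‖ * ‖v t‖ := L.le_opNorm₂ _ _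
      _ ≤ ‖L‖ * c * ‖v t‖ := by gcongr
      _ = _ := by ring
  refine ⟨(intervalIntegrable_iff_integrableOn_Ioc_of_le hab).2 (i1.add i2), ?_⟩
  have hh : Integrable (fun z : ℝ × ℝ => L (g z.1) (v z.2)) (μ.prod μ) :=
    Integrable.op_fst_snd (op := fun p q => L p q) (by fun_prop)
      ⟨‖L‖, fun p q => L.le_opNorm₂ p q⟩ g1 v1
  -- The integral of L(g(t), v(r)) over the square (a,b]² is split along the diagonal. Where r ≤ t
  -- the inner integral of v gives u(t) - u(a); on the other half that of g gives f - f(a).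
  let s : Set (ℝ × ℝ) := {z | z.2 ≤ z.1}
  have hs : MeasurableSet s := measurableSet_le measurable_snd measurable_fst
  have e0 : ∫ z, L (g z.1) (v z.2) ∂(μ.prod μ) = L (f b - f a) (u b - u a) := by
    rw [integral_prod _ hh, ← g2, ← v2, intervalIntegral.integral_of_le hab,
      intervalIntegral.integral_of_le hab, ← hμ, ← L.flip_apply, ← (L.flip _).integral_comp_comm g1]
    refine integral_congr_ae (.of_forall fun t => ?_)
    exact (L (g t)).integral_comp_comm v1
  have e1 : ∫ z, s.indicator (fun z => L (g z.1) (v z.2)) z ∂(μ.prod μ)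
      = ∫ t, L (g t) (u t) - L (g t) (u a) ∂μ := by
    rw [integral_prod _ (hh.indicator hs)]
    refine integral_congr_ae ?_
    filter_upwards [ae_restrict_mem measurableSet_Ioc] with t ht
    have : ∀ r, s.indicator (fun z => L (g z.1) (v z.2)) (t, r)
        = (Iic t).indicator (fun r => L (g t) (v r)) r := fun r => rfl
    simp only [this]
    rw [integral_indicator measurableSet_Iic, hμ, Measure.restrict_restrict measurableSet_Iic,
      inter_comm, Ioc_inter_Iic, min_eq_right ht.2,
      (L (g t)).integral_comp_comm (v1.mono_set (Ioc_subset_Ioc_right ht.2)),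
      ← intervalIntegral.integral_of_le ht.1.le, (h' ha ht.1.le).2, map_sub]
  have e2 : ∫ z, sᶜ.indicator (fun z => L (g z.1) (v z.2)) z ∂(μ.prod μ)
      = ∫ t, L (f t) (v t) - L (f a) (v t) ∂μ := by
    rw [integral_prod_symm _ (hh.indicator hs.compl)]
    refine integral_congr_ae ?_
    filter_upwards [ae_restrict_mem measurableSet_Ioc] with t ht
    have : ∀ r, sᶜ.indicator (fun z => L (g z.1) (v z.2)) (r, t)
        = (Iio t).indicator (fun r => L.flip (v t) (g r)) r := fun r => by
      simp only [indicator, s, mem_compl_iff, mem_ofPred_eq, not_le, mem_Iio, L.flip_apply]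
    simp only [this]
    have es : Iio t ∩ Ioc a b = Ioo a t := by
      ext r
      simp only [mem_inter_iff, mem_Iio, mem_Ioc, mem_Ioo]
      exact ⟨fun h => ⟨h.2.1, h.1⟩, fun h => ⟨h.2, h.1, (h.2.trans_le ht.2).le⟩⟩
    rw [integral_indicator measurableSet_Iio, hμ, Measure.restrict_restrict measurableSet_Iio, es,
      ← integral_Ioc_eq_integral_Ioo,
      (L.flip (v t)).integral_comp_comm (g1.mono_set (Ioc_subset_Ioc_right ht.2)),
      ← intervalIntegral.integral_of_le ht.1.le, (h ha ht.1.le).2, map_sub]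
    rfl
  have e3 : ∫ z, L (g z.1) (v z.2) ∂(μ.prod μ)
      = ∫ z, s.indicator (fun z => L (g z.1) (v z.2)) z ∂(μ.prod μ)
        + ∫ z, sᶜ.indicator (fun z => L (g z.1) (v z.2)) z ∂(μ.prod μ) := by
    rw [integral_indicator hs, integral_indicator hs.compl, integral_add_compl hs hh]
  have j1 : Integrable (fun t => L (g t) (u a)) μ := (L.flip (u a)).integrable_comp g1
  have j2 : Integrable (fun t => L (f a) (v t)) μ := (L (f a)).integrable_comp v1
  have k1 : ∫ t, L (g t) (u a) ∂μ = L (f b - f a) (u a) := by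
    rw [← g2, intervalIntegral.integral_of_le hab, ← L.flip_apply,
      ← (L.flip (u a)).integral_comp_comm g1]
    rfl
  have k2 : ∫ t, L (f a) (v t) ∂μ = L (f a) (u b - u a) := by
    rw [← v2, intervalIntegral.integral_of_le hab, ← (L (f a)).integral_comp_comm v1]
  rw [e0, e1, e2, integral_sub i1 j1, integral_sub i2 j2, k1, k2] at e3
  rw [intervalIntegral.integral_of_le hab, integral_add i1 i2]
  simp only [map_sub, sub_apply] at e3 ⊢
  linear_combination (norm := module) (-1 : ℝ) • e3

end IsPrimitive

end Primitive

/-! ### Derivatives of the inverse and of the kernel J. -/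

section Calculus

variable {E F G : Type*} [NormedAddCommGroup E] [NormedSpace ℂ E]
  [NormedAddCommGroup F] [NormedSpace ℂ F] [NormedAddCommGroup G] [NormedSpace ℂ G]

theorem HasDerivAt.clm_apply_real {c : ℝ → E →L[ℂ] F} {c' : E →L[ℂ] F} {u : ℝ → E} {u' : E} {x : ℝ}
    (hc : HasDerivAt c c' x) (hu : HasDerivAt u u' x) :
    HasDerivAt (fun s => c s (u s)) (c' (u x) + c x u') x := by
  have h1 := ((ContinuousLinearMap.restrictScalarsL ℂ E F ℝ ℝ).hasFDerivAt (x := c x)).comp_hasDerivAt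
    x hc
  exact h1.clm_apply hu

theorem HasDerivAt.clm_map_real {u : ℝ → E} {u' : E} {x : ℝ} (L : E →L[ℂ] F)
    (hu : HasDerivAt u u' x) : HasDerivAt (fun s => L (u s)) (L u') x := by
  simpa using (hasDerivAt_const x L).clm_apply_real hu

theorem HasDerivAt.clm_comp_real {c : ℝ → F →L[ℂ] G} {c' : F →L[ℂ] G} {u : ℝ → E →L[ℂ] F}
    {u' : E →L[ℂ] F} {x : ℝ} (hc : HasDerivAt c c' x) (hu : HasDerivAt u u' x) :
    HasDerivAt (fun s => c s ∘L u s) (c' ∘L u x + c x ∘L u') x := by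
  have h1 := HasDerivAt.clm_apply_real (E := E →L[ℂ] F) (F := E →L[ℂ] G)
    (c := fun s => ContinuousLinearMap.compL ℂ E F G (c s)) (hc.clm_map_real _) hu
  simpa only [ContinuousLinearMap.compL_apply] using h1

/-- A bounded strongly continuous family of operators maps continuous functions to continuous
functions. -/
theorem ContinuousOn.clm_apply_of_bounded {X : Type*} [TopologicalSpace X] {s : Set X}
    {L : X → E →L[ℂ] F} {g : X → E} {M : ℝ} (hM : ∀ x ∈ s, ‖L x‖ ≤ M)
    (hL : ∀ w, ContinuousOn (fun x => L x w) s) (hg : ContinuousOn g s) :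
    ContinuousOn (fun x => L x (g x)) s := fun x hx =>
  tendsto_clm_apply_of_bounded (eventually_mem_nhdsWithin.mono hM) (hL (g x) x hx) (hg x hx)

end Calculus

namespace LinearSystem

variable {H H₀ : Type*}
  [NormedAddCommGroup H] [InnerProductSpace ℂ H] [CompleteSpace H]
  [NormedAddCommGroup H₀] [InnerProductSpace ℂ H₀] [CompleteSpace H₀] [FiniteDimensional ℂ H₀]
  (sys : LinearSystem H H₀)

/-- The derivative of `S(s) g(s)` at a point where `g` takes a value in the domain of `A`. -/
theorem hasDerivAt_S_apply {g : ℝ → H} {g' : H} {x : ℝ} (hx : 0 < x) (hg : HasDerivAt g g' x)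
    {η : H} (h : (g x, η) ∈ sys.A.graph) :
    HasDerivAt (fun s => sys.S s (g s)) (sys.S x (g' - η)) x := by
  rw [hasDerivAt_iff_tendsto_slope] at hg ⊢
  have h1 := hasDerivAt_iff_tendsto_slope.1 (sys.hasDerivAt_S h hx)
  obtain ⟨M, _, hM⟩ := sys.exists_bound
  have hpos : ∀ᶠ s in 𝓝[≠] x, 0 ≤ s :=
    nhdsWithin_le_nhds ((eventually_gt_nhds hx).mono fun s hs => le_of_lt hs)
  have h2 : Tendsto (fun s => sys.S s (slope g x s)) (𝓝[≠] x) (𝓝 (sys.S x g')) := by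
    refine tendsto_clm_apply_of_bounded (hpos.mono hM) ?_ hg
    exact ((sys.continuousOn_S g').continuousAt (Ici_mem_nhds hx)).tendsto.mono_left
      nhdsWithin_le_nhds
  have h3 := h2.add h1
  rw [← sub_eq_add_neg, ← map_sub] at h3
  refine h3.congr fun s => ?_
  simp only [slope_def_module]
  rw [ContinuousLinearMap.map_smul_of_tower, ← smul_add, map_sub]
  congr 1
  abel

theorem hasDerivAt_S_comp {x : ℝ} (hx : 0 < x) {X Y : H₀ →L[ℂ] H}
    (h : ∀ u, (X u, Y u) ∈ sys.A.graph) :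
    HasDerivAt (fun s => sys.S s ∘L X) (-(sys.S x ∘L Y)) x :=
  hasDerivAt_clm_of_apply fun u => sys.hasDerivAt_S (h u) hx

theorem hasDerivAt_S_two_comp {x : ℝ} (hx : 0 < x) {X Y : H₀ →L[ℂ] H}
    (h : ∀ u, (X u, Y u) ∈ sys.A.graph) :
    HasDerivAt (fun s => sys.S (s + s) ∘L X) (-(2 : ℝ) • (sys.S (x + x) ∘L Y)) x := by
  have h1 := HasDerivAt.scomp (g₁ := fun s => sys.S s ∘L X) (h := fun s => s + s) x
    (sys.hasDerivAt_S_comp (add_pos hx hx) h) ((hasDerivAt_id' x).add (hasDerivAt_id' x))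
  have e : (1 + 1 : ℝ) • -(sys.S (x + x) ∘L Y) = -(2 : ℝ) • (sys.S (x + x) ∘L Y) := by module
  rw [e] at h1
  exact h1

variable [hcon : sys.IsContractive]

theorem hasDerivAt_Rop {x : ℝ} (hx : 0 < x) {v w : H} (h : (v, w) ∈ sys.A.graph) :
    HasDerivAt (fun s => sys.Rop s v)
      (-sys.S x (sys.inputOp (sys.applyC (sys.S x v)))) x := by
  have hc := sys.continuousOn_SBCS h
  have h1 : HasDerivAt (fun s => sys.Rop 0 v - ∫ t in (0 : ℝ)..s,
      sys.S t (sys.inputOp (sys.applyC (sys.S t v))))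
      (-sys.S x (sys.inputOp (sys.applyC (sys.S x v)))) x := by
    have h2 := intervalIntegral.integral_hasDerivAt_right (a := 0) (b := x)
      ((hc.mono (by rw [uIcc_of_le hx.le]; exact Icc_subset_Ici_self)).intervalIntegrable)
      ((hc.mono Ioi_subset_Ici_self).stronglyMeasurableAtFilter isOpen_Ioi x hx)
      (hc.continuousAt (Ici_mem_nhds hx))
    exact h2.const_sub _
  refine h1.congr_of_eventuallyEq ?_
  filter_upwards [Ioi_mem_nhds hx] with s hs
  have := sys.R_sub_R h le_rfl (le_of_lt hs)
  simp only [Rop_apply]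
  rw [← this]
  abel

theorem continuousOn_Rop (v : H) : ContinuousOn (fun s => sys.Rop s v) (Ici 0) := by
  obtain ⟨M, _, hM⟩ := sys.exists_bound
  have h := ContinuousOn.clm_apply_of_bounded (s := Ici (0 : ℝ)) (L := sys.S)
    (g := fun s => sys.R₀ (sys.S s v)) (fun x hx => hM x hx) sys.continuousOn_S
    (sys.R₀.continuous.comp_continuousOn (sys.continuousOn_S v))
  exact h

variable {lam : ℂ} (hlam : ‖lam‖ < 1)

-- The second resolvent identity. It transfers continuity and differentiability in x from R_x to its
-- resolvent, given the uniform bound `norm_N_le`.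
include hlam in
theorem N_sub_N {x y : ℝ} (hx : 0 ≤ x) (hy : 0 ≤ y) (ξ : H) :
    sys.N lam y ξ - sys.N lam x ξ
      = lam • sys.N lam y (sys.Rop x (sys.N lam x ξ) - sys.Rop y (sys.N lam x ξ)) := by
  have h1 := sys.N_add hlam hx ξ
  have h2 := sys.N_comm_add hlam hy (sys.N lam x ξ)
  have h3 := congrArg (sys.N lam y) h1
  rw [map_add, map_smul] at h2 h3
  rw [map_sub, ← h3, ← sub_eq_zero]
  rw [← sub_eq_zero] at h2
  rw [← h2]
  module

include hlam in
theorem continuousOn_N (v : H) : ContinuousOn (fun s => sys.N lam s v) (Ici 0) := by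
  intro x hx
  have h1 : Tendsto (fun s => sys.Rop x (sys.N lam x v) - sys.Rop s (sys.N lam x v))
      (𝓝[Ici 0] x) (𝓝 0) := by
    have := (tendsto_const_nhds (x := sys.Rop x (sys.N lam x v))).sub
      (sys.continuousOn_Rop (sys.N lam x v) x hx)
    rwa [sub_self] at this
  have h2 := tendsto_clm_apply_of_bounded (L := fun s => sys.N lam s)
    (eventually_mem_nhdsWithin.mono fun s hs => sys.norm_N_le hlam hs)
    (by simp only [map_zero]; exact tendsto_const_nhds (x := (0 : H))) h1
  have h3 := (h2.const_smul lam).add_const (sys.N lam x v)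
  simp only [smul_zero, zero_add] at h3
  refine h3.congr' ?_
  filter_upwards [self_mem_nhdsWithin] with s hs
  rw [← sys.N_sub_N hlam hx hs]
  abel

-- R_x is differentiable only at vectors of the domain; N b is one by `N_mem_graph`, so the
-- resolvent identity can be divided by the increment.
include hlam in
theorem hasDerivAt_N {x : ℝ} (hx : 0 < x) {b β : H} (h : (b, β) ∈ sys.A.graph) :
    HasDerivAt (fun s => sys.N lam s b) (lam • sys.N lam x (sys.S x (sys.inputOp
      (sys.applyC (sys.S x (sys.N lam x b)))))) x := by
  have hR := hasDerivAt_iff_tendsto_slope.1 (sys.hasDerivAt_Rop hx (sys.N_mem_graph hlam hx.le h))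
  rw [hasDerivAt_iff_tendsto_slope]
  have hpos : ∀ᶠ s in 𝓝[≠] x, 0 ≤ s :=
    nhdsWithin_le_nhds ((eventually_gt_nhds hx).mono fun s hs => le_of_lt hs)
  have h2 := tendsto_clm_apply_of_bounded (L := fun s => sys.N lam s) (l := 𝓝[≠] x)
    (hpos.mono fun s hs => sys.norm_N_le hlam hs)
    (((sys.continuousOn_N hlam _).continuousAt (Ici_mem_nhds hx)).tendsto.mono_left
      nhdsWithin_le_nhds) hR.neg
  rw [neg_neg] at h2
  refine (h2.const_smul lam).congr' ?_
  filter_upwards [hpos] with s hs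
  simp only [slope_def_module]
  rw [sys.N_sub_N hlam hx.le hs, ← smul_neg, ContinuousLinearMap.map_smul_of_tower, neg_sub,
    smul_comm]

/-- The operators `∫_0^∞ (C S(x + t) P) (C S(x + t)) dt (1 + λ R_x)⁻¹ S(y) X`. -/
noncomputable def Z (lam : ℂ) (P X : H₀ →L[ℂ] H) (x y : ℝ) : H₀ →L[ℂ] H₀ :=
  sys.G (sys.S (x + x) ∘L P) ∘L sys.S x ∘L sys.N lam x ∘L sys.S y ∘L X

include hlam in
theorem continuousOn_Z (P X : H₀ →L[ℂ] H) :
    ContinuousOn (fun p : ℝ × ℝ => sys.Z lam P X p.1 p.2) (Ici 0 ×ˢ Ici 0) := by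
  obtain ⟨M, _, hM⟩ := sys.exists_bound
  have m1 : MapsTo Prod.fst (Ici (0 : ℝ) ×ˢ Ici (0 : ℝ)) (Ici 0) := fun p hp => hp.1
  have m2 : MapsTo Prod.snd (Ici (0 : ℝ) ×ˢ Ici (0 : ℝ)) (Ici 0) := fun p hp => hp.2
  refine continuousOn_clm_apply.2 fun u => ?_
  have h1 : ContinuousOn (fun p : ℝ × ℝ => sys.S p.2 (X u)) (Ici 0 ×ˢ Ici 0) :=
    (sys.continuousOn_S (X u)).comp continuousOn_snd m2
  have h2 := ContinuousOn.clm_apply_of_bounded (L := fun p : ℝ × ℝ => sys.N lam p.1)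
    (s := Ici (0 : ℝ) ×ˢ Ici (0 : ℝ)) (fun p hp => sys.norm_N_le hlam hp.1)
    (fun w => (sys.continuousOn_N hlam w).comp continuousOn_fst m1) h1
  have h3 := ContinuousOn.clm_apply_of_bounded (L := fun p : ℝ × ℝ => sys.S p.1)
    (s := Ici (0 : ℝ) ×ˢ Ici (0 : ℝ)) (fun p hp => hM p.1 hp.1)
    (fun w => (sys.continuousOn_S w).comp continuousOn_fst m1) h2
  have h4 : ContinuousOn (fun s => sys.G (sys.S (s + s) ∘L P)) (Ici 0) :=
    sys.G.continuous.comp_continuousOn ((sys.continuousOn_S_comp P).comp (by fun_prop)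
      fun s (hs : 0 ≤ s) => (add_nonneg hs hs : 0 ≤ s + s))
  exact (h4.comp continuousOn_fst m1).clm_apply h3

include hlam in
/-- The derivative of `J` in the first variable. -/
theorem hasDerivAt_J_fst {x y : ℝ} (hx : 0 < x) (hy : 0 ≤ y) :
    HasDerivAt (fun s => sys.J lam s y)
      (-sys.Z lam sys.AB sys.inputOp x y - sys.K lam x x ∘L sys.K lam x y) x := by
  refine hasDerivAt_clm_of_apply fun u => ?_
  have hb := sys.S_inputOp_mem_graph hy u
  set b := sys.S y (sys.inputOp u) with hbd
  have hv := sys.N_mem_graph hlam hx.le hb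
  change (sys.N lam x b, _) ∈ _ at hv
  generalize hw : sys.N (-lam) x _ = w at hv
  have hN := sys.hasDerivAt_N hlam hx hb
  have e1 : sys.applyC (sys.S x (sys.N lam x b)) = sys.K lam x y u :=
    sys.applyC_S_N_S_inputOp hlam hx.le hy u
  change HasDerivAt (fun s => sys.N lam s b) (lam • sys.N lam x (sys.S x (sys.inputOp
      (sys.applyC (sys.S x (sys.N lam x b)))))) x at hN
  rw [e1] at hN
  have h1 := sys.hasDerivAt_S_apply hx hN hv
  have h2 := (sys.hasDerivAt_S_two_comp hx sys.inputOp_mem_graph).clm_map_real sys.G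
  have h3 := h2.clm_apply_real h1
  -- The product rule produces G(S(2x)B) S(x) A N b; the Leibniz rule trades it for φ(2x) K(x,y)
  -- minus a `Z` term, which cancels half of the derivative of S(2x)B.
  have hg := sys.G_add_G (X := sys.S (x + x) ∘L sys.inputOp) (Y := sys.S (x + x) ∘L sys.AB)
    (fun u => sys.S_inputOp_mem_graph (by positivity) u) (sys.S_mem_graph hv hx.le)
  rw [← sys.applyC_S hv hx.le, e1, ← sys.phi_eq (by positivity)] at hg
  refine h3.congr_deriv ?_
  rw [ContinuousLinearMap.map_smul_of_tower, map_sub, map_sub, map_smul, map_smul]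
  have e2 : sys.G (sys.S (x + x) ∘L sys.inputOp) (sys.S x (sys.N lam x (sys.S x (sys.inputOp
      (sys.K lam x y u))))) = sys.J lam x x (sys.K lam x y u) := rfl
  have e3 : (sys.G (sys.S (x + x) ∘L sys.AB)) (sys.S x (sys.N lam x b))
      = sys.Z lam sys.AB sys.inputOp x y u := rfl
  rw [e2]
  rw [e3] at hg
  simp only [sub_apply, neg_apply, smul_apply, ContinuousLinearMap.comp_apply, e3]
  have e4 : sys.K lam x x (sys.K lam x y u)
    = sys.phi (x + x) (sys.K lam x y u) - lam • sys.J lam x x (sys.K lam x y u) := rfl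
  rw [e4, ← hg]
  module

-- The formula for A applied to the inverse for -λ contains the inverse for λ. The Leibniz rule at
-- that vector therefore moves A to the other factor and reverses the sign of λ; this is where K_λ
-- becomes coupled to K_{-λ}.
include hlam in
theorem Z_AB_eq {x y : ℝ} (hx : 0 ≤ x) (hy : 0 ≤ y) :
    sys.Z lam sys.inputOp sys.AB x y
      = sys.K lam x x ∘L sys.K (-lam) x y - sys.Z (-lam) sys.AB sys.inputOp x y := by
  have hlam' : ‖-lam‖ < 1 := by rwa [norm_neg]
  ext u
  have hb := sys.S_inputOp_mem_graph hy u
  set b := sys.S y (sys.inputOp u) with hbd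
  have hv := sys.N_mem_graph hlam' hx hb
  change (sys.N (-lam) x b, _) ∈ _ at hv
  have e1 : sys.applyC (sys.S x (sys.N (-lam) x b)) = sys.K (-lam) x y u :=
    sys.applyC_S_N_S_inputOp hlam' hx hy u
  have e1' := sys.applyC_S_N hlam' hx (sys.mem_domain_of_mem_graph hb)
  change sys.applyC (sys.S x (sys.N (-lam) x b)) = _ at e1'
  rw [← e1', neg_neg] at hv
  change (sys.N (-lam) x b, sys.N lam x ((sys.S y ∘L sys.AB) u - -lam • sys.S x (sys.inputOp
    (sys.applyC (sys.S x (sys.N (-lam) x b)))))) ∈ _ at hv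
  rw [e1] at hv
  have hg := sys.G_add_G (X := sys.S (x + x) ∘L sys.inputOp) (Y := sys.S (x + x) ∘L sys.AB)
    (fun u => sys.S_inputOp_mem_graph (by positivity) u) (sys.S_mem_graph hv hx)
  rw [← sys.applyC_S hv hx, e1, ← sys.phi_eq (by positivity)] at hg
  rw [map_sub, map_sub, map_sub, map_smul, map_smul, map_smul] at hg
  have e2 : sys.G (sys.S (x + x) ∘L sys.inputOp) (sys.S x (sys.N lam x (sys.S x (sys.inputOp
      (sys.K (-lam) x y u))))) = sys.J lam x x (sys.K (-lam) x y u) := rfl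
  have e3 : (sys.G (sys.S (x + x) ∘L sys.AB)) (sys.S x (sys.N (-lam) x b))
      = sys.Z (-lam) sys.AB sys.inputOp x y u := rfl
  have e5 : sys.G (sys.S (x + x) ∘L sys.inputOp) (sys.S x (sys.N lam x ((sys.S y ∘L sys.AB) u)))
      = sys.Z lam sys.inputOp sys.AB x y u := rfl
  rw [e2, e3, e5] at hg
  have e4 : sys.K lam x x (sys.K (-lam) x y u)
    = sys.phi (x + x) (sys.K (-lam) x y u) - lam • sys.J lam x x (sys.K (-lam) x y u) := rfl
  rw [sub_apply, ContinuousLinearMap.comp_apply, e4, ← hg]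
  module

/-- The derivative of `Z` in the second variable. -/
theorem hasDerivAt_Z_snd (P : H₀ →L[ℂ] H) {x y : ℝ} (hy : 0 < y) :
    HasDerivAt (fun s => sys.Z lam P sys.inputOp x s) (-sys.Z lam P sys.AB x y) y := by
  have h1 := (sys.hasDerivAt_S_comp hy sys.inputOp_mem_graph)
  have h2 := (hasDerivAt_const y (sys.G (sys.S (x + x) ∘L P) ∘L sys.S x ∘L sys.N lam x)).clm_comp_real h1
  simp only [ContinuousLinearMap.zero_comp, zero_add, ContinuousLinearMap.comp_neg] at h2
  exact h2

include hlam in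
/-- The derivative of `J` in the second variable. -/
theorem hasDerivAt_J_snd {x y : ℝ} (hx : 0 ≤ x) (hy : 0 < y) :
    HasDerivAt (fun s => sys.J lam x s)
      (sys.Z (-lam) sys.AB sys.inputOp x y - sys.K lam x x ∘L sys.K (-lam) x y) y := by
  have h := sys.hasDerivAt_Z_snd (lam := lam) sys.inputOp (x := x) hy
  rwa [sys.Z_AB_eq hlam hx hy.le, neg_sub] at h

include hlam in
theorem continuousOn_K :
    ContinuousOn (fun p : ℝ × ℝ => sys.K lam p.1 p.2) (Ici 0 ×ˢ Ici 0) := by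
  refine ContinuousOn.sub (sys.continuousOn_phi.comp (by fun_prop)
    fun p hp => (add_nonneg hp.1 hp.2 : 0 ≤ p.1 + p.2)) ?_
  exact (sys.continuousOn_Z hlam sys.inputOp sys.inputOp).const_smul lam

end LinearSystem

/-! ### Integration by parts against test functions in the quadrant. -/

/-- The open first quadrant. -/
abbrev quadrant : Set (ℝ × ℝ) := Ioi 0 ×ˢ Ioi 0

section Weak

variable {E : Type*} [NormedAddCommGroup E] [NormedSpace ℝ E]

/-- Integrability on the compact subsets of the first quadrant. -/
def LocInt (g : ℝ × ℝ → E) : Prop := ∀ K ⊆ quadrant, IsCompact K → IntegrableOn g K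

theorem ContinuousOn.locInt {g : ℝ × ℝ → E} (hg : ContinuousOn g quadrant) : LocInt g :=
  fun K hK hc => (hg.mono hK).integrableOn_compact hc

theorem LocInt.add {f g : ℝ × ℝ → E} (hf : LocInt f) (hg : LocInt g) :
    LocInt (fun p => f p + g p) := fun K hK hc => (hf K hK hc).add (hg K hK hc)

theorem LocInt.neg {f : ℝ × ℝ → E} (hf : LocInt f) : LocInt (fun p => - f p) :=
  fun K hK hc => (hf K hK hc).neg

theorem LocInt.mul_continuousOn {𝒜 : Type*} [NormedRing 𝒜] {g w : ℝ × ℝ → 𝒜} (hg : LocInt g)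
    (hw : ContinuousOn w quadrant) : LocInt (fun p => g p * w p) :=
  fun K hK hc => (hg K hK hc).mul_continuousOn (hw.mono hK) hc

theorem LocInt.continuousOn_mul {𝒜 : Type*} [NormedRing 𝒜] {g w : ℝ × ℝ → 𝒜} (hg : LocInt g)
    (hw : ContinuousOn w quadrant) : LocInt (fun p => w p * g p) :=
  fun K hK hc => (hg K hK hc).continuousOn_mul (hw.mono hK) hc

theorem LocInt.integrable_smul {g : ℝ × ℝ → E} (hg : LocInt g) {χ : ℝ × ℝ → ℝ}
    (hχ : Continuous χ) (hs : HasCompactSupport χ) (hsub : tsupport χ ⊆ quadrant) :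
    Integrable (fun p => χ p • g p) := by
  have h1 := (hg _ hsub hs).continuousOn_smul hχ.continuousOn hs
  refine h1.integrable_of_forall_notMem_eq_zero fun p hp => ?_
  rw [image_eq_zero_of_notMem_tsupport hp, zero_smul]

theorem exists_subset_Icc_prod {K : Set (ℝ × ℝ)} (hK : K ⊆ quadrant) (hc : IsCompact K) :
    ∃ a b : ℝ, 0 < a ∧ a ≤ b ∧ K ⊆ Icc a b ×ˢ Icc a b := by
  rcases K.eq_empty_or_nonempty with rfl | hne
  · exact ⟨1, 1, one_pos, le_rfl, empty_subset _⟩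
  obtain ⟨p, hp, hpm⟩ := hc.exists_isMinOn hne
    (f := fun p : ℝ × ℝ => min p.1 p.2) (by fun_prop)
  obtain ⟨q, hq, hqm⟩ := hc.exists_isMaxOn hne
    (f := fun p : ℝ × ℝ => max p.1 p.2) (by fun_prop)
  refine ⟨min p.1 p.2, max q.1 q.2, lt_min (hK hp).1 (hK hp).2, ?_, fun z hz => ?_⟩
  · exact (hpm hq : min p.1 p.2 ≤ _).trans ((min_le_left _ _).trans (le_max_left _ _))
  · have h1 : min p.1 p.2 ≤ min z.1 z.2 := hpm hz
    have h2 : max z.1 z.2 ≤ max q.1 q.2 := hqm hz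
    exact ⟨⟨h1.trans (min_le_left _ _), (le_max_left _ _).trans h2⟩,
      ⟨h1.trans (min_le_right _ _), (le_max_right _ _).trans h2⟩⟩

theorem IsPrimitive.locInt_fst {p r : ℝ → E} (h : IsPrimitive p r) :
    LocInt (fun z : ℝ × ℝ => r z.1) := by
  intro K hK hc
  obtain ⟨a, b, ha, hab, hsub⟩ := exists_subset_Icc_prod hK hc
  refine IntegrableOn.mono_set ?_ hsub
  have h1 : IntegrableOn r (Icc a b) :=
    (intervalIntegrable_iff_integrableOn_Icc_of_le hab).1 (h ha hab).1
  rw [IntegrableOn, Measure.volume_eq_prod, ← Measure.prod_restrict]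
  exact h1.comp_fst _

/-- The shear (x,y) ↦ (x, x+y) preserves the measure and turns this into a function of one
coordinate. -/
theorem MeasureTheory.MemLp.locInt_add {ψ : ℝ → E} (hψ : MemLp ψ 2 halfLine) :
    LocInt (fun z : ℝ × ℝ => ψ (z.1 + z.2)) := by
  intro K hK hc
  obtain ⟨a, b, ha, hab, hsub⟩ := exists_subset_Icc_prod hK hc
  have h0 : IntegrableOn ψ (Ioc 0 (b + b)) := by
    have h1 : MemLp ψ 2 (volume.restrict (Ioc 0 (b + b))) :=
      hψ.mono_measure (Measure.restrict_mono Ioc_subset_Ioi_self le_rfl)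
    exact h1.integrable one_le_two
  have h1 : IntegrableOn (fun z : ℝ × ℝ => ψ z.2) (Icc a b ×ˢ Ioc 0 (b + b)) := by
    rw [IntegrableOn, Measure.volume_eq_prod, ← Measure.prod_restrict]
    exact h0.comp_snd _
  have hmp : MeasurePreserving (fun z : ℝ × ℝ => (z.1, z.1 + z.2)) :=
    measurePreserving_prod_add volume volume
  have hme : MeasurableEmbedding (fun z : ℝ × ℝ => (z.1, z.1 + z.2)) :=
    (MeasurableEquiv.shearAddRight ℝ).measurableEmbedding
  have h2 := (hmp.integrableOn_comp_preimage hme).2 h1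
  refine IntegrableOn.mono_set h2 fun z hz => ?_
  have := hsub hz
  refine ⟨this.1, ?_, ?_⟩
  · have h1 := this.1.1
    have h2 := this.2.1
    simp only; linarith
  · have h1 := this.1.2
    have h2 := this.2.2
    simp only; linarith

/-- On each horizontal line the product χ f is a primitive of the sum of the two integrands and
vanishes outside a compact interval; Fubini does the rest. -/
theorem integral_partial_fst_smul [CompleteSpace E] {χ χ' : ℝ × ℝ → ℝ}
    (hχ : ∀ x y, HasDerivAt (fun s => χ (s, y)) (χ' (x, y)) x) (hc' : Continuous χ')
    (hs : HasCompactSupport χ) (hsub : tsupport χ ⊆ quadrant) (hsub' : tsupport χ' ⊆ tsupport χ)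
    {f g : ℝ × ℝ → E} (hf : Integrable fun p => χ' p • f p) (hg : Integrable fun p => χ p • g p)
    (hp : ∀ y, 0 < y → IsPrimitive (fun s => f (s, y)) (fun s => g (s, y))) :
    ∫ p, χ' p • f p = -∫ p, χ p • g p := by
  have hfg : Integrable (fun p => χ' p • f p + χ p • g p) ((volume : Measure ℝ).prod volume) :=
    hf.add hg
  rw [eq_neg_iff_add_eq_zero, ← integral_add hf hg, Measure.volume_eq_prod,
    integral_prod_symm _ hfg]
  obtain ⟨a, b, ha, hab, hK⟩ := exists_subset_Icc_prod hsub hs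
  have z1 : ∀ p, p ∉ Icc a b ×ˢ Icc a b → χ p = 0 := fun p hp =>
    image_eq_zero_of_notMem_tsupport fun h => hp (hK h)
  have z2 : ∀ p, p ∉ Icc a b ×ˢ Icc a b → χ' p = 0 := fun p hp =>
    image_eq_zero_of_notMem_tsupport fun h => hp (hK (hsub' h))
  refine integral_eq_zero_of_ae (.of_forall fun y => ?_)
  simp only [Pi.zero_apply]
  by_cases hy : y ∈ Icc a b
  swap
  · refine integral_eq_zero_of_ae (.of_forall fun x => ?_)
    simp only [Pi.zero_apply]
    rw [z1 _ fun h => hy h.2, z2 _ fun h => hy h.2]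
    simp
  have h1 : IsPrimitive (fun s => χ (s, y)) (fun s => χ' (s, y)) :=
    .of_hasDerivAt (fun x _ => hχ x y) (by fun_prop)
  have h2 := h1.bilin (hp y (ha.trans_le hy.1)) (ContinuousLinearMap.lsmul ℝ ℝ)
  -- The interval from a/2 to b + 1 lies in (0,∞) and its ends are outside [a,b], so `χ` vanishes at
  -- both.
  have h3 := (h2 (show 0 < a / 2 by positivity) (by linarith : a / 2 ≤ b + 1)).2
  simp only [ContinuousLinearMap.lsmul_apply] at h3
  rw [intervalIntegral.integral_eq_integral_of_support_subset] at h3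
  · rw [h3, z1 _ fun h => by have := h.1.2; simp only at this; linarith,
      z1 _ fun h => by have := h.1.1; simp only at this; linarith]
    simp
  · intro x hx
    by_contra hx'
    have hx'' : (x, y) ∉ Icc a b ×ˢ Icc a b := fun h => hx' ⟨by linarith [h.1.1], by linarith [h.1.2]⟩
    exact hx (by simp only; rw [z1 _ hx'', z2 _ hx'']; simp)

theorem integral_partial_snd_smul [CompleteSpace E] {χ χ' : ℝ × ℝ → ℝ}
    (hχ : ∀ x y, HasDerivAt (fun s => χ (x, s)) (χ' (x, y)) y) (hc' : Continuous χ')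
    (hs : HasCompactSupport χ) (hsub : tsupport χ ⊆ quadrant) (hsub' : tsupport χ' ⊆ tsupport χ)
    {f g : ℝ × ℝ → E} (hf : Integrable fun p => χ' p • f p) (hg : Integrable fun p => χ p • g p)
    (hp : ∀ x, 0 < x → IsPrimitive (fun s => f (x, s)) (fun s => g (x, s))) :
    ∫ p, χ' p • f p = -∫ p, χ p • g p := by
  have et : ∀ χ : ℝ × ℝ → ℝ, tsupport (χ ∘ Prod.swap) = Prod.swap ⁻¹' tsupport χ := fun χ =>
    tsupport_comp_eq_preimage χ (Homeomorph.prodComm ℝ ℝ)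
  have h := integral_partial_fst_smul (χ := χ ∘ Prod.swap) (χ' := χ' ∘ Prod.swap)
    (f := f ∘ Prod.swap) (g := g ∘ Prod.swap) (fun x y => hχ y x) (by fun_prop)
    (hs.comp_homeomorph (Homeomorph.prodComm ℝ ℝ))
    (by rw [et]; exact fun p hp => ⟨(hsub hp).2, (hsub hp).1⟩)
    (by rw [et, et]; exact fun p hp => hsub' hp) hf.swap hg.swap hp
  have sw : ∀ k : ℝ × ℝ → E, ∫ p, k p = ∫ p : ℝ × ℝ, k p.swap := fun k => (integral_prod_swap k).symm
  rw [sw, sw (fun p => χ p • g p)]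
  exact h

/-- The partial derivative of `χ` in the direction `v`. -/
noncomputable def pd (v : ℝ × ℝ) (χ : ℝ × ℝ → ℝ) (p : ℝ × ℝ) : ℝ := fderiv ℝ χ p v

theorem contDiff_pd {χ : ℝ × ℝ → ℝ} (h : ContDiff ℝ ∞ χ) (v : ℝ × ℝ) : ContDiff ℝ ∞ (pd v χ) :=
  (h.fderiv_right (m := ∞) (by simp)).clm_apply contDiff_const

theorem tsupport_pd (χ : ℝ × ℝ → ℝ) (v : ℝ × ℝ) : tsupport (pd v χ) ⊆ tsupport χ :=
  tsupport_fderiv_apply_subset ℝ v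

theorem hasDerivAt_pd_fst {χ : ℝ × ℝ → ℝ} (h : ContDiff ℝ ∞ χ) (x y : ℝ) :
    HasDerivAt (fun s => χ (s, y)) (pd (1, 0) χ (x, y)) x :=
  ((h.differentiable (by simp)) (x, y)).hasFDerivAt.comp_hasDerivAt x
    ((hasDerivAt_id x).prodMk (hasDerivAt_const x y))

theorem hasDerivAt_pd_snd {χ : ℝ × ℝ → ℝ} (h : ContDiff ℝ ∞ χ) (x y : ℝ) :
    HasDerivAt (fun s => χ (x, s)) (pd (0, 1) χ (x, y)) y :=
  ((h.differentiable (by simp)) (x, y)).hasFDerivAt.comp_hasDerivAt y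
    ((hasDerivAt_const y x).prodMk (hasDerivAt_id y))

theorem pd_comm {χ : ℝ × ℝ → ℝ} (h : ContDiff ℝ ∞ χ) (v w : ℝ × ℝ) : pd v (pd w χ) = pd w (pd v χ) := by
  ext p
  have hd : DifferentiableAt ℝ (fderiv ℝ χ) p :=
    ((h.fderiv_right (m := ∞) (by simp)).differentiable (by simp)) p
  have e : ∀ v w, pd v (pd w χ) p = fderiv ℝ (fderiv ℝ χ) p v w := fun v w => by
    have := (hd.hasFDerivAt.clm_apply (hasFDerivAt_const w p)).fderiv
    change fderiv ℝ (fun q => fderiv ℝ χ q w) p v = _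
    rw [this]
    simp
  rw [e, e]
  exact (h.contDiffAt.isSymmSndFDerivAt (by
    rw [minSmoothness_of_isRCLikeNormedField]
    exact WithTop.coe_le_coe.2 (le_top : (2 : ℕ∞) ≤ ⊤))) v w

theorem iteratedDeriv_two_fst {χ : ℝ × ℝ → ℝ} (h : ContDiff ℝ ∞ χ) (p : ℝ × ℝ) :
    iteratedDeriv 2 (fun s => χ (s, p.2)) p.1 = pd (1, 0) (pd (1, 0) χ) p := by
  rw [iteratedDeriv_succ, iteratedDeriv_one]
  have : deriv (fun s => χ (s, p.2)) = fun s => pd (1, 0) χ (s, p.2) :=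
    funext fun s => (hasDerivAt_pd_fst h s p.2).deriv
  rw [this]
  exact (hasDerivAt_pd_fst (contDiff_pd h _) p.1 p.2).deriv

theorem iteratedDeriv_two_snd {χ : ℝ × ℝ → ℝ} (h : ContDiff ℝ ∞ χ) (p : ℝ × ℝ) :
    iteratedDeriv 2 (fun s => χ (p.1, s)) p.2 = pd (0, 1) (pd (0, 1) χ) p := by
  rw [iteratedDeriv_succ, iteratedDeriv_one]
  have : deriv (fun s => χ (p.1, s)) = fun s => pd (0, 1) χ (p.1, s) :=
    funext fun s => (hasDerivAt_pd_snd h p.1 s).deriv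
  rw [this]
  exact (hasDerivAt_pd_snd (contDiff_pd h _) p.1 p.2).deriv

/-- Two functions `M`, `N` whose first order partial derivatives satisfy the system
`M_x - N_y = p M`, `N_x - M_y = -p N` satisfy `M_xx - M_yy = (p' + p²) M` in the sense of
distributions. -/
theorem integral_wave_smul {𝒜 : Type*} [NormedRing 𝒜] [NormedAlgebra ℝ 𝒜] [CompleteSpace 𝒜]
    {M N Mx My Nx Ny : ℝ × ℝ → 𝒜} {p r : ℝ → 𝒜}
    (hM : ContinuousOn M quadrant) (hN : ContinuousOn N quadrant) (hp : IsPrimitive p r)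
    (lMx : LocInt Mx) (lMy : LocInt My) (lNx : LocInt Nx) (lNy : LocInt Ny)
    (hMx : ∀ y, 0 < y → IsPrimitive (fun s => M (s, y)) (fun s => Mx (s, y)))
    (hMy : ∀ x, 0 < x → IsPrimitive (fun s => M (x, s)) (fun s => My (x, s)))
    (hNx : ∀ y, 0 < y → IsPrimitive (fun s => N (s, y)) (fun s => Nx (s, y)))
    (hNy : ∀ x, 0 < x → IsPrimitive (fun s => N (x, s)) (fun s => Ny (x, s)))
    (e1 : ∀ z ∈ quadrant, Mx z - Ny z = p z.1 * M z)
    (e2 : ∀ z ∈ quadrant, Nx z - My z = -(p z.1 * N z))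
    {χ : ℝ × ℝ → ℝ} (hχ : ContDiff ℝ ∞ χ) (hs : HasCompactSupport χ)
    (hsub : tsupport χ ⊆ quadrant) :
    ∫ z, (pd (1, 0) (pd (1, 0) χ) z - pd (0, 1) (pd (0, 1) χ) z) • M z
      = ∫ z, χ z • ((r z.1 + p z.1 * p z.1) * M z) := by
  have cpt : ∀ {χ} (_ : HasCompactSupport χ) v, HasCompactSupport (pd v χ) := fun h v =>
    h.mono' (subset_closure.trans (tsupport_pd _ v))
  have int : ∀ {g : ℝ × ℝ → 𝒜} (_ : LocInt g) {η} (_ : ContDiff ℝ ∞ η) (_ : HasCompactSupport η)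
      (_ : tsupport η ⊆ quadrant), Integrable fun z => η z • g z := fun hg η h1 h2 h3 =>
    hg.integrable_smul h1.continuous h2 h3
  have fst : ∀ {η} (_ : ContDiff ℝ ∞ η) (_ : HasCompactSupport η) (_ : tsupport η ⊆ quadrant)
      {f g : ℝ × ℝ → 𝒜} (_ : LocInt f) (_ : LocInt g)
      (_ : ∀ y, 0 < y → IsPrimitive (fun s => f (s, y)) (fun s => g (s, y))),
      ∫ z, pd (1, 0) η z • f z = -∫ z, η z • g z := fun h1 h2 h3 f g h4 h5 h6 =>
    integral_partial_fst_smul (hasDerivAt_pd_fst h1) (contDiff_pd h1 _).continuous h2 h3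
      (tsupport_pd _ _) (int h4 (contDiff_pd h1 _) (cpt h2 _) ((tsupport_pd _ _).trans h3))
      (int h5 h1 h2 h3) h6
  have snd : ∀ {η} (_ : ContDiff ℝ ∞ η) (_ : HasCompactSupport η) (_ : tsupport η ⊆ quadrant)
      {f g : ℝ × ℝ → 𝒜} (_ : LocInt f) (_ : LocInt g)
      (_ : ∀ x, 0 < x → IsPrimitive (fun s => f (x, s)) (fun s => g (x, s))),
      ∫ z, pd (0, 1) η z • f z = -∫ z, η z • g z := fun h1 h2 h3 f g h4 h5 h6 =>
    integral_partial_snd_smul (hasDerivAt_pd_snd h1) (contDiff_pd h1 _).continuous h2 h3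
      (tsupport_pd _ _) (int h4 (contDiff_pd h1 _) (cpt h2 _) ((tsupport_pd _ _).trans h3))
      (int h5 h1 h2 h3) h6
  set χx := pd (1, 0) χ with hχx
  set χy := pd (0, 1) χ with hχy
  have dx : ContDiff ℝ ∞ χx := contDiff_pd hχ _
  have dy : ContDiff ℝ ∞ χy := contDiff_pd hχ _
  have sx : HasCompactSupport χx := cpt hs _
  have sy : HasCompactSupport χy := cpt hs _
  have tx : tsupport χx ⊆ quadrant := (tsupport_pd _ _).trans hsub
  have ty : tsupport χy ⊆ quadrant := (tsupport_pd _ _).trans hsub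
  have cp : ContinuousOn (fun z : ℝ × ℝ => p z.1) quadrant :=
    hp.continuousOn.comp continuousOn_fst fun z hz => hz.1
  have lr := hp.locInt_fst
  have zero : ∀ {η : ℝ × ℝ → ℝ} (_ : tsupport η ⊆ quadrant) (z : ℝ × ℝ), z ∉ quadrant → η z = 0 :=
    fun h z hz => image_eq_zero_of_notMem_tsupport fun h' => hz (h h')
  have a1 := fst dx sx tx hM.locInt lMx hMx
  have a2 := snd dy sy ty hM.locInt lMy hMy
  have a3 := snd dx sx tx hN.locInt lNy hNy
  have a4 := fst dy sy ty hN.locInt lNx hNx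
  have a5 := fst hχ hs hsub (f := fun z => p z.1 * M z)
    (g := fun z => r z.1 * M z + p z.1 * Mx z) (cp.mul hM).locInt
    ((lr.mul_continuousOn hM).add (lMx.continuousOn_mul cp))
    (fun y hy => hp.bilin (hMx y hy) (ContinuousLinearMap.mul ℝ 𝒜))
  have a6 := snd hχ hs hsub (f := fun z => p z.1 * N z) (g := fun z => p z.1 * Ny z)
    (cp.mul hN).locInt (lNy.continuousOn_mul cp)
    (fun x hx => (hNy x hx).clm (ContinuousLinearMap.mul ℝ 𝒜 (p x)))
  -- Symmetry of the second derivatives of χ gives ∫ χ_x N_y = ∫ χ_y N_x; this eliminates N without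
  -- a second derivative of it.
  have comm : pd (0, 1) χx = pd (1, 0) χy := pd_comm hχ _ _
  rw [comm, a4] at a3
  have b1 : ∫ z, χx z • Mx z = (∫ z, χx z • (p z.1 * M z)) + ∫ z, χx z • Ny z := by
    have j1 : Integrable fun z => χx z • (p z.1 * M z) := int (cp.mul hM).locInt dx sx tx
    rw [← integral_add j1 (int lNy dx sx tx)]
    refine integral_congr_ae (.of_forall fun z => ?_)
    by_cases hz : z ∈ quadrant
    · simp only; rw [← e1 z hz, ← smul_add, sub_add_cancel]
    · simp only [zero tx z hz, zero_smul, add_zero]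
  have b2 : ∫ z, χy z • My z = (∫ z, χy z • (p z.1 * N z)) + ∫ z, χy z • Nx z := by
    have j1 : Integrable fun z => χy z • (p z.1 * N z) := int (cp.mul hN).locInt dy sy ty
    rw [← integral_add j1 (int lNx dy sy ty)]
    refine integral_congr_ae (.of_forall fun z => ?_)
    by_cases hz : z ∈ quadrant
    · simp only; rw [← neg_neg (p z.1 * N z), ← e2 z hz, ← smul_add]; congr 1; abel
    · simp only [zero ty z hz, zero_smul, add_zero]
  have i1 := int hM.locInt (contDiff_pd dx (1, 0)) (cpt sx _) ((tsupport_pd _ _).trans tx)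
  have i2 := int hM.locInt (contDiff_pd dy (0, 1)) (cpt sy _) ((tsupport_pd _ _).trans ty)
  have i3 := int ((lr.mul_continuousOn hM).add (lMx.continuousOn_mul cp)) hχ hs hsub
  have i4 := int (lNy.continuousOn_mul cp) hχ hs hsub
  have b3 : ∫ z, χ z • ((r z.1 + p z.1 * p z.1) * M z)
      = (∫ z, χ z • (r z.1 * M z + p z.1 * Mx z)) - ∫ z, χ z • (p z.1 * Ny z) := by
    rw [← integral_sub i3 i4]
    refine integral_congr_ae (.of_forall fun z => ?_)
    by_cases hz : z ∈ quadrant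
    · simp only
      rw [add_mul, mul_assoc, ← e1 z hz, ← smul_sub, mul_sub]
      congr 1; abel
    · simp only [zero hsub z hz, zero_smul, sub_zero]
  rw [← hχx] at a5
  rw [← hχy] at a6
  simp only [sub_smul]
  rw [integral_sub i1 i2, a1, a2, b3, b1, b2, a5, a6, neg_inj.1 a3]
  module

end Weak

theorem IsPrimitive.const_smul_complex {E : Type*} [NormedAddCommGroup E] [NormedSpace ℂ E]
    [CompleteSpace E] {f g : ℝ → E} (h : IsPrimitive f g) (c : ℂ) :
    IsPrimitive (fun x => c • f x) (fun x => c • g x) :=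
  h.clm ((c • ContinuousLinearMap.id ℂ E).restrictScalars ℝ)

theorem IsPrimitive.comp_add_const {E : Type*} [NormedAddCommGroup E] [NormedSpace ℝ E]
    {f g : ℝ → E} (h : IsPrimitive f g) {c : ℝ} (hc : 0 ≤ c) :
    IsPrimitive (fun x => f (x + c)) (fun x => g (x + c)) := by
  intro a b ha hab
  obtain ⟨h1, h2⟩ := h (add_pos_of_pos_of_nonneg ha hc) (add_le_add_left hab c)
  refine ⟨?_, ?_⟩
  · have := h1.comp_add_right c
    simpa using this
  · rw [intervalIntegral.integral_comp_add_right, h2]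

theorem IsPrimitive.comp_add_self {E : Type*} [NormedAddCommGroup E] [NormedSpace ℝ E]
    {f g : ℝ → E} (h : IsPrimitive f g) :
    IsPrimitive (fun x => f (x + x)) (fun x => (2 : ℝ) • g (x + x)) := by
  intro a b ha hab
  obtain ⟨h1, h2⟩ := h (mul_pos two_pos ha) (mul_le_mul_of_nonneg_left hab zero_le_two)
  simp only [← two_mul]
  refine ⟨?_, ?_⟩
  · have h3 : IntervalIntegrable (fun x => g (2 * x)) volume a b := by
      simpa using h1.comp_mul_left (c := 2)
    exact h3.smul (2 : ℝ)
  · rw [intervalIntegral.integral_smul, intervalIntegral.integral_comp_mul_left _ two_ne_zero, h2,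
      smul_smul]
    norm_num

theorem isOpen_quadrant : IsOpen quadrant := isOpen_Ioi.prod isOpen_Ioi

/-- A function with continuous partial derivatives is differentiable. -/
theorem hasStrictFDerivAt_of_partial {E : Type*} [NormedAddCommGroup E] [NormedSpace ℝ E]
    {Ω : Set (ℝ × ℝ)} (hΩ : IsOpen Ω) {f : ℝ × ℝ → E} {fx fy : ℝ × ℝ → E}
    (hx : ∀ p ∈ Ω, HasDerivAt (fun s => f (s, p.2)) (fx p) p.1)
    (hy : ∀ p ∈ Ω, HasDerivAt (fun s => f (p.1, s)) (fy p) p.2)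
    (cx : ContinuousOn fx Ω) (cy : ContinuousOn fy Ω) {p : ℝ × ℝ} (hp : p ∈ Ω) :
    HasStrictFDerivAt f ((ContinuousLinearMap.toSpanSingleton ℝ (fx p)).coprod
      (ContinuousLinearMap.toSpanSingleton ℝ (fy p))) p := by
  have hn := hΩ.mem_nhds hp
  have h := hasStrictFDerivAt_uncurry_coprod (𝕜 := ℝ) (u := p) (f := fun x y => f (x, y))
    (f₁ := fun x y => ContinuousLinearMap.toSpanSingleton ℝ (fx (x, y)))
    (f₂ := fun x y => ContinuousLinearMap.toSpanSingleton ℝ (fy (x, y)))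
    (by filter_upwards [hn] with v hv using (hx v hv).hasFDerivAt)
    (by filter_upwards [hn] with v hv using (hy v hv).hasFDerivAt)
    ((ContinuousLinearMap.toSpanSingletonCLE (𝕜 := ℝ) (E := E)).continuous.continuousAt.comp
      (cx.continuousAt hn))
    ((ContinuousLinearMap.toSpanSingletonCLE (𝕜 := ℝ) (E := E)).continuous.continuousAt.comp
      (cy.continuousAt hn))
  exact h

theorem hasDerivAt_diag_of_partial {E : Type*} [NormedAddCommGroup E] [NormedSpace ℝ E]
    {f : ℝ × ℝ → E} {fx fy : ℝ × ℝ → E}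
    (hx : ∀ p ∈ quadrant, HasDerivAt (fun s => f (s, p.2)) (fx p) p.1)
    (hy : ∀ p ∈ quadrant, HasDerivAt (fun s => f (p.1, s)) (fy p) p.2)
    (cx : ContinuousOn fx quadrant) (cy : ContinuousOn fy quadrant) {x : ℝ} (h : 0 < x) :
    HasDerivAt (fun s => f (s, s)) (fx (x, x) + fy (x, x)) x := by
  have h1 := HasFDerivAt.comp_hasDerivAt (f := fun s : ℝ => (s, s)) x
    (hasStrictFDerivAt_of_partial isOpen_quadrant hx hy cx cy
      (show (x, x) ∈ quadrant from ⟨h, h⟩)).hasFDerivAt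
    ((hasDerivAt_id' x).prodMk (hasDerivAt_id' x))
  exact h1.congr_deriv (by simp)

/-! ### The first-order system, the Miura identity, and the weak differential equation. -/

namespace LinearSystem

variable {H H₀ : Type*}
  [NormedAddCommGroup H] [InnerProductSpace ℂ H] [CompleteSpace H]
  [NormedAddCommGroup H₀] [InnerProductSpace ℂ H₀] [CompleteSpace H₀] [FiniteDimensional ℂ H₀]
  (sys : LinearSystem H H₀) [hcon : sys.IsContractive]

/-- The function `C S(s) A B`, the negative of the derivative of `φ`. -/
noncomputable def psi : ℝ → H₀ →L[ℂ] H₀ := sys.obsOp sys.AB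

theorem memLp_psi : MemLp sys.psi 2 halfLine := Lp.memLp _

/-- Integration over a bounded interval is the pairing with an indicator function of L², so it
commutes with limits in L². -/
theorem exists_integral_clm {a b : ℝ} (ha : 0 < a) (hab : a ≤ b) :
    ∃ I : Lp (H₀ →L[ℂ] H₀) 2 halfLine →L[ℂ] (H₀ →L[ℂ] H₀), ∀ f, I f = ∫ t in a..b, f t := by
  have hm : halfLine (Ioc a b) ≠ ⊤ :=
    ((Measure.restrict_apply_le _ _).trans_lt measure_Ioc_lt_top).ne
  refine ⟨ContinuousLinearMap.lpPairing halfLine 2 2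
    (ContinuousLinearMap.lsmul ℂ ℂ (E := H₀ →L[ℂ] H₀))
    (indicatorConstLp 2 measurableSet_Ioc hm 1), fun f => ?_⟩
  rw [ContinuousLinearMap.lpPairing_eq_integral, intervalIntegral.integral_of_le hab]
  have e : volume.restrict (Ioc a b) = halfLine.restrict (Ioc a b) := by
    rw [halfLine, Measure.restrict_restrict measurableSet_Ioc,
      inter_eq_left.2 (Ioc_subset_Ioi_self.trans (Ioi_subset_Ioi ha.le))]
  rw [e, ← integral_indicator measurableSet_Ioc]
  refine integral_congr_ae ?_
  filter_upwards [indicatorConstLp_coeFn (p := 2) (hs := measurableSet_Ioc) (hμs := hm)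
    (c := (1 : ℂ))] with t ht
  rw [ht]
  by_cases h : t ∈ Ioc a b <;> simp [h]

/-- The quotients (B - S(h)B)/h tend to AB, and `obsOp` maps them to (φ(t) - φ(t+h))/h, which hence
converges in L² to ψ. Their integrals over (a,b) telescope to averages of φ next to a and b. -/
theorem isPrimitive_phi : IsPrimitive sys.phi (fun s => -sys.psi s) := by
  intro a b ha hab
  have hsub : Ioc a b ⊆ Ioi 0 := Ioc_subset_Ioi_self.trans (Ioi_subset_Ioi ha.le)
  have hi : IntervalIntegrable sys.psi volume a b := by
    rw [intervalIntegrable_iff_integrableOn_Ioc_of_le hab]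
    exact (sys.memLp_psi.mono_measure (Measure.restrict_mono hsub le_rfl)).integrable one_le_two
  refine ⟨hi.neg, ?_⟩
  obtain ⟨I, hI⟩ := exists_integral_clm (H₀ := H₀) ha hab
  have h1 : Tendsto (fun h : ℝ => I (sys.obsOp (((h⁻¹ : ℝ) : ℂ) •
      (sys.inputOp - sys.S h ∘L sys.inputOp)))) (𝓝[>] 0) (𝓝 (I (sys.obsOp sys.AB))) :=
    ((I ∘L sys.obsOp).continuous.tendsto _).comp
      (sys.tendsto_generator_comp sys.inputOp_mem_graph)
  have ii : ∀ c d : ℝ, 0 ≤ c → 0 ≤ d → IntervalIntegrable sys.phi volume c d := fun c d hc hd =>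
    (sys.continuousOn_phi.mono fun t ht => (le_min hc hd).trans ht.1).intervalIntegrable
  have h2 : ∀ᶠ h : ℝ in 𝓝[>] 0, I (sys.obsOp (((h⁻¹ : ℝ) : ℂ) •
      (sys.inputOp - sys.S h ∘L sys.inputOp)))
      = h⁻¹ • (∫ t in a..(a + h), sys.phi t) - h⁻¹ • ∫ t in b..(b + h), sys.phi t := by
    filter_upwards [self_mem_nhdsWithin] with h hh
    have hh : 0 < h := hh
    rw [map_smul, map_smul, Complex.coe_smul, map_sub, map_sub, hI, hI, ← smul_sub]
    congr 1
    have e1 : ∫ t in a..b, sys.obsOp sys.inputOp t = ∫ t in a..b, sys.phi t := by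
      refine intervalIntegral.integral_congr_ae_restrict ?_
      rw [uIoc_of_le hab]
      have := sys.obsOp_S_inputOp_ae le_rfl
      rw [sys.S_zero, ContinuousLinearMap.one_def, ContinuousLinearMap.id_comp] at this
      filter_upwards [ae_restrict_of_ae_restrict_of_subset hsub this] with t ht
      rw [ht, add_zero]
    have e2 : ∫ t in a..b, sys.obsOp (sys.S h ∘L sys.inputOp) t
        = ∫ t in (a + h)..(b + h), sys.phi t := by
      rw [← intervalIntegral.integral_comp_add_right]
      refine intervalIntegral.integral_congr_ae_restrict ?_
      rw [uIoc_of_le hab]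
      exact ae_restrict_of_ae_restrict_of_subset hsub (sys.obsOp_S_inputOp_ae hh.le)
    have hb : 0 ≤ b := ha.le.trans hab
    rw [e1, e2]
    exact intervalIntegral.integral_interval_sub_interval_comm (ii _ _ ha.le hb)
      (ii _ _ (by positivity) (by positivity)) (ii _ _ ha.le (by positivity))
  have h3 := (tendsto_inv_smul_integral sys.continuousOn_phi ha.le).sub
    (tendsto_inv_smul_integral sys.continuousOn_phi (ha.le.trans hab))
  have h4 := tendsto_nhds_unique (h1.congr' h2) h3
  rw [hI] at h4
  rw [intervalIntegral.integral_neg]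
  change -(∫ t in a..b, sys.obsOp sys.AB t) = _
  rw [h4, neg_sub]

/-- The derivative of `K` in the first variable. -/
noncomputable def Kx (lam : ℂ) (x y : ℝ) : H₀ →L[ℂ] H₀ :=
  -sys.psi (x + y) + lam • (sys.Z lam sys.AB sys.inputOp x y + sys.K lam x x * sys.K lam x y)

/-- The derivative of `K` in the second variable. -/
noncomputable def Ky (lam : ℂ) (x y : ℝ) : H₀ →L[ℂ] H₀ :=
  -sys.psi (x + y)
    + lam • (sys.K lam x x * sys.K (-lam) x y - sys.Z (-lam) sys.AB sys.inputOp x y)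

variable {lam : ℂ} (hlam : ‖lam‖ < 1)

/-- The ψ and `Z` terms cancel between λ and -λ. With the next identity this is a first-order system
for K_λ and K_{-λ} with coefficient p = λ(K_λ(x,x) + K_{-λ}(x,x)). -/
theorem Kx_sub_Ky (x y : ℝ) : sys.Kx lam x y - sys.Ky (-lam) x y
    = (lam • (sys.K lam x x + sys.K (-lam) x x)) * sys.K lam x y := by
  rw [Kx, Ky, neg_neg, smul_mul_assoc, add_mul]
  module

theorem Kx_neg_sub_Ky (x y : ℝ) : sys.Kx (-lam) x y - sys.Ky lam x y
    = -((lam • (sys.K lam x x + sys.K (-lam) x x)) * sys.K (-lam) x y) := by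
  rw [Kx, Ky, smul_mul_assoc, add_mul]
  module

/-- The derivative of `K(x, x)`. -/
noncomputable def Kdiag (lam : ℂ) (x : ℝ) : H₀ →L[ℂ] H₀ := sys.Kx lam x x + sys.Ky lam x x

/-- The Miura identity p' + p² = 2λ (d/dx) K_λ(x,x), whose right side is q. It comes from
subtracting the two equations of the first-order system on the diagonal. -/
theorem smul_Kdiag_add (x : ℝ) :
    lam • (sys.Kdiag lam x + sys.Kdiag (-lam) x)
      + (lam • (sys.K lam x x + sys.K (-lam) x x)) * (lam • (sys.K lam x x + sys.K (-lam) x x))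
    = (2 * lam) • sys.Kdiag lam x := by
  simp only [Kdiag, Kx, Ky, neg_neg, smul_mul_assoc, mul_smul_comm, add_mul, mul_add]
  module

include hlam in
theorem continuousOn_K_quadrant :
    ContinuousOn (fun p : ℝ × ℝ => sys.K lam p.1 p.2) quadrant :=
  (sys.continuousOn_K hlam).mono (prod_mono Ioi_subset_Ici_self Ioi_subset_Ici_self)

include hlam in
theorem continuousOn_Z_quadrant (P X : H₀ →L[ℂ] H) :
    ContinuousOn (fun p : ℝ × ℝ => sys.Z lam P X p.1 p.2) quadrant :=
  (sys.continuousOn_Z hlam P X).mono (prod_mono Ioi_subset_Ici_self Ioi_subset_Ici_self)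

include hlam in
theorem continuousOn_K_diag : ContinuousOn (fun p : ℝ × ℝ => sys.K lam p.1 p.1) quadrant :=
  (sys.continuousOn_K_quadrant hlam).comp (f := fun p : ℝ × ℝ => (p.1, p.1)) (by fun_prop)
    fun p hp => ⟨hp.1, hp.1⟩

/-- The derivative of `J` in the first variable. -/
noncomputable def Jx (lam : ℂ) (p : ℝ × ℝ) : H₀ →L[ℂ] H₀ :=
  -sys.Z lam sys.AB sys.inputOp p.1 p.2 - sys.K lam p.1 p.1 * sys.K lam p.1 p.2

/-- The derivative of `J` in the second variable. -/
noncomputable def Jy (lam : ℂ) (p : ℝ × ℝ) : H₀ →L[ℂ] H₀ :=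
  sys.Z (-lam) sys.AB sys.inputOp p.1 p.2 - sys.K lam p.1 p.1 * sys.K (-lam) p.1 p.2

theorem Kx_eq (x y : ℝ) : sys.Kx lam x y = -sys.psi (x + y) - lam • sys.Jx lam (x, y) := by
  rw [Kx, Jx]; module

theorem Ky_eq (x y : ℝ) : sys.Ky lam x y = -sys.psi (x + y) - lam • sys.Jy lam (x, y) := by
  rw [Ky, Jy]; module

include hlam in
theorem hasDerivAt_Jx (p : ℝ × ℝ) (hp : p ∈ quadrant) :
    HasDerivAt (fun s => sys.J lam s p.2) (sys.Jx lam p) p.1 :=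
  sys.hasDerivAt_J_fst hlam hp.1 (le_of_lt hp.2)

include hlam in
theorem hasDerivAt_Jy (p : ℝ × ℝ) (hp : p ∈ quadrant) :
    HasDerivAt (fun s => sys.J lam p.1 s) (sys.Jy lam p) p.2 :=
  sys.hasDerivAt_J_snd hlam (le_of_lt hp.1) hp.2

include hlam in
theorem continuousOn_Jx : ContinuousOn (sys.Jx lam) quadrant :=
  (sys.continuousOn_Z_quadrant hlam _ _).neg.sub
    ((sys.continuousOn_K_diag hlam).mul (sys.continuousOn_K_quadrant hlam))

include hlam in
theorem continuousOn_Jy : ContinuousOn (sys.Jy lam) quadrant := by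
  have hlam' : ‖-lam‖ < 1 := by rwa [norm_neg]
  exact (sys.continuousOn_Z_quadrant hlam' _ _).sub
    ((sys.continuousOn_K_diag hlam).mul (sys.continuousOn_K_quadrant hlam'))

include hlam in
theorem isPrimitive_K_fst {y : ℝ} (hy : 0 < y) :
    IsPrimitive (fun s => sys.K lam s y) (fun s => sys.Kx lam s y) := by
  have h1 := sys.isPrimitive_phi.comp_add_const hy.le
  have h2 : IsPrimitive (fun s => sys.J lam s y) (fun s => sys.Jx lam (s, y)) :=
    .of_hasDerivAt (fun x hx => sys.hasDerivAt_Jx hlam (x, y) ⟨hx, hy⟩)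
      ((sys.continuousOn_Jx hlam).comp (by fun_prop) fun s hs => ⟨hs, hy⟩)
  refine (h1.add (h2.const_smul_complex (-lam))).congr (fun x hx => ?_) (.of_forall fun x => ?_)
  · rw [K]; module
  · rw [Kx_eq]; module

include hlam in
theorem isPrimitive_K_snd {x : ℝ} (hx : 0 < x) :
    IsPrimitive (fun s => sys.K lam x s) (fun s => sys.Ky lam x s) := by
  have h1 := sys.isPrimitive_phi.comp_add_const hx.le
  have h2 : IsPrimitive (fun s => sys.J lam x s) (fun s => sys.Jy lam (x, s)) :=
    .of_hasDerivAt (fun y hy => sys.hasDerivAt_Jy hlam (x, y) ⟨hx, hy⟩)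
      ((sys.continuousOn_Jy hlam).comp (by fun_prop) fun s hs => ⟨hx, hs⟩)
  refine (h1.add (h2.const_smul_complex (-lam))).congr (fun y hy => ?_) (.of_forall fun y => ?_)
  · rw [K, add_comm x]; module
  · rw [Ky_eq, add_comm x]; module

include hlam in
theorem hasDerivAt_J_diag {x : ℝ} (hx : 0 < x) :
    HasDerivAt (fun s => sys.J lam s s) (sys.Jx lam (x, x) + sys.Jy lam (x, x)) x :=
  hasDerivAt_diag_of_partial (f := fun p => sys.J lam p.1 p.2) (sys.hasDerivAt_Jx hlam)
    (sys.hasDerivAt_Jy hlam) (sys.continuousOn_Jx hlam) (sys.continuousOn_Jy hlam) hx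

include hlam in
theorem continuousOn_deriv_J_diag :
    ContinuousOn (fun x => sys.Jx lam (x, x) + sys.Jy lam (x, x)) (Ioi 0) :=
  ((sys.continuousOn_Jx hlam).comp (f := fun s : ℝ => (s, s)) (by fun_prop)
    fun s hs => ⟨hs, hs⟩).add
  ((sys.continuousOn_Jy hlam).comp (f := fun s : ℝ => (s, s)) (by fun_prop)
    fun s hs => ⟨hs, hs⟩)

include hlam in
theorem isPrimitive_K_diag : IsPrimitive (fun s => sys.K lam s s) (sys.Kdiag lam) := by
  have h2 : IsPrimitive (fun s => sys.J lam s s) (fun x => sys.Jx lam (x, x) + sys.Jy lam (x, x)) :=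
    .of_hasDerivAt (fun x hx => sys.hasDerivAt_J_diag hlam hx) (sys.continuousOn_deriv_J_diag hlam)
  refine (sys.isPrimitive_phi.comp_add_self.add (h2.const_smul_complex (-lam))).congr
    (fun y hy => ?_) (.of_forall fun y => ?_)
  · rw [K]; module
  · rw [Kdiag, Kx_eq, Ky_eq]; module

theorem locInt_psi : LocInt fun p : ℝ × ℝ => sys.psi (p.1 + p.2) := sys.memLp_psi.locInt_add

include hlam in
theorem locInt_Kx : LocInt fun p : ℝ × ℝ => sys.Kx lam p.1 p.2 :=
  sys.locInt_psi.neg.add (((sys.continuousOn_Z_quadrant hlam _ _).add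
    ((sys.continuousOn_K_diag hlam).mul (sys.continuousOn_K_quadrant hlam))).const_smul lam).locInt

include hlam in
theorem locInt_Ky : LocInt fun p : ℝ × ℝ => sys.Ky lam p.1 p.2 := by
  have hlam' : ‖-lam‖ < 1 := by rwa [norm_neg]
  exact sys.locInt_psi.neg.add ((((sys.continuousOn_K_diag hlam).mul
    (sys.continuousOn_K_quadrant hlam')).sub
      (sys.continuousOn_Z_quadrant hlam' _ _)).const_smul lam).locInt

include hlam in
theorem T_diag_ae_hasDerivAt : ∀ᵐ x ∂(volume.restrict (Ioi (0 : ℝ))),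
    HasDerivAt (fun s => sys.T lam s s) (-lam • sys.Kdiag lam x) x := by
  filter_upwards [((sys.isPrimitive_K_diag hlam).const_smul_complex (-lam)).ae_hasDerivAt,
    ae_restrict_mem measurableSet_Ioi] with x hx hx0
  refine hx.congr_of_eventuallyEq ?_
  filter_upwards [Ioi_mem_nhds hx0] with s hs
  exact sys.T_eq hlam (le_of_lt hs) (le_of_lt hs)

include hlam in
theorem q_ae : ∀ᵐ x ∂(volume.restrict (Ioi (0 : ℝ))), sys.q lam x
    = lam • (sys.Kdiag lam x + sys.Kdiag (-lam) x)
      + (lam • (sys.K lam x x + sys.K (-lam) x x)) * (lam • (sys.K lam x x + sys.K (-lam) x x)) := by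
  filter_upwards [sys.T_diag_ae_hasDerivAt hlam] with x hx
  rw [q, hx.deriv, smul_Kdiag_add]
  module

include hlam in
theorem isPrimitive_T_diag : IsPrimitive (fun s => (-2 : ℂ) • sys.T lam s s) (sys.q lam) := by
  refine ((sys.isPrimitive_K_diag hlam).const_smul_complex (2 * lam)).congr (fun x hx => ?_) ?_
  · rw [sys.T_eq hlam hx.le hx.le]; module
  · filter_upwards [sys.q_ae hlam] with x hx
    rw [hx, smul_Kdiag_add]

include hlam in
theorem continuousOn_T :
    ContinuousOn (fun p : ℝ × ℝ => sys.T lam p.1 p.2) (Ici 0 ×ˢ Ici 0) :=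
  ((sys.continuousOn_K hlam).const_smul (-lam)).congr fun p hp => sys.T_eq hlam hp.1 hp.2

include hlam in
/-- The partial differential equation for `T` in the sense of distributions. -/
theorem integral_wave_smul_T {χ : ℝ × ℝ → ℝ} (hχ : ContDiff ℝ ∞ χ) (hs : HasCompactSupport χ)
    (hsub : tsupport χ ⊆ quadrant) :
    ∫ z : ℝ × ℝ, (iteratedDeriv 2 (fun s => χ (s, z.2)) z.1
        - iteratedDeriv 2 (fun s => χ (z.1, s)) z.2) • sys.T lam z.1 z.2
      = ∫ z : ℝ × ℝ, χ z • (sys.q lam z.1 ∘L sys.T lam z.1 z.2) := by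
  have hlam' : ‖-lam‖ < 1 := by rwa [norm_neg]
  have main := integral_wave_smul (M := fun z => sys.K lam z.1 z.2)
    (N := fun z => sys.K (-lam) z.1 z.2) (p := fun x => lam • (sys.K lam x x + sys.K (-lam) x x))
    (r := fun x => lam • (sys.Kdiag lam x + sys.Kdiag (-lam) x))
    (sys.continuousOn_K_quadrant hlam) (sys.continuousOn_K_quadrant hlam')
    (((sys.isPrimitive_K_diag hlam).add (sys.isPrimitive_K_diag hlam')).const_smul_complex lam)
    (sys.locInt_Kx hlam) (sys.locInt_Ky hlam) (sys.locInt_Kx hlam') (sys.locInt_Ky hlam')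
    (fun y hy => sys.isPrimitive_K_fst hlam hy) (fun x hx => sys.isPrimitive_K_snd hlam hx)
    (fun y hy => sys.isPrimitive_K_fst hlam' hy) (fun x hx => sys.isPrimitive_K_snd hlam' hx)
    (fun z _ => sys.Kx_sub_Ky z.1 z.2) (fun z _ => sys.Kx_neg_sub_Ky z.1 z.2) hχ hs hsub
  have z1 : ∀ z ∉ quadrant, χ z = 0 := fun z hz =>
    image_eq_zero_of_notMem_tsupport fun h => hz (hsub h)
  have z2 : ∀ z ∉ quadrant, ∀ v, pd v (pd v χ) z = 0 := fun z hz v =>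
    image_eq_zero_of_notMem_tsupport fun h =>
      hz (hsub (tsupport_pd _ _ (tsupport_pd _ _ h)))
  have eT : ∀ z ∈ quadrant, sys.T lam z.1 z.2 = -lam • sys.K lam z.1 z.2 := fun z hz =>
    sys.T_eq hlam (le_of_lt hz.1) (le_of_lt hz.2)
  have main' := congrArg (fun w => -lam • w) main
  simp only [← integral_smul] at main'
  refine Eq.trans ?_ (main'.trans ?_)
  · refine integral_congr_ae (.of_forall fun z => ?_)
    simp only
    rw [iteratedDeriv_two_fst hχ, iteratedDeriv_two_snd hχ]
    by_cases hz : z ∈ quadrant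
    · rw [eT z hz, smul_comm]
    · rw [z2 z hz, z2 z hz, sub_zero, zero_smul, zero_smul, smul_zero]
  · have hq : ∀ᵐ z : ℝ × ℝ, z.1 ∈ Ioi (0 : ℝ) → sys.q lam z.1
        = lam • (sys.Kdiag lam z.1 + sys.Kdiag (-lam) z.1)
          + (lam • (sys.K lam z.1 z.1 + sys.K (-lam) z.1 z.1))
            * (lam • (sys.K lam z.1 z.1 + sys.K (-lam) z.1 z.1)) :=
      Measure.quasiMeasurePreserving_fst.ae
        ((ae_restrict_iff' measurableSet_Ioi).1 (sys.q_ae hlam))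
    refine integral_congr_ae ?_
    filter_upwards [hq] with z hz
    by_cases h : z ∈ quadrant
    · rw [eT z h, hz h.1, smul_comm, ← mul_smul_comm]
      rfl
    · rw [z1 z h, zero_smul, zero_smul, smul_zero]

end LinearSystem

/-! ### Classical regularity when φ is twice continuously differentiable. -/

section Partial

variable {E : Type*} [NormedAddCommGroup E] [NormedSpace ℝ E]

/-- If the mixed derivative `∂_y ∂_x f` exists and is continuous then so does `∂_x ∂_y f`, and both
are equal. -/
theorem hasDerivAt_mixed {Ω : Set (ℝ × ℝ)} (hΩ : IsOpen Ω) {f fx fy fxy : ℝ × ℝ → E}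
    (hx : ∀ p ∈ Ω, HasDerivAt (fun s => f (s, p.2)) (fx p) p.1)
    (hy : ∀ p ∈ Ω, HasDerivAt (fun s => f (p.1, s)) (fy p) p.2)
    (hxy : ∀ p ∈ Ω, HasDerivAt (fun s => fx (p.1, s)) (fxy p) p.2)
    (hc : ContinuousOn fxy Ω) {p : ℝ × ℝ} (hp : p ∈ Ω) :
    HasDerivAt (fun s => fy (s, p.2)) (fxy p) p.1 := by
  obtain ⟨x, y⟩ := p
  set m := fxy (x, y) with hm
  rw [hasDerivAt_iff_isLittleO, Asymptotics.isLittleO_iff]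
  intro ε hε
  have h1 : ∀ᶠ q in 𝓝 (x, y), q ∈ Ω ∧ ‖fxy q - m‖ ≤ ε := by
    refine (hΩ.eventually_mem hp).and ?_
    have := tendsto_iff_norm_sub_tendsto_zero.1 (hc.continuousAt (hΩ.mem_nhds hp)).tendsto
    exact (this.eventually (gt_mem_nhds hε)).mono fun q hq => hq.le
  obtain ⟨δ, hδ, hball⟩ := Metric.eventually_nhds_iff_ball.1 h1
  have hb : ∀ s ∈ Metric.ball x δ, ∀ t ∈ Metric.ball y δ, (s, t) ∈ Ω ∧ ‖fxy (s, t) - m‖ ≤ ε :=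
    fun s hs t ht => hball _ (by rw [← ball_prod_same]; exact ⟨hs, ht⟩)
  have hx0 := Metric.mem_ball_self (x := x) hδ
  have hy0 := Metric.mem_ball_self (x := y) hδ
  have hA : ∀ s ∈ Metric.ball x δ, ∀ t ∈ Metric.ball y δ,
      ‖fx (s, t) - fx (s, y) - (t - y) • m‖ ≤ ε * ‖t - y‖ := fun s hs t ht => by
    have := (convex_ball y δ).norm_image_sub_le_of_norm_hasDerivWithin_le
      (f := fun r => fx (s, r) - r • m) (f' := fun r => fxy (s, r) - m) (C := ε)
      (fun r hr => by
        have h := (hxy (s, r) (hb s hs r hr).1).sub ((hasDerivAt_id r).smul_const m)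
        rw [one_smul] at h
        exact h.hasDerivWithinAt)
      (fun r hr => (hb s hs r hr).2) hy0 ht
    refine le_trans (le_of_eq ?_) this
    congr 1; module
  -- The mean value inequality, applied once in each variable, bounds the second difference of f
  -- over a rectangle. Dividing by t - y and letting t → y turns differences in the second variable
  -- into `fy`.
  have hB : ∀ s ∈ Metric.ball x δ, ∀ t ∈ Metric.ball y δ,
      ‖(f (s, t) - f (s, y)) - (f (x, t) - f (x, y)) - ((s - x) * (t - y)) • m‖
        ≤ ε * ‖t - y‖ * ‖s - x‖ := fun s hs t ht => by
    have := (convex_ball x δ).norm_image_sub_le_of_norm_hasDerivWithin_le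
      (f := fun r => f (r, t) - f (r, y) - r • (t - y) • m)
      (f' := fun r => fx (r, t) - fx (r, y) - (t - y) • m) (C := ε * ‖t - y‖)
      (fun r hr => by
        have h := ((hx (r, t) (hb r hr t ht).1).sub (hx (r, y) (hb r hr y hy0).1)).sub
          ((hasDerivAt_id r).smul_const ((t - y) • m))
        rw [one_smul] at h
        exact h.hasDerivWithinAt)
      (fun r hr => hA r hr t ht) hx0 hs
    refine le_trans (le_of_eq ?_) this
    congr 1; module
  filter_upwards [Metric.ball_mem_nhds x hδ] with s hs
  have l1 := hasDerivAt_iff_tendsto_slope.1 (hy _ (hb s hs y hy0).1)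
  have l2 := hasDerivAt_iff_tendsto_slope.1 (hy _ (hb x hx0 y hy0).1)
  refine le_of_tendsto ((l1.sub l2).sub_const ((s - x) • m)).norm ?_
  filter_upwards [self_mem_nhdsWithin, nhdsWithin_le_nhds (Metric.ball_mem_nhds y hδ)] with t ht ht'
  have hne : t - y ≠ 0 := sub_ne_zero.2 ht
  have hpos : 0 < ‖t - y‖ := norm_pos_iff.2 hne
  have h := hB s hs t ht'
  simp only [slope_def_module]
  have e : (t - y)⁻¹ • (f (s, t) - f (s, y)) - (t - y)⁻¹ • (f (x, t) - f (x, y)) - (s - x) • m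
      = (t - y)⁻¹ • ((f (s, t) - f (s, y)) - (f (x, t) - f (x, y)) - ((s - x) * (t - y)) • m) := by
    have e0 : s - x = (t - y)⁻¹ * ((s - x) * (t - y)) := by field_simp
    conv_lhs => rw [e0]
    module
  rw [e, norm_smul, norm_inv, inv_mul_le_iff₀ hpos]
  linarith

theorem contDiffOn_succ_of_partial {Ω : Set (ℝ × ℝ)} (hΩ : IsOpen Ω) {n : ℕ} {f fx fy : ℝ × ℝ → E}
    (hx : ∀ p ∈ Ω, HasDerivAt (fun s => f (s, p.2)) (fx p) p.1)
    (hy : ∀ p ∈ Ω, HasDerivAt (fun s => f (p.1, s)) (fy p) p.2)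
    (cx : ContDiffOn ℝ n fx Ω) (cy : ContDiffOn ℝ n fy Ω) : ContDiffOn ℝ (n + 1) f Ω := by
  have h : ∀ p ∈ Ω, HasFDerivAt f ((ContinuousLinearMap.fst ℝ ℝ ℝ).smulRight (fx p)
      + (ContinuousLinearMap.snd ℝ ℝ ℝ).smulRight (fy p)) p := fun p hp => by
    have := (hasStrictFDerivAt_of_partial hΩ hx hy cx.continuousOn cy.continuousOn hp).hasFDerivAt
    refine this.congr_fderiv ?_
    ext <;> simp
  rw [contDiffOn_succ_iff_fderiv_of_isOpen hΩ]
  refine ⟨fun p hp => (h p hp).differentiableAt.differentiableWithinAt, by simp, ?_⟩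
  exact ((contDiffOn_const.smulRight cx).add (contDiffOn_const.smulRight cy)).congr
    fun p hp => (h p hp).fderiv

theorem ContDiffOn.hasDerivAt_fst {Ω : Set (ℝ × ℝ)} (hΩ : IsOpen Ω) {f : ℝ × ℝ → E}
    (hf : ContDiffOn ℝ 1 f Ω) {p : ℝ × ℝ} (hp : p ∈ Ω) :
    HasDerivAt (fun s => f (s, p.2)) (fderiv ℝ f p (1, 0)) p.1 :=
  HasFDerivAt.comp_hasDerivAt (f := fun s : ℝ => (s, p.2)) p.1
    ((hf.differentiableOn one_ne_zero).differentiableAt (hΩ.mem_nhds hp)).hasFDerivAt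
    ((hasDerivAt_id' p.1).prodMk (hasDerivAt_const p.1 p.2))

end Partial

namespace LinearSystem

variable {H H₀ : Type*}
  [NormedAddCommGroup H] [InnerProductSpace ℂ H] [CompleteSpace H]
  [NormedAddCommGroup H₀] [InnerProductSpace ℂ H₀] [CompleteSpace H₀] [FiniteDimensional ℂ H₀]
  (sys : LinearSystem H H₀) [hcon : sys.IsContractive]
  {lam : ℂ} (hlam : ‖lam‖ < 1)

omit [CompleteSpace H] [CompleteSpace H₀] hcon in
theorem hasDerivAt_phi (hφ : ContDiffOn ℝ 2 sys.phi (Ioi 0)) {x : ℝ} (hx : 0 < x) :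
    HasDerivAt sys.phi (deriv sys.phi x) x :=
  ((hφ.differentiableOn two_ne_zero).differentiableAt (Ioi_mem_nhds hx)).hasDerivAt

omit [CompleteSpace H] [CompleteSpace H₀] hcon in
theorem contDiffOn_deriv_phi (hφ : ContDiffOn ℝ 2 sys.phi (Ioi 0)) :
    ContDiffOn ℝ 1 (deriv sys.phi) (Ioi 0) := by
  have h : ContDiffOn ℝ (1 + 1) sys.phi (Ioi 0) := by
    rw [one_add_one_eq_two]; exact hφ
  exact ((contDiffOn_succ_iff_deriv_of_isOpen isOpen_Ioi).1 h).2.2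

omit [CompleteSpace H] [CompleteSpace H₀] hcon in
theorem hasDerivAt_deriv_phi (hφ : ContDiffOn ℝ 2 sys.phi (Ioi 0)) {x : ℝ} (hx : 0 < x) :
    HasDerivAt (deriv sys.phi) (deriv (deriv sys.phi) x) x :=
  (((sys.contDiffOn_deriv_phi hφ).differentiableOn one_ne_zero).differentiableAt
    (Ioi_mem_nhds hx)).hasDerivAt

theorem mapsTo_add_quadrant : MapsTo (fun p : ℝ × ℝ => p.1 + p.2) quadrant (Ioi 0) :=
  fun p hp => (add_pos hp.1 hp.2 : 0 < p.1 + p.2)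

include hlam in
theorem contDiffOn_J_one : ContDiffOn ℝ 1 (fun p : ℝ × ℝ => sys.J lam p.1 p.2) quadrant := by
  have := contDiffOn_succ_of_partial (n := 0) isOpen_quadrant (sys.hasDerivAt_Jx hlam)
    (f := fun p => sys.J lam p.1 p.2) (sys.hasDerivAt_Jy hlam)
    (contDiffOn_zero.2 (sys.continuousOn_Jx hlam)) (contDiffOn_zero.2 (sys.continuousOn_Jy hlam))
  simpa using this

include hlam in
theorem contDiffOn_K_one (hφ : ContDiffOn ℝ 2 sys.phi (Ioi 0)) :
    ContDiffOn ℝ 1 (fun p : ℝ × ℝ => sys.K lam p.1 p.2) quadrant :=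
  ((hφ.of_le one_le_two).comp (by fun_prop) mapsTo_add_quadrant).sub
    ((sys.contDiffOn_J_one hlam).const_smul lam)

include hlam in
theorem contDiffOn_K_diag_one (hφ : ContDiffOn ℝ 2 sys.phi (Ioi 0)) :
    ContDiffOn ℝ 1 (fun p : ℝ × ℝ => sys.K lam p.1 p.1) quadrant :=
  (sys.contDiffOn_K_one hlam hφ).comp (g := fun p : ℝ × ℝ => sys.K lam p.1 p.2)
    (f := fun p : ℝ × ℝ => (p.1, p.1)) (by fun_prop) fun p hp => ⟨hp.1, hp.1⟩

include hlam in
theorem hasDerivAt_K_fst (hφ : ContDiffOn ℝ 2 sys.phi (Ioi 0)) {p : ℝ × ℝ} (hp : p ∈ quadrant) :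
    HasDerivAt (fun s => sys.K lam s p.2)
      (deriv sys.phi (p.1 + p.2) - lam • sys.Jx lam p) p.1 :=
  ((sys.hasDerivAt_phi hφ (mapsTo_add_quadrant hp)).comp_add_const p.1 p.2).sub
    ((sys.hasDerivAt_Jx hlam p hp).const_smul lam)

include hlam in
theorem hasDerivAt_K_snd (hφ : ContDiffOn ℝ 2 sys.phi (Ioi 0)) {p : ℝ × ℝ} (hp : p ∈ quadrant) :
    HasDerivAt (fun s => sys.K lam p.1 s)
      (deriv sys.phi (p.1 + p.2) - lam • sys.Jy lam p) p.2 :=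
  ((sys.hasDerivAt_phi hφ (mapsTo_add_quadrant hp)).comp_const_add p.1 p.2).sub
    ((sys.hasDerivAt_Jy hlam p hp).const_smul lam)

/-- The mixed second derivative of `J`. -/
noncomputable def Jxy (lam : ℂ) (p : ℝ × ℝ) : H₀ →L[ℂ] H₀ :=
  sys.Z lam sys.AB sys.AB p.1 p.2
    - sys.K lam p.1 p.1 * (deriv sys.phi (p.1 + p.2) - lam • sys.Jy lam p)

include hlam in
theorem continuousOn_Jxy (hφ : ContDiffOn ℝ 2 sys.phi (Ioi 0)) :
    ContinuousOn (sys.Jxy lam) quadrant :=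
  (sys.continuousOn_Z_quadrant hlam _ _).sub ((sys.continuousOn_K_diag hlam).mul
    (((sys.contDiffOn_deriv_phi hφ).continuousOn.comp (by fun_prop) mapsTo_add_quadrant).sub
      ((sys.continuousOn_Jy hlam).const_smul lam)))

include hlam in
theorem hasDerivAt_Jx_snd (hφ : ContDiffOn ℝ 2 sys.phi (Ioi 0)) {p : ℝ × ℝ} (hp : p ∈ quadrant) :
    HasDerivAt (fun s => sys.Jx lam (p.1, s)) (sys.Jxy lam p) p.2 := by
  have h1 := (sys.hasDerivAt_Z_snd (lam := lam) sys.AB (x := p.1) hp.2).neg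
  have h2 := (sys.hasDerivAt_K_snd hlam hφ hp).const_mul (sys.K lam p.1 p.1)
  have h3 := h1.sub h2
  rw [neg_neg] at h3
  exact h3

-- Differentiating `Z` in x directly would ask for A on the range of AB, which need not lie in the
-- domain. The other mixed derivative is explicit and continuous, so equality of mixed derivatives
-- supplies this one.
include hlam in
theorem hasDerivAt_Jy_fst (hφ : ContDiffOn ℝ 2 sys.phi (Ioi 0)) {p : ℝ × ℝ} (hp : p ∈ quadrant) :
    HasDerivAt (fun s => sys.Jy lam (s, p.2)) (sys.Jxy lam p) p.1 :=
  hasDerivAt_mixed isOpen_quadrant (f := fun p => sys.J lam p.1 p.2) (sys.hasDerivAt_Jx hlam)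
    (sys.hasDerivAt_Jy hlam) (fun p hp => sys.hasDerivAt_Jx_snd hlam hφ hp)
    (sys.continuousOn_Jxy hlam hφ) hp

-- Solving the formula for ∂_y J_{-λ} for `Z` expresses it as ∂_y J_{-λ} + K_{-λ}(x,x) K_λ(x,y), so
-- its x-derivative comes from the mixed derivative of J_{-λ}.
include hlam in
theorem contDiffOn_Z_one (hφ : ContDiffOn ℝ 2 sys.phi (Ioi 0)) :
    ContDiffOn ℝ 1 (fun p : ℝ × ℝ => sys.Z lam sys.AB sys.inputOp p.1 p.2) quadrant := by
  have hlam' : ‖-lam‖ < 1 := by rwa [norm_neg]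
  have hW : ContDiffOn ℝ 1 (fun p : ℝ × ℝ => sys.K (-lam) p.1 p.1 * sys.K lam p.1 p.2) quadrant :=
    (sys.contDiffOn_K_diag_one hlam' hφ).mul (sys.contDiffOn_K_one hlam hφ)
  have hW' : ContinuousOn (fun p => fderiv ℝ (fun p : ℝ × ℝ =>
      sys.K (-lam) p.1 p.1 * sys.K lam p.1 p.2) p (1, 0)) quadrant :=
    (hW.continuousOn_fderiv_of_isOpen isOpen_quadrant le_rfl).clm_apply continuousOn_const
  have hx : ∀ p ∈ quadrant, HasDerivAt (fun s => sys.Z lam sys.AB sys.inputOp s p.2)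
      (sys.Jxy (-lam) p + fderiv ℝ (fun p : ℝ × ℝ =>
      sys.K (-lam) p.1 p.1 * sys.K lam p.1 p.2) p (1, 0)) p.1 := fun p hp => by
    refine ((sys.hasDerivAt_Jy_fst hlam' hφ hp).add
      (hW.hasDerivAt_fst isOpen_quadrant hp)).congr_of_eventuallyEq (.of_forall fun s => ?_)
    simp only [Pi.add_apply]
    rw [Jy, neg_neg, sub_add_cancel]
  have := contDiffOn_succ_of_partial (n := 0) isOpen_quadrant hx
    (f := fun p => sys.Z lam sys.AB sys.inputOp p.1 p.2)
    (fun p hp => sys.hasDerivAt_Z_snd sys.AB hp.2)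
    (contDiffOn_zero.2 ((sys.continuousOn_Jxy hlam' hφ).add hW'))
    (contDiffOn_zero.2 (sys.continuousOn_Z_quadrant hlam _ _).neg)
  simpa using this

include hlam in
theorem contDiffOn_J_two (hφ : ContDiffOn ℝ 2 sys.phi (Ioi 0)) :
    ContDiffOn ℝ 2 (fun p : ℝ × ℝ => sys.J lam p.1 p.2) quadrant := by
  have hlam' : ‖-lam‖ < 1 := by rwa [norm_neg]
  have hx : ContDiffOn ℝ 1 (sys.Jx lam) quadrant := (sys.contDiffOn_Z_one hlam hφ).neg.sub
    ((sys.contDiffOn_K_diag_one hlam hφ).mul (sys.contDiffOn_K_one hlam hφ))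
  have hy : ContDiffOn ℝ 1 (sys.Jy lam) quadrant := (sys.contDiffOn_Z_one hlam' hφ).sub
    ((sys.contDiffOn_K_diag_one hlam hφ).mul (sys.contDiffOn_K_one hlam' hφ))
  have := contDiffOn_succ_of_partial (n := 1) isOpen_quadrant (sys.hasDerivAt_Jx hlam)
    (f := fun p => sys.J lam p.1 p.2) (sys.hasDerivAt_Jy hlam) (by exact_mod_cast hx)
    (by exact_mod_cast hy)
  rw [← one_add_one_eq_two]
  exact_mod_cast this

include hlam in
theorem contDiffOn_T (hφ : ContDiffOn ℝ 2 sys.phi (Ioi 0)) :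
    ContDiffOn ℝ 2 (fun p : ℝ × ℝ => sys.T lam p.1 p.2) quadrant := by
  have h : ContDiffOn ℝ 2 (fun p : ℝ × ℝ => sys.K lam p.1 p.2) quadrant :=
    (hφ.comp (by fun_prop) mapsTo_add_quadrant).sub ((sys.contDiffOn_J_two hlam hφ).const_smul lam)
  exact (h.const_smul (-lam)).congr fun p hp => sys.T_eq hlam (le_of_lt hp.1) (le_of_lt hp.2)

include hlam in
theorem contDiffOn_T_diag (hφ : ContDiffOn ℝ 2 sys.phi (Ioi 0)) :
    ContDiffOn ℝ 1 (fun x => sys.T lam x x) (Ioi 0) :=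
  ((sys.contDiffOn_T hlam hφ).of_le one_le_two).comp (g := fun p : ℝ × ℝ => sys.T lam p.1 p.2)
    (f := fun x : ℝ => (x, x)) (by fun_prop) fun x hx => ⟨hx, hx⟩

include hlam in
theorem hasDerivAt_K_diag (hφ : ContDiffOn ℝ 2 sys.phi (Ioi 0)) {x : ℝ} (hx : 0 < x) :
    HasDerivAt (fun s => sys.K lam s s) ((2 : ℝ) • deriv sys.phi (x + x)
      - lam • (sys.Jx lam (x, x) + sys.Jy lam (x, x))) x := by
  have h1 := HasDerivAt.scomp (g₁ := sys.phi) (h := fun s : ℝ => s + s) x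
    (sys.hasDerivAt_phi hφ (add_pos hx hx)) ((hasDerivAt_id' x).add (hasDerivAt_id' x))
  rw [one_add_one_eq_two] at h1
  exact h1.sub ((sys.hasDerivAt_J_diag hlam hx).const_smul lam)

include hlam in
/-- The partial differential equation for `T` in the classical sense. -/
theorem wave_T (hφ : ContDiffOn ℝ 2 sys.phi (Ioi 0)) {x y : ℝ} (hx : 0 < x) (hy : 0 < y) :
    iteratedDeriv 2 (fun s => sys.T lam s y) x - iteratedDeriv 2 (fun s => sys.T lam x s) y
      - sys.q lam x ∘L sys.T lam x y = 0 := by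
  have hlam' : ‖-lam‖ < 1 := by rwa [norm_neg]
  have hp : (x, y) ∈ quadrant := ⟨hx, hy⟩
  set p : ℝ → H₀ →L[ℂ] H₀ := fun s => lam • (sys.K lam s s + sys.K (-lam) s s) with hpd
  -- The first-order system with the derivative of φ cancelled. By it and `r2` both second
  -- derivatives of K_λ contain the same mixed derivative of J_{-λ}, which drops out of their
  -- difference.
  have r1 : ∀ s t, -lam • sys.Jx lam (s, t) = lam • sys.Jy (-lam) (s, t) + p s * sys.K lam s t :=
    fun s t => by
      have := sys.Kx_sub_Ky (lam := lam) s t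
      rw [Kx_eq, Ky_eq] at this
      rw [hpd]; simp only; rw [← this]; module
  have r2 : ∀ s t, -lam • sys.Jy lam (s, t) = lam • sys.Jx (-lam) (s, t) + p s * sys.K (-lam) s t :=
    fun s t => by
      have := sys.Kx_neg_sub_Ky (lam := lam) s t
      rw [Kx_eq, Ky_eq, eq_neg_iff_add_eq_zero, add_comm, ← eq_neg_iff_add_eq_zero] at this
      rw [hpd]; simp only; rw [this]; module
  -- The Miura identity again, now at every point, since K is differentiable on the diagonal.
  obtain ⟨p', hp', hq⟩ : ∃ p', HasDerivAt p p' x ∧ sys.q lam x = p' + p x * p x := by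
    refine ⟨_, ((sys.hasDerivAt_K_diag hlam hφ hx).add
      (sys.hasDerivAt_K_diag hlam' hφ hx)).const_smul lam, ?_⟩
    have hT : HasDerivAt (fun s => sys.T lam s s) _ x :=
      ((sys.hasDerivAt_K_diag hlam hφ hx).const_smul (-lam)).congr_of_eventuallyEq (by
        filter_upwards [Ioi_mem_nhds hx] with s hs
        exact sys.T_eq hlam (le_of_lt hs) (le_of_lt hs))
    have e := sys.smul_Kdiag_add (lam := lam) x
    rw [Kdiag, Kdiag, Kx_eq, Ky_eq, Kx_eq, Ky_eq, ← eq_sub_iff_add_eq'] at e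
    rw [q, hT.deriv, hpd]
    simp only
    rw [e]
    module
  have dx : HasDerivAt (fun s => deriv sys.phi (s + y) - lam • sys.Jx lam (s, y))
      (deriv (deriv sys.phi) (x + y) + lam • sys.Jxy (-lam) (x, y)
        + (p' * sys.K lam x y + p x * (deriv sys.phi (x + y) - lam • sys.Jx lam (x, y)))) x := by
    refine ((((sys.hasDerivAt_deriv_phi hφ (add_pos hx hy)).comp_add_const x y).add
      ((sys.hasDerivAt_Jy_fst hlam' hφ hp).const_smul lam)).add
      (hp'.mul (sys.hasDerivAt_K_fst hlam hφ hp))).congr_of_eventuallyEq (.of_forall fun s => ?_)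
    simp only [Pi.add_apply, Pi.smul_apply, Pi.mul_apply]
    rw [sub_eq_add_neg, ← neg_smul, r1, add_assoc]
  have dy : HasDerivAt (fun s => deriv sys.phi (x + s) - lam • sys.Jy lam (x, s))
      (deriv (deriv sys.phi) (x + y) + lam • sys.Jxy (-lam) (x, y)
        + p x * (deriv sys.phi (x + y) - -lam • sys.Jy (-lam) (x, y))) y := by
    refine ((((sys.hasDerivAt_deriv_phi hφ (add_pos hx hy)).comp_const_add x y).add
      ((sys.hasDerivAt_Jx_snd hlam' hφ hp).const_smul lam)).add
      ((sys.hasDerivAt_K_snd hlam' hφ hp).const_mul (p x))).congr_of_eventuallyEq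
        (.of_forall fun s => ?_)
    simp only [Pi.add_apply, Pi.smul_apply]
    rw [sub_eq_add_neg, ← neg_smul, r2, add_assoc]
  have ex : iteratedDeriv 2 (fun s => sys.T lam s y) x
      = -lam • (deriv (deriv sys.phi) (x + y) + lam • sys.Jxy (-lam) (x, y)
        + (p' * sys.K lam x y + p x * (deriv sys.phi (x + y) - lam • sys.Jx lam (x, y)))) := by
    rw [iteratedDeriv_succ, iteratedDeriv_one]
    refine ((dx.const_smul (-lam)).congr_of_eventuallyEq ?_).deriv
    filter_upwards [Ioi_mem_nhds hx] with s hs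
    refine (((sys.hasDerivAt_K_fst hlam hφ (p := (s, y)) ⟨hs, hy⟩).const_smul (-lam)
      ).congr_of_eventuallyEq ?_).deriv
    filter_upwards [Ioi_mem_nhds hs] with r hr
    exact sys.T_eq hlam (le_of_lt hr) hy.le
  have ey : iteratedDeriv 2 (fun s => sys.T lam x s) y
      = -lam • (deriv (deriv sys.phi) (x + y) + lam • sys.Jxy (-lam) (x, y)
        + p x * (deriv sys.phi (x + y) - -lam • sys.Jy (-lam) (x, y))) := by
    rw [iteratedDeriv_succ, iteratedDeriv_one]
    refine ((dy.const_smul (-lam)).congr_of_eventuallyEq ?_).deriv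
    filter_upwards [Ioi_mem_nhds hy] with s hs
    refine (((sys.hasDerivAt_K_snd hlam hφ (p := (x, s)) ⟨hx, hs⟩).const_smul (-lam)
      ).congr_of_eventuallyEq ?_).deriv
    filter_upwards [Ioi_mem_nhds hs] with r hr
    exact sys.T_eq hlam hx.le (le_of_lt hr)
  rw [ex, ey, hq, sys.T_eq hlam hx.le hy.le, sub_eq_add_neg (deriv sys.phi (x + y)) (lam • _),
    ← neg_smul, r1]
  change _ - _ - (p' + p x * p x) * (-lam • sys.K lam x y) = 0
  simp only [add_mul, mul_add, mul_sub, mul_smul_comm, smul_mul_assoc, mul_assoc]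
  module

end LinearSystem

/-! ### Hadamard's inequality and the summability of its constants. -/

section Hadamard

open scoped ComplexOrder in
/-- The square of Hadamard's bound for the determinant of a complex matrix with entries of modulus
at most one. -/
theorem Matrix.norm_det_sq_le {n : ℕ} (M : Matrix (Fin n) (Fin n) ℂ) (hM : ∀ i j, ‖M i j‖ ≤ 1) :
    ‖M.det‖ ^ 2 ≤ (n : ℝ) ^ n := by
  rcases Nat.eq_zero_or_pos n with rfl | hn
  · simp
  have hn' : (n : ℝ) ≠ 0 := by positivity
  have hP : (M * M.conjTranspose).PosSemidef := Matrix.posSemidef_self_mul_conjTranspose M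
  set e := hP.isHermitian.eigenvalues with he
  have he0 : ∀ i, 0 ≤ e i := hP.eigenvalues_nonneg
  have h1 : ∏ i, e i = ‖M.det‖ ^ 2 := by
    have h := hP.isHermitian.det_eq_prod_eigenvalues
    rw [Matrix.det_mul, Matrix.det_conjTranspose] at h
    have h2 : ((‖M.det‖ ^ 2 : ℝ) : ℂ) = ((∏ i, e i : ℝ) : ℂ) := by
      push_cast
      rw [← Complex.mul_conj']
      exact h
    exact_mod_cast h2.symm
  have h2 : ∑ i, e i ≤ (n : ℝ) * n := by
    have h := hP.isHermitian.trace_eq_sum_eigenvalues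
    have h3 : Matrix.trace (M * M.conjTranspose) = ((∑ i, ∑ j, ‖M i j‖ ^ 2 : ℝ) : ℂ) := by
      rw [Matrix.trace]
      push_cast
      refine Finset.sum_congr rfl fun i _ => ?_
      rw [Matrix.diag_apply, Matrix.mul_apply]
      refine Finset.sum_congr rfl fun j _ => ?_
      rw [Matrix.conjTranspose_apply]
      exact Complex.mul_conj' _
    have h4 : ∑ i, e i = ∑ i, ∑ j, ‖M i j‖ ^ 2 := by
      rw [h3] at h
      have h5 : ((∑ i, ∑ j, ‖M i j‖ ^ 2 : ℝ) : ℂ) = ((∑ i, e i : ℝ) : ℂ) := by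
        rw [h]; push_cast; rfl
      exact_mod_cast h5.symm
    rw [h4]
    calc ∑ i, ∑ j, ‖M i j‖ ^ 2 ≤ ∑ i : Fin n, ∑ j : Fin n, (1 : ℝ) :=
          Finset.sum_le_sum fun i _ => Finset.sum_le_sum fun j _ =>
            pow_le_one₀ (norm_nonneg _) (hM i j)
      _ = n * n := by simp
  -- The eigenvalues of M M* have product |det M|² and sum at most n², so their arithmetic mean is
  -- at most n.
  have amgm := Real.geom_mean_le_arith_mean Finset.univ (fun _ : Fin n => (1 : ℝ)) e
    (fun _ _ => zero_le_one) (by simp [hn]) (fun i _ => he0 i)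
  simp only [Real.rpow_one, one_mul, Finset.sum_const, Finset.card_univ, Fintype.card_fin,
    nsmul_eq_mul, mul_one] at amgm
  have h0 : 0 ≤ ∏ i, e i := Finset.prod_nonneg fun i _ => he0 i
  have h4 : (∏ i, e i) ^ (n : ℝ)⁻¹ ≤ n := amgm.trans (by
    rw [div_le_iff₀ (by positivity)]; exact h2)
  rw [← h1]
  calc ∏ i, e i = ((∏ i, e i) ^ (n : ℝ)⁻¹) ^ n := (Real.rpow_inv_natCast_pow h0 hn.ne').symm
    _ ≤ (n : ℝ) ^ n := by gcongr

/-- The constants in Hadamard's inequality. -/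
noncomputable def hadamardConst (n : ℕ) : ℝ := √((n : ℝ) ^ n)

theorem hadamardConst_nonneg (n : ℕ) : 0 ≤ hadamardConst n := Real.sqrt_nonneg _

/-- Hadamard's inequality. -/
theorem Matrix.norm_det_le_of_le_mul {n : ℕ} (A : Matrix (Fin n) (Fin n) ℂ) {r c : Fin n → ℝ}
    (hr : ∀ i, 0 ≤ r i) (hc : ∀ i, 0 ≤ c i) (h : ∀ i j, ‖A i j‖ ≤ r i * c j) :
    ‖A.det‖ ≤ hadamardConst n * ((∏ i, r i) * ∏ i, c i) := by
  -- Scaling rows and columns reduces to entries of modulus at most one. Division by zero does no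
  -- harm, because `A i j` vanishes whenever r i * c j does.
  let M : Matrix (Fin n) (Fin n) ℂ := Matrix.of fun i j => A i j / ((r i * c j : ℝ) : ℂ)
  have hM : ∀ i j, ‖M i j‖ ≤ 1 := fun i j => by
    have h0 : 0 ≤ r i * c j := mul_nonneg (hr i) (hc j)
    simp only [M, Matrix.of_apply, norm_div, Complex.norm_real, Real.norm_of_nonneg h0]
    exact div_le_one_of_le₀ (h i j) h0
  have hA : A = Matrix.of fun i j => ((r i : ℝ) : ℂ) * (Matrix.of fun i j => ((c j : ℝ) : ℂ) * M i j) i j := by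
    ext i j
    simp only [Matrix.of_apply, M]
    by_cases h0 : r i * c j = 0
    · have := h i j
      rw [h0, norm_le_zero_iff] at this
      rw [this]; simp
    · have h1 : r i ≠ 0 := left_ne_zero_of_mul h0
      have h2 : c j ≠ 0 := right_ne_zero_of_mul h0
      push_cast
      have h3 := Complex.ofReal_ne_zero.2 h1
      have h4 := Complex.ofReal_ne_zero.2 h2
      field_simp
  have hd : A.det = (∏ i, (r i : ℂ)) * ((∏ i, (c i : ℂ)) * M.det) := by
    conv_lhs => rw [hA]
    rw [Matrix.det_mul_column, Matrix.det_mul_row]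
  have hMd : ‖M.det‖ ≤ hadamardConst n := Real.le_sqrt_of_sq_le (M.norm_det_sq_le hM)
  rw [hd, norm_mul, norm_mul, norm_prod, norm_prod]
  simp only [Complex.norm_real, Real.norm_of_nonneg (hr _), Real.norm_of_nonneg (hc _)]
  have p1 : 0 ≤ ∏ i, r i := Finset.prod_nonneg fun i _ => hr i
  have p2 : 0 ≤ ∏ i, c i := Finset.prod_nonneg fun i _ => hc i
  calc _ ≤ (∏ i, r i) * ((∏ i, c i) * hadamardConst n) := by gcongr
    _ = _ := by ring

theorem hadamardConst_le (n : ℕ) : hadamardConst n ≤ √(Real.exp 1 ^ n * n.factorial) := by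
  refine Real.sqrt_le_sqrt ?_
  have h := Real.pow_div_factorial_le_exp (n : ℝ) (Nat.cast_nonneg n) n
  rw [div_le_iff₀ (by positivity)] at h
  rwa [← Real.exp_nat_mul, mul_one]

/-- Since n^n ≤ e^n n!, the term is at most √((4 e z²)^n / n!) · 2^{-n}; by 2ab ≤ a² + b² it is
dominated by an exponential series plus a geometric one. -/
theorem summable_hadamardConst (z : ℝ) :
    Summable fun n : ℕ => hadamardConst n / n.factorial * |z| ^ n := by
  have h1 : Summable fun n : ℕ => (4 * Real.exp 1 * z ^ 2) ^ n / n.factorial + (1 / 4 : ℝ) ^ n :=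
    (Real.summable_pow_div_factorial _).add (summable_geometric_of_lt_one (by norm_num) (by norm_num))
  refine Summable.of_nonneg_of_le (fun n => ?_) (fun n => ?_) h1
  · exact mul_nonneg (div_nonneg (hadamardConst_nonneg n) (by positivity)) (by positivity)
  · have hf : (0 : ℝ) < n.factorial := by positivity
    have h2 : hadamardConst n / n.factorial * |z| ^ n
        ≤ √((Real.exp 1 * z ^ 2) ^ n / n.factorial) := by
      refine Real.le_sqrt_of_sq_le ?_
      have h3 : hadamardConst n ^ 2 ≤ Real.exp 1 ^ n * n.factorial := by
        have := pow_le_pow_left₀ (hadamardConst_nonneg n) (hadamardConst_le n) 2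
        rwa [Real.sq_sqrt (by positivity)] at this
      calc (hadamardConst n / n.factorial * |z| ^ n) ^ 2
          = hadamardConst n ^ 2 * (z ^ 2) ^ n / (n.factorial * n.factorial) := by
            rw [← sq_abs z]; ring
        _ ≤ (Real.exp 1 ^ n * n.factorial) * (z ^ 2) ^ n / (n.factorial * n.factorial) := by gcongr
        _ = _ := by rw [mul_pow]; field_simp
    refine h2.trans ?_
    have hq : (4 : ℝ) ^ n * (1 / 4) ^ n = 1 := by rw [← mul_pow]; norm_num
    have hs : ((1 / 2 : ℝ) ^ n) ^ 2 = (1 / 4) ^ n := by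
      rw [← pow_mul, mul_comm, pow_mul]; norm_num
    have h4 : √((Real.exp 1 * z ^ 2) ^ n / n.factorial)
        = √((4 * Real.exp 1 * z ^ 2) ^ n / n.factorial) * (1 / 2 : ℝ) ^ n := by
      rw [← Real.sqrt_sq (by positivity : (0 : ℝ) ≤ (1 / 2 : ℝ) ^ n), ← Real.sqrt_mul (by positivity), hs]
      congr 1
      rw [mul_assoc 4, mul_pow 4]
      linear_combination (-(Real.exp 1 * z ^ 2) ^ n / n.factorial) * hq
    rw [h4]
    have h5 := two_mul_le_add_sq (√((4 * Real.exp 1 * z ^ 2) ^ n / n.factorial)) ((1 / 2 : ℝ) ^ n)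
    rw [Real.sq_sqrt (by positivity), hs] at h5
    have h6 : 0 ≤ √((4 * Real.exp 1 * z ^ 2) ^ n / n.factorial) * (1 / 2 : ℝ) ^ n := by positivity
    linarith

theorem hadamardConst_succ_sq_le (n : ℕ) : hadamardConst (n + 1) / n.factorial
    = (n + 1) * (hadamardConst (n + 1) / (n + 1).factorial) := by
  rw [Nat.factorial_succ]
  push_cast
  field_simp

/-- The extra factor n + 1 is at most 2^{n+1} and is absorbed by doubling the argument; the summand
|z| + 1 pays for the additional power. -/
theorem summable_hadamardConst_succ (z : ℝ) :
    Summable fun n : ℕ => hadamardConst (n + 1) / n.factorial * |z| ^ n := by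
  have h := (summable_nat_add_iff 1).2 (summable_hadamardConst (2 * (|z| + 1)))
  refine Summable.of_nonneg_of_le (fun n => ?_) (fun n => ?_) h
  · exact mul_nonneg (div_nonneg (hadamardConst_nonneg _) (by positivity)) (by positivity)
  · rw [hadamardConst_succ_sq_le, mul_comm ((n : ℝ) + 1), mul_assoc]
    refine mul_le_mul_of_nonneg_left ?_ (div_nonneg (hadamardConst_nonneg _) (by positivity))
    rw [abs_of_nonneg (by positivity : (0 : ℝ) ≤ 2 * (|z| + 1)), mul_pow]
    have h1 : ((n : ℝ) + 1) ≤ 2 ^ (n + 1) := by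
      exact_mod_cast (Nat.lt_two_pow_self (n := n + 1)).le
    have h2 : |z| ^ n ≤ (|z| + 1) ^ (n + 1) :=
      (pow_le_pow_left₀ (abs_nonneg z) (by linarith) n).trans
        (pow_le_pow_right₀ (by linarith [abs_nonneg z]) (Nat.le_succ n))
    gcongr

end Hadamard

/-! ### Coefficients of the Fredholm determinant and of its first minor. -/

section Minor

/-- The matrix with entries `h (s_i + t_j)`. -/
def hankelMatrix (h : ℝ → ℂ) {n : ℕ} (s t : Fin n → ℝ) : Matrix (Fin n) (Fin n) ℂ :=
  Matrix.of fun i j => h (s i + t j)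

/-- Expansion of a bordered determinant along its first row. -/
theorem det_hankelMatrix_cons (h : ℝ → ℂ) {n : ℕ} (s y : ℝ) (t : Fin (n + 1) → ℝ) :
    (hankelMatrix h (Fin.cons s t : Fin (n + 2) → ℝ) (Fin.cons y t)).det
      = h (s + y) * (hankelMatrix h t t).det - ∑ i : Fin (n + 1), h (s + t i) *
        (hankelMatrix h (Fin.cons (t i) fun j => t (i.succAbove j) : Fin (n + 1) → ℝ)
          (Fin.cons y fun j => t (i.succAbove j))).det := by
  rw [Matrix.det_succ_row_zero, Fin.sum_univ_succ, sub_eq_add_neg, ← Finset.sum_neg_distrib]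
  congr 1
  · simp [hankelMatrix, Matrix.submatrix]
  · refine Finset.sum_congr rfl fun i _ => ?_
    -- The cycle brings the row of `t i` to the top of the submatrix. Its sign (-1)^i meets the
    -- Laplace sign (-1)^{i+1}, so every term enters with a minus.
    have e : ((hankelMatrix h (Fin.cons s t : Fin (n + 2) → ℝ) (Fin.cons y t)).submatrix
        Fin.succ i.succ.succAbove).submatrix i.cycleRange.symm id
        = hankelMatrix h (Fin.cons (t i) fun j => t (i.succAbove j) : Fin (n + 1) → ℝ)
          (Fin.cons y fun j => t (i.succAbove j)) := by
      ext a b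
      refine Fin.cases ?_ (fun a => ?_) a <;> refine Fin.cases ?_ (fun b => ?_) b <;>
        simp [hankelMatrix]
    rw [← e, Matrix.det_permute]
    rw [Equiv.Perm.sign_symm, Fin.sign_cycleRange]
    simp only [hankelMatrix, Matrix.of_apply, Fin.cons_zero, Fin.cons_succ, Fin.val_succ, pow_succ]
    push_cast
    ring

end Minor

section FredholmMinor

/-- The product of `n` copies of Lebesgue measure on `(x, ∞)`. -/
noncomputable abbrev piIoi (x : ℝ) (n : ℕ) : Measure (Fin n → ℝ) :=
  Measure.pi fun _ => volume.restrict (Ioi x)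

/-- The kernel `h (s + t)` is dominated by `w s * w t` on `(x, ∞)`, with `w` square integrable. -/
structure HankelBound (h : ℝ → ℂ) (x : ℝ) (w : ℝ → ℝ) : Prop where
  nonneg : ∀ s, 0 ≤ w s
  memLp : MemLp w 2 (volume.restrict (Ioi x))
  ae_le : ∀ᵐ t ∂(volume.restrict (Ioi x)), ∀ s, x ≤ s → ‖h (s + t)‖ ≤ w s * w t
  -- No exceptional null set is allowed here: the diagonal of the minor is evaluated at the single
  -- point x.
  diag_le : ∀ s, x ≤ s → ‖h (s + s)‖ ≤ w s * w s

/-- The coefficients of the Fredholm determinant of the kernel `h (s + t)` on `(x, ∞)`. -/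
noncomputable def fredholmCoeff (h : ℝ → ℂ) (x : ℝ) (n : ℕ) : ℂ :=
  ∫ t, (hankelMatrix h t t).det ∂(piIoi x n)

/-- The coefficients of the first Fredholm minor of the kernel `h (s + t)` on `(x, ∞)`. -/
noncomputable def fredholmMinorCoeff (h : ℝ → ℂ) (x : ℝ) (n : ℕ) (a b : ℝ) : ℂ :=
  ∫ t, (hankelMatrix h (Fin.cons a t : Fin (n + 1) → ℝ) (Fin.cons b t)).det ∂(piIoi x n)

theorem continuous_det_hankelMatrix {h : ℝ → ℂ} (hc : Continuous h) {α : Type*}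
    [TopologicalSpace α] {n : ℕ} {f g : α → Fin n → ℝ} (hf : Continuous f) (hg : Continuous g) :
    Continuous fun a => (hankelMatrix h (f a) (g a)).det := by
  refine Continuous.matrix_det ?_
  refine continuous_matrix fun i j => ?_
  exact hc.comp (((continuous_apply i).comp hf).add ((continuous_apply j).comp hg))

theorem continuous_finCons {α : Type*} [TopologicalSpace α] {n : ℕ} {f : α → ℝ}
    {g : α → Fin n → ℝ} (hf : Continuous f) (hg : Continuous g) :
    Continuous fun a => (Fin.cons (f a) (g a) : Fin (n + 1) → ℝ) := by
  refine continuous_pi fun i => ?_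
  refine Fin.cases ?_ (fun i => ?_) i
  · simpa using hf
  · simp only [Fin.cons_succ]
    exact (continuous_apply i).comp hg

namespace HankelBound

variable {h : ℝ → ℂ} {x : ℝ} {w : ℝ → ℝ}

theorem mono (hb : HankelBound h x w) {y : ℝ} (hxy : x ≤ y) : HankelBound h y w where
  nonneg := hb.nonneg
  memLp := hb.memLp.mono_measure (Measure.restrict_mono (Ioi_subset_Ioi hxy) le_rfl)
  ae_le := by
    have h1 := ae_mono (Measure.restrict_mono (Ioi_subset_Ioi hxy) (le_refl volume)) hb.ae_le
    filter_upwards [h1] with t ht s hs using ht s (hxy.trans hs)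
  diag_le := fun s hs => hb.diag_le s (hxy.trans hs)

theorem integrable_sq (hb : HankelBound h x w) :
    Integrable (fun t => w t ^ 2) (volume.restrict (Ioi x)) := hb.memLp.integrable_sq

theorem integrable_prod_sq (hb : HankelBound h x w) (n : ℕ) :
    Integrable (fun t : Fin n → ℝ => ∏ i, w (t i) ^ 2) (piIoi x n) :=
  Integrable.fintype_prod (f := fun _ t => w t ^ 2) fun _ => hb.integrable_sq

theorem integral_prod_sq (n : ℕ) : ∫ t : Fin n → ℝ, ∏ i, w (t i) ^ 2 ∂(piIoi x n)
    = (∫ t in Ioi x, w t ^ 2) ^ n := by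
  have := integral_fintype_prod_eq_pow (ι := Fin n) (μ := volume.restrict (Ioi x))
    (fun t : ℝ => w t ^ 2)
  simpa using this

theorem norm_det_le_of_le (hb : HankelBound h x w) {n : ℕ} {s t : Fin n → ℝ}
    (hst : ∀ i j, ‖h (s i + t j)‖ ≤ w (s i) * w (t j)) :
    ‖(hankelMatrix h s t).det‖ ≤ hadamardConst n * ((∏ i, w (s i)) * ∏ i, w (t i)) :=
  Matrix.norm_det_le_of_le_mul _ (fun i => hb.nonneg _) (fun i => hb.nonneg _) hst

theorem ae_pi (hb : HankelBound h x w) (n : ℕ) : ∀ᵐ t ∂(piIoi x n), ∀ i : Fin n,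
    x < t i ∧ ∀ s, x ≤ s → ‖h (s + t i)‖ ≤ w s * w (t i) := by
  refine eventually_all.2 fun i => ?_
  exact (Measure.tendsto_eval_ae_ae (μ := fun _ : Fin n => volume.restrict (Ioi x)) (i := i)).eventually
    ((ae_restrict_mem measurableSet_Ioi).and hb.ae_le)

theorem norm_det_le (hb : HankelBound h x w) (n : ℕ) : ∀ᵐ t ∂(piIoi x n),
    ‖(hankelMatrix h t t).det‖ ≤ hadamardConst n * ∏ i, w (t i) ^ 2 := by
  filter_upwards [hb.ae_pi n] with t ht
  refine (hb.norm_det_le_of_le fun i j => (ht j).2 _ (ht i).1.le).trans_eq ?_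
  rw [← Finset.prod_mul_distrib]
  simp only [sq]

/-- The exceptional null set concerns `t` alone, so `a` and `b` may be chosen afterwards; only the
corner entry h(a+b) needs a hypothesis of its own. -/
theorem norm_det_cons_le (hb : HankelBound h x w) (n : ℕ) : ∀ᵐ t ∂(piIoi x n), ∀ a b,
    x ≤ a → x ≤ b → ‖h (a + b)‖ ≤ w a * w b →
    ‖(hankelMatrix h (Fin.cons a t : Fin (n + 1) → ℝ) (Fin.cons b t)).det‖
      ≤ hadamardConst (n + 1) * (w a * w b) * ∏ i, w (t i) ^ 2 := by
  filter_upwards [hb.ae_pi n] with t ht a b ha hb' hab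
  refine (hb.norm_det_le_of_le fun i j => ?_).trans_eq ?_
  · refine Fin.cases ?_ (fun i => ?_) i <;> refine Fin.cases ?_ (fun j => ?_) j
    · simpa using hab
    · simpa using (ht j).2 a ha
    · simpa [add_comm, mul_comm] using (ht i).2 b hb'
    · simpa using (ht j).2 _ (ht i).1.le
  · simp only [Fin.prod_univ_succ, Fin.cons_zero, Fin.cons_succ, sq, Finset.prod_mul_distrib]
    ring

theorem integrable_det (hb : HankelBound h x w) (hc : Continuous h) (n : ℕ) :
    Integrable (fun t => (hankelMatrix h t t).det) (piIoi x n) :=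
  ((hb.integrable_prod_sq n).const_mul (hadamardConst n)).mono'
    (continuous_det_hankelMatrix hc continuous_id continuous_id).aestronglyMeasurable
    (hb.norm_det_le n)

theorem norm_fredholmCoeff_le (hb : HankelBound h x w) (n : ℕ) :
    ‖fredholmCoeff h x n‖ ≤ hadamardConst n * (∫ t in Ioi x, w t ^ 2) ^ n := by
  refine (norm_integral_le_of_norm_le ((hb.integrable_prod_sq n).const_mul _)
    (hb.norm_det_le n)).trans_eq ?_
  rw [integral_const_mul, integral_prod_sq]

theorem norm_fredholmMinorCoeff_le (hb : HankelBound h x w) (n : ℕ) {a b : ℝ}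
    (ha : x ≤ a) (hb' : x ≤ b) (hab : ‖h (a + b)‖ ≤ w a * w b) :
    ‖fredholmMinorCoeff h x n a b‖
      ≤ hadamardConst (n + 1) * (w a * w b) * (∫ t in Ioi x, w t ^ 2) ^ n := by
  refine (norm_integral_le_of_norm_le ((hb.integrable_prod_sq n).const_mul
    (hadamardConst (n + 1) * (w a * w b))) ?_).trans_eq ?_
  · filter_upwards [hb.norm_det_cons_le n] with t ht using ht a b ha hb' hab
  · rw [integral_const_mul, integral_prod_sq]

theorem aestronglyMeasurable_fredholmMinorCoeff (hc : Continuous h) (n : ℕ) (b : ℝ) :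
    AEStronglyMeasurable (fun a => fredholmMinorCoeff h x n a b) (volume.restrict (Ioi x)) := by
  refine (AEStronglyMeasurable.integral_prod_right' (f := fun p : ℝ × (Fin n → ℝ) =>
    (hankelMatrix h (Fin.cons p.1 p.2 : Fin (n + 1) → ℝ) (Fin.cons b p.2)).det) ?_)
  exact (continuous_det_hankelMatrix hc (continuous_finCons continuous_fst continuous_snd)
      (continuous_finCons continuous_const continuous_snd)).aestronglyMeasurable

theorem integrable_mul_det_cons (hb : HankelBound h x w) (hc : Continuous h) (n : ℕ) {z b : ℝ}
    (hz : x ≤ z) (hb' : x ≤ b) :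
    Integrable (fun p : ℝ × (Fin n → ℝ) => h (z + p.1) *
      (hankelMatrix h (Fin.cons p.1 p.2 : Fin (n + 1) → ℝ) (Fin.cons b p.2)).det)
      ((volume.restrict (Ioi x)).prod (piIoi x n)) := by
  have h1 := (hb.integrable_sq.mul_prod (hb.integrable_prod_sq n)).const_mul
    (hadamardConst (n + 1) * (w z * w b))
  refine h1.mono' ?_ ?_
  · exact (Continuous.mul (hc.comp (continuous_const.add continuous_fst))
      (continuous_det_hankelMatrix hc (continuous_finCons continuous_fst continuous_snd)
      (continuous_finCons continuous_const continuous_snd))).aestronglyMeasurable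
  · have h2 := Measure.quasiMeasurePreserving_fst (μ := volume.restrict (Ioi x))
      (ν := piIoi x n) |>.ae (hb.ae_le.and (ae_restrict_mem measurableSet_Ioi))
    have h3 := Measure.quasiMeasurePreserving_snd (μ := volume.restrict (Ioi x))
      (ν := piIoi x n) |>.ae (hb.norm_det_cons_le n)
    filter_upwards [h2, h3] with p hp1 hp2
    have e1 := hp1.1 z hz
    have e2 := hp2 p.1 b (le_of_lt hp1.2) hb' (by
      rw [add_comm, mul_comm]; exact hp1.1 b hb')
    rw [norm_mul]
    refine (mul_le_mul e1 e2 (norm_nonneg _) (mul_nonneg (hb.nonneg _) (hb.nonneg _))).trans_eq ?_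
    ring

theorem integral_mul_fredholmMinorCoeff (hb : HankelBound h x w) (hc : Continuous h) (n : ℕ)
    {z b : ℝ} (hz : x ≤ z) (hb' : x ≤ b) (i : Fin (n + 1)) :
    Integrable (fun t : Fin (n + 1) → ℝ => h (z + t i) *
        (hankelMatrix h (Fin.cons (t i) fun j => t (i.succAbove j) : Fin (n + 1) → ℝ)
          (Fin.cons b fun j => t (i.succAbove j))).det) (piIoi x (n + 1)) ∧
    ∫ t, h (z + t i) *
        (hankelMatrix h (Fin.cons (t i) fun j => t (i.succAbove j) : Fin (n + 1) → ℝ)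
          (Fin.cons b fun j => t (i.succAbove j))).det ∂(piIoi x (n + 1))
      = ∫ ζ in Ioi x, h (z + ζ) * fredholmMinorCoeff h x n ζ b := by
  have hint := hb.integrable_mul_det_cons hc n hz hb'
  have hmp := measurePreserving_piFinSuccAbove (fun _ : Fin (n + 1) => volume.restrict (Ioi x)) i
  have e1 := (hmp.integrable_comp hint.aestronglyMeasurable).2 hint
  refine ⟨e1, ?_⟩
  have e2 := hmp.integral_comp' (g := fun p : ℝ × (Fin n → ℝ) => h (z + p.1) *
      (hankelMatrix h (Fin.cons p.1 p.2 : Fin (n + 1) → ℝ) (Fin.cons b p.2)).det)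
  refine e2.trans ?_
  rw [integral_prod _ hint]
  refine integral_congr_ae (Eventually.of_forall fun ζ => ?_)
  show ∫ t, h (z + ζ) * _ ∂_ = _
  rw [integral_const_mul]
  rfl

theorem fredholmMinorCoeff_zero (a b : ℝ) : fredholmMinorCoeff h x 0 a b = h (a + b) := by
  rw [fredholmMinorCoeff, piIoi, Measure.pi_of_empty, integral_dirac]
  simp [hankelMatrix]

theorem fredholmCoeff_zero : fredholmCoeff h x 0 = 1 := by
  rw [fredholmCoeff, piIoi, Measure.pi_of_empty, integral_dirac]
  simp

/-- Expand along the first row; by symmetry of the product measure the n + 1 off-corner terms have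
equal integrals. -/
theorem fredholmMinorCoeff_succ (hb : HankelBound h x w) (hc : Continuous h) (n : ℕ)
    {a b : ℝ} (ha : x ≤ a) (hb' : x ≤ b) :
    fredholmMinorCoeff h x (n + 1) a b = h (a + b) * fredholmCoeff h x (n + 1)
      - (n + 1) * ∫ ζ in Ioi x, h (a + ζ) * fredholmMinorCoeff h x n ζ b := by
  rw [fredholmMinorCoeff]
  simp_rw [det_hankelMatrix_cons]
  rw [integral_sub ((hb.integrable_det hc _).const_mul _)
    (integrable_finsetSum _ fun i _ => (hb.integral_mul_fredholmMinorCoeff hc n ha hb' i).1),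
    integral_const_mul, integral_finsetSum _ fun i _ =>
      (hb.integral_mul_fredholmMinorCoeff hc n ha hb' i).1]
  simp_rw [(hb.integral_mul_fredholmMinorCoeff hc n ha hb' _).2]
  simp [fredholmCoeff]

end HankelBound

end FredholmMinor

/-! ### The Fredholm series: first fundamental relation and derivative in x. -/

section FredholmSum

/-- The Fredholm determinant of the kernel `h (s + t)` on `(x, ∞)`. -/
noncomputable def fredholmSum (h : ℝ → ℂ) (lam : ℂ) (x : ℝ) : ℂ :=
  ∑' n : ℕ, lam ^ n / (n.factorial : ℂ) * fredholmCoeff h x n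

/-- The first Fredholm minor of the kernel `h (s + t)` on `(x, ∞)`. -/
noncomputable def fredholmMinor (h : ℝ → ℂ) (lam : ℂ) (x a b : ℝ) : ℂ :=
  ∑' n : ℕ, lam ^ n / (n.factorial : ℂ) * fredholmMinorCoeff h x n a b

/-- The majorant of the first Fredholm minor. -/
noncomputable def fredholmMajorant (lam : ℂ) (c : ℝ) (n : ℕ) : ℝ :=
  hadamardConst (n + 1) / n.factorial * |‖lam‖ * c| ^ n

theorem summable_fredholmMajorant (lam : ℂ) (c : ℝ) : Summable (fredholmMajorant lam c) :=
  summable_hadamardConst_succ _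

theorem norm_pow_div_factorial (lam : ℂ) (n : ℕ) :
    ‖lam ^ n / (n.factorial : ℂ)‖ = ‖lam‖ ^ n / n.factorial := by
  rw [norm_div, norm_pow, Complex.norm_natCast]

namespace HankelBound

variable {h : ℝ → ℂ} {x : ℝ} {w : ℝ → ℝ} {lam : ℂ}

theorem integral_sq_nonneg (x : ℝ) (w : ℝ → ℝ) : 0 ≤ ∫ t in Ioi x, w t ^ 2 :=
  integral_nonneg fun _ => sq_nonneg _

theorem summable_norm_coeff (hb : HankelBound h x w) :
    Summable fun n : ℕ => ‖lam ^ n / (n.factorial : ℂ) * fredholmCoeff h x n‖ := by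
  refine Summable.of_nonneg_of_le (fun _ => norm_nonneg _) (fun n => ?_)
    (summable_hadamardConst (‖lam‖ * ∫ t in Ioi x, w t ^ 2))
  rw [norm_mul, norm_pow_div_factorial,
    abs_of_nonneg (mul_nonneg (norm_nonneg _) (integral_sq_nonneg x w)), mul_pow]
  calc _ ≤ ‖lam‖ ^ n / n.factorial * (hadamardConst n * (∫ t in Ioi x, w t ^ 2) ^ n) := by
        gcongr; exact hb.norm_fredholmCoeff_le n
    _ = _ := by ring

theorem norm_minor_term_le (hb : HankelBound h x w) {c : ℝ} (hcx : ∫ t in Ioi x, w t ^ 2 ≤ c)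
    {a b : ℝ} (ha : x ≤ a) (hb' : x ≤ b) (hab : ‖h (a + b)‖ ≤ w a * w b) (n : ℕ) :
    ‖lam ^ n / (n.factorial : ℂ) * fredholmMinorCoeff h x n a b‖
      ≤ (w a * w b) * fredholmMajorant lam c n := by
  have h0 := integral_sq_nonneg x w
  have h1 := mul_nonneg (hb.nonneg a) (hb.nonneg b)
  rw [norm_mul, norm_pow_div_factorial, fredholmMajorant,
    abs_of_nonneg (mul_nonneg (norm_nonneg _) (h0.trans hcx)), mul_pow]
  have h2 := hadamardConst_nonneg (n + 1)
  calc _ ≤ ‖lam‖ ^ n / n.factorial *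
        (hadamardConst (n + 1) * (w a * w b) * (∫ t in Ioi x, w t ^ 2) ^ n) := by
        gcongr; exact hb.norm_fredholmMinorCoeff_le n ha hb' hab
    _ ≤ ‖lam‖ ^ n / n.factorial * (hadamardConst (n + 1) * (w a * w b) * c ^ n) := by gcongr
    _ = _ := by ring

theorem summable_norm_minor (hb : HankelBound h x w)
    {a b : ℝ} (ha : x ≤ a) (hb' : x ≤ b) (hab : ‖h (a + b)‖ ≤ w a * w b) :
    Summable fun n : ℕ => ‖lam ^ n / (n.factorial : ℂ) * fredholmMinorCoeff h x n a b‖ :=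
  Summable.of_nonneg_of_le (fun _ => norm_nonneg _) (hb.norm_minor_term_le le_rfl ha hb' hab)
    ((summable_fredholmMajorant lam _).mul_left _)

theorem ae_good (hb : HankelBound h x w) : ∀ᵐ a ∂(volume.restrict (Ioi x)), x ≤ a ∧
    ∀ b, x ≤ b → ‖h (a + b)‖ ≤ w a * w b ∧ ‖h (b + a)‖ ≤ w b * w a := by
  filter_upwards [hb.ae_le, ae_restrict_mem measurableSet_Ioi] with a ha hxa
  exact ⟨le_of_lt hxa, fun b hb => ⟨by rw [add_comm, mul_comm]; exact ha b hb, ha b hb⟩⟩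

theorem norm_fredholmMinor_le (hb : HankelBound h x w)
    {a b : ℝ} (ha : x ≤ a) (hb' : x ≤ b) (hab : ‖h (a + b)‖ ≤ w a * w b) :
    ‖fredholmMinor h lam x a b‖
      ≤ (∑' n, fredholmMajorant lam (∫ t in Ioi x, w t ^ 2) n) * w b * w a := by
  refine (norm_tsum_le_tsum_norm (hb.summable_norm_minor ha hb' hab)).trans ?_
  refine ((hb.summable_norm_minor ha hb' hab).tsum_le_tsum
    (hb.norm_minor_term_le le_rfl ha hb' hab)
    ((summable_fredholmMajorant lam _).mul_left _)).trans_eq ?_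
  rw [tsum_mul_left]
  ring

theorem memLp_fredholmMinor (hb : HankelBound h x w) (hc : Continuous h) {b : ℝ} (hxb : x ≤ b) :
    MemLp (fun a => fredholmMinor h lam x a b) 2 (volume.restrict (Ioi x)) := by
  refine MemLp.of_le_mul (c := (∑' n, fredholmMajorant lam (∫ t in Ioi x, w t ^ 2) n) * w b)
    hb.memLp ?_ ?_
  · refine aestronglyMeasurable_of_tendsto_ae atTop
      (f := fun N a => ∑ n ∈ Finset.range N, lam ^ n / (n.factorial : ℂ) * fredholmMinorCoeff h x n a b)
      (fun N => ?_) ?_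
    · exact Finset.aestronglyMeasurable_fun_sum _ fun n _ =>
        (aestronglyMeasurable_fredholmMinorCoeff hc n b).const_mul _
    · filter_upwards [hb.ae_good] with a ha
      exact (hb.summable_norm_minor ha.1 hxb (ha.2 b hxb).1).of_norm.hasSum.tendsto_sum_nat
  · filter_upwards [hb.ae_good] with a ha
    rw [Real.norm_of_nonneg (hb.nonneg a)]
    exact hb.norm_fredholmMinor_le ha.1 hxb (ha.2 b hxb).1

/-- Fredholm's first fundamental relation. -/
theorem fredholmMinor_eq (hb : HankelBound h x w) (hc : Continuous h) {a b : ℝ} (ha : x ≤ a)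
    (hxb : x ≤ b) (hab : ‖h (a + b)‖ ≤ w a * w b) :
    fredholmMinor h lam x a b = h (a + b) * fredholmSum h lam x
      - lam * ∫ ζ in Ioi x, h (a + ζ) * fredholmMinor h lam x ζ b := by
  set c := ∫ t in Ioi x, w t ^ 2 with hcdef
  have hle : ∀ n : ℕ, ∀ᵐ ζ ∂(volume.restrict (Ioi x)),
      ‖h (a + ζ) * (lam ^ n / (n.factorial : ℂ) * fredholmMinorCoeff h x n ζ b)‖
        ≤ w a * w b * fredholmMajorant lam c n * w ζ ^ 2 := fun n => by
    filter_upwards [hb.ae_good] with ζ hζ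
    rw [norm_mul]
    refine (mul_le_mul (hζ.2 a ha).2 (hb.norm_minor_term_le le_rfl hζ.1 hxb (hζ.2 b hxb).1 n)
      (norm_nonneg _) (mul_nonneg (hb.nonneg _) (hb.nonneg _))).trans_eq ?_
    ring
  have hint : ∀ n : ℕ, Integrable (fun ζ => h (a + ζ) *
      (lam ^ n / (n.factorial : ℂ) * fredholmMinorCoeff h x n ζ b)) (volume.restrict (Ioi x)) :=
    fun n => (hb.integrable_sq.const_mul _).mono'
      ((hc.comp (continuous_const.add continuous_id)).aestronglyMeasurable.mul
        ((aestronglyMeasurable_fredholmMinorCoeff hc n b).const_mul _)) (hle n)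
  have hsum : Summable fun n : ℕ => ∫ ζ in Ioi x, ‖h (a + ζ) *
      (lam ^ n / (n.factorial : ℂ) * fredholmMinorCoeff h x n ζ b)‖ := by
    refine Summable.of_nonneg_of_le (fun n => integral_nonneg fun _ => norm_nonneg _) (fun n => ?_)
      (((summable_fredholmMajorant lam c).mul_left (w a * w b)).mul_right c)
    refine (integral_mono_ae (hint n).norm (hb.integrable_sq.const_mul _) (hle n)).trans_eq ?_
    rw [integral_const_mul]
  have h1 := hasSum_integral_of_summable_integral_norm hint hsum
  simp_rw [tsum_mul_left] at h1
  have h2 := ((hasSum_nat_add_iff' 1).2 (hb.summable_norm_coeff (lam := lam)).of_norm.hasSum).mul_left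
    (h (a + b))
  -- The factor n + 1 of the recursion turns 1/(n+1)! into 1/n!, so the whole series of the minor
  -- reappears under the integral; the term of index 0 is added back afterwards.
  have key : (fun n : ℕ => lam ^ (n + 1) / ((n + 1).factorial : ℂ) *
      fredholmMinorCoeff h x (n + 1) a b) = fun n => h (a + b) *
        (lam ^ (n + 1) / ((n + 1).factorial : ℂ) * fredholmCoeff h x (n + 1)) - lam *
        ∫ ζ in Ioi x, h (a + ζ) *
          (lam ^ n / (n.factorial : ℂ) * fredholmMinorCoeff h x n ζ b) := by
    funext n
    rw [hb.fredholmMinorCoeff_succ hc n ha hxb]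
    have e : ∀ ζ, h (a + ζ) * (lam ^ n / (n.factorial : ℂ) * fredholmMinorCoeff h x n ζ b)
        = lam ^ n / (n.factorial : ℂ) * (h (a + ζ) * fredholmMinorCoeff h x n ζ b) :=
      fun ζ => by ring
    simp_rw [e]
    rw [integral_const_mul, Nat.factorial_succ]
    have hn : (n.factorial : ℂ) ≠ 0 := Nat.cast_ne_zero.2 n.factorial_ne_zero
    have hn1 : (n : ℂ) + 1 ≠ 0 := Nat.cast_add_one_ne_zero n
    push_cast
    field_simp
    ring
  have h3 := (hasSum_nat_add_iff (f := fun n : ℕ => lam ^ n / (n.factorial : ℂ) *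
    fredholmMinorCoeff h x n a b) 1).1 (by rw [key]; exact h2.sub (h1.mul_left lam))
  rw [fredholmMinor, h3.tsum_eq]
  simp only [Finset.sum_range_one, pow_zero, Nat.factorial_zero, Nat.cast_one, div_one, one_mul,
    fredholmMinorCoeff_zero, fredholmCoeff_zero]
  rw [fredholmSum]
  simp only [fredholmMinor]
  ring

/-- The hyperplanes t_i = t_j are null sets, so the least coordinate is almost everywhere attained
only once. -/
theorem ae_injective_piIoi (x : ℝ) (n : ℕ) : ∀ᵐ t ∂(piIoi x n), Function.Injective t := by
  have h1 : ∀ᵐ t : Fin n → ℝ, Function.Injective t := by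
    have h2 : ∀ i j : Fin n, i ≠ j → ∀ᵐ t : Fin n → ℝ, t i ≠ t j := fun i j hij => by
      let V : Submodule ℝ (Fin n → ℝ) := LinearMap.ker
        (LinearMap.proj (R := ℝ) (φ := fun _ : Fin n => ℝ) i - LinearMap.proj j)
      have hV : V ≠ ⊤ := fun hV => by
        have : Pi.single i (1 : ℝ) ∈ V := hV ▸ Submodule.mem_top
        simp [V, hij.symm] at this
      have h3 := Measure.addHaar_submodule (volume : Measure (Fin n → ℝ)) V hV
      rw [ae_iff]
      convert h3 using 2
      ext t
      simp [V, sub_eq_zero]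
    have h3 : ∀ᵐ t : Fin n → ℝ, ∀ i j : Fin n, i ≠ j → t i ≠ t j := by
      refine ae_all_iff.2 fun i => ae_all_iff.2 fun j => ?_
      by_cases hij : i = j
      · exact Eventually.of_forall fun t h => absurd hij h
      · filter_upwards [h2 i j hij] with t ht _ using ht
    filter_upwards [h3] with t ht i j hij
    by_contra hne
    exact ht i j hne hij
  rw [piIoi, ← Measure.restrict_pi_pi]
  exact ae_restrict_of_ae h1

theorem restrict_piIoi {x s : ℝ} (hs : x ≤ s) (n : ℕ) :
    (piIoi x n).restrict {t | ∀ j, s < t j} = piIoi s n := by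
  have : {t : Fin n → ℝ | ∀ j, s < t j} = univ.pi fun _ => Ioi s := by
    ext t; simp [Set.mem_pi]
  rw [this, piIoi, Measure.restrict_pi_pi]
  simp_rw [Measure.restrict_restrict measurableSet_Ioi, Ioi_inter_Ioi, sup_of_le_left hs]

theorem det_hankelMatrix_cons_succAbove (h : ℝ → ℂ) {n : ℕ} (t : Fin (n + 1) → ℝ) (i : Fin (n + 1)) :
    (hankelMatrix h (Fin.cons (t i) fun j => t (i.succAbove j) : Fin (n + 1) → ℝ)
      (Fin.cons (t i) fun j => t (i.succAbove j))).det = (hankelMatrix h t t).det := by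
  rw [← Matrix.det_submatrix_equiv_self i.cycleRange.symm (hankelMatrix h t t)]
  congr 1
  ext a b
  refine Fin.cases ?_ (fun a => ?_) a <;> refine Fin.cases ?_ (fun b => ?_) b <;>
        simp [hankelMatrix]

/-- Integration over `(x, ∞)ⁿ⁺¹`, ordered according to the least coordinate. -/
theorem fredholmCoeff_succ (hb : HankelBound h x w) (hc : Continuous h) (n : ℕ) :
    Integrable (fun s => fredholmMinorCoeff h s n s s) (volume.restrict (Ioi x)) ∧
    fredholmCoeff h x (n + 1) = (n + 1) * ∫ s in Ioi x, fredholmMinorCoeff h s n s s := by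
  let E : Set (ℝ × (Fin n → ℝ)) := {p | ∀ j, p.1 < p.2 j}
  have hE : MeasurableSet E := by
    have : E = ⋂ j, {p : ℝ × (Fin n → ℝ) | p.1 < p.2 j} := by ext p; simp [E]
    rw [this]
    exact MeasurableSet.iInter fun j => measurableSet_lt (by fun_prop) (by fun_prop)
  let g : ℝ × (Fin n → ℝ) → ℂ := fun p => (hankelMatrix h (Fin.cons p.1 p.2 : Fin (n + 1) → ℝ)
    (Fin.cons p.1 p.2)).det
  let e : Fin (n + 1) → (Fin (n + 1) → ℝ) → ℝ × (Fin n → ℝ) :=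
    fun i t => (t i, fun j => t (i.succAbove j))
  have hmp := fun i : Fin (n + 1) =>
    measurePreserving_piFinSuccAbove (fun _ : Fin (n + 1) => volume.restrict (Ioi x)) i
  have hge : ∀ i t, g (e i t) = (hankelMatrix h t t).det := fun i t =>
    det_hankelMatrix_cons_succAbove h t i
  have hg : Integrable g ((volume.restrict (Ioi x)).prod (piIoi x n)) := by
    refine ((hmp 0).integrable_comp_emb (MeasurableEquiv.measurableEmbedding _)).1 ?_
    exact (hb.integrable_det hc (n + 1)).congr (Eventually.of_forall fun t => (hge 0 t).symm)
  have hG := hg.indicator hE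
  have hGe : ∀ i, Integrable (fun t => E.indicator g (e i t)) (piIoi x (n + 1)) ∧
      ∫ t, E.indicator g (e i t) ∂(piIoi x (n + 1))
        = ∫ p, E.indicator g p ∂((volume.restrict (Ioi x)).prod (piIoi x n)) := fun i =>
    ⟨((hmp i).integrable_comp_emb (MeasurableEquiv.measurableEmbedding _)).2 hG,
      (hmp i).integral_comp' (g := E.indicator g)⟩
  -- Exactly one index carries the strict minimum, so exactly one of the n + 1 indicators is
  -- nonzero, and there the reordered determinant is the original one.
  have hsplit : ∀ᵐ t ∂(piIoi x (n + 1)),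
      (hankelMatrix h t t).det = ∑ i, E.indicator g (e i t) := by
    filter_upwards [ae_injective_piIoi x (n + 1)] with t ht
    obtain ⟨i, hi⟩ := Finite.exists_min t
    rw [Finset.sum_eq_single i, indicator_of_mem, hge]
    · exact fun j => lt_of_le_of_ne (hi _) fun h => i.succAbove_ne j (ht h).symm
    · intro k _ hk
      refine indicator_of_notMem (fun hk' => ?_) _
      obtain ⟨j, rfl⟩ := Fin.exists_succAbove_eq hk.symm
      exact absurd (hi k) (not_le.2 (hk' j))
    · simp
  -- With the least coordinate s fixed, the others range over (s,∞)ⁿ: the base point of the minor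
  -- moves along with s.
  have hinner : ∀ᵐ s ∂(volume.restrict (Ioi x)),
      ∫ t, E.indicator g (s, t) ∂(piIoi x n) = fredholmMinorCoeff h s n s s := by
    filter_upwards [ae_restrict_mem measurableSet_Ioi] with s hs
    rw [fredholmMinorCoeff, ← restrict_piIoi (le_of_lt hs), ← integral_indicator]
    · rfl
    · have : {t : Fin n → ℝ | ∀ j, s < t j} = Prod.mk s ⁻¹' E := rfl
      rw [this]
      exact measurable_prodMk_left hE
  refine ⟨hG.integral_prod_left.congr hinner, ?_⟩
  rw [fredholmCoeff, integral_congr_ae hsplit, integral_finsetSum _ fun i _ => (hGe i).1]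
  simp_rw [fun i => (hGe i).2]
  rw [integral_prod _ hG, integral_congr_ae hinner]
  simp

/-- The Fredholm determinant is a primitive of the diagonal of the first minor. -/
theorem fredholmSum_eq (hb : HankelBound h x w) (hc : Continuous h) :
    Integrable (fun s => fredholmMinor h lam s s s) (volume.restrict (Ioi x)) ∧
    fredholmSum h lam x = 1 + lam * ∫ s in Ioi x, fredholmMinor h lam s s s := by
  set c := ∫ t in Ioi x, w t ^ 2 with hcdef
  have hcs : ∀ s, x ≤ s → ∫ t in Ioi s, w t ^ 2 ≤ c := fun s hs =>
    setIntegral_mono_set hb.integrable_sq (Eventually.of_forall fun _ => sq_nonneg _)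
      (Ioi_subset_Ioi hs).eventuallyLE
  have hle : ∀ n : ℕ, ∀ᵐ s ∂(volume.restrict (Ioi x)),
      ‖lam ^ n / (n.factorial : ℂ) * fredholmMinorCoeff h s n s s‖
        ≤ fredholmMajorant lam c n * w s ^ 2 := fun n => by
    filter_upwards [ae_restrict_mem measurableSet_Ioi] with s hs
    refine ((hb.mono (le_of_lt hs)).norm_minor_term_le (hcs s (le_of_lt hs)) le_rfl le_rfl
      (hb.diag_le s (le_of_lt hs)) n).trans_eq ?_
    ring
  have hint : ∀ n : ℕ, Integrable (fun s =>
      lam ^ n / (n.factorial : ℂ) * fredholmMinorCoeff h s n s s) (volume.restrict (Ioi x)) :=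
    fun n => (hb.fredholmCoeff_succ hc n).1.const_mul _
  have hsum : Summable fun n : ℕ => ∫ s in Ioi x,
      ‖lam ^ n / (n.factorial : ℂ) * fredholmMinorCoeff h s n s s‖ := by
    refine Summable.of_nonneg_of_le (fun n => integral_nonneg fun _ => norm_nonneg _) (fun n => ?_)
      ((summable_fredholmMajorant lam c).mul_right c)
    refine (integral_mono_ae (hint n).norm (hb.integrable_sq.const_mul _) (hle n)).trans_eq ?_
    rw [integral_const_mul]
  have h1 := hasSum_integral_of_summable_integral_norm hint hsum
  refine ⟨?_, ?_⟩
  · refine (hb.integrable_sq.const_mul (∑' n, fredholmMajorant lam c n)).mono' ?_ ?_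
    · refine aestronglyMeasurable_of_tendsto_ae atTop
        (f := fun N s => ∑ n ∈ Finset.range N,
          lam ^ n / (n.factorial : ℂ) * fredholmMinorCoeff h s n s s)
        (fun N => Finset.aestronglyMeasurable_fun_sum _ fun n _ => (hint n).aestronglyMeasurable) ?_
      filter_upwards [ae_restrict_mem measurableSet_Ioi] with s hs
      exact ((hb.mono (le_of_lt hs)).summable_norm_minor le_rfl le_rfl
        (hb.diag_le s (le_of_lt hs))).of_norm.hasSum.tendsto_sum_nat
    · filter_upwards [ae_all_iff.2 hle, ae_restrict_mem measurableSet_Ioi] with s hs hxs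
      rw [← tsum_mul_right]
      exact tsum_of_norm_bounded
        ((summable_fredholmMajorant lam c).mul_right (w s ^ 2)).hasSum hs
  · have key : (fun n : ℕ => lam ^ (n + 1) / ((n + 1).factorial : ℂ) * fredholmCoeff h x (n + 1))
        = fun n => lam * ∫ s in Ioi x,
          lam ^ n / (n.factorial : ℂ) * fredholmMinorCoeff h s n s s := by
      funext n
      rw [(hb.fredholmCoeff_succ hc n).2, integral_const_mul, Nat.factorial_succ]
      have hn : (n.factorial : ℂ) ≠ 0 := Nat.cast_ne_zero.2 n.factorial_ne_zero
      have hn1 : (n : ℂ) + 1 ≠ 0 := Nat.cast_add_one_ne_zero n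
      push_cast
      field_simp
      ring
    have h3 := (hasSum_nat_add_iff (f := fun n : ℕ => lam ^ n / (n.factorial : ℂ) *
      fredholmCoeff h x n) 1).1 (by rw [key]; exact h1.mul_left lam)
    rw [fredholmSum, h3.tsum_eq]
    simp only [Finset.sum_range_one, pow_zero, Nat.factorial_zero, Nat.cast_one, div_one, one_mul,
      fredholmCoeff_zero]
    rw [add_comm]
    rfl

end HankelBound

end FredholmSum

/-! ### The scalar case: the determinant and its logarithm. -/

theorem eq_trace_smul_one {V : Type*} [NormedAddCommGroup V] [NormedSpace ℂ V]
    [FiniteDimensional ℂ V] (hdim : Module.finrank ℂ V = 1) (L : V →L[ℂ] V) :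
    L = LinearMap.trace ℂ V (L : V →ₗ[ℂ] V) • (1 : V →L[ℂ] V) := by
  obtain ⟨v, hv, h⟩ := finrank_eq_one_iff'.1 hdim
  obtain ⟨c, hc⟩ := h (L v)
  have hL : L = c • (1 : V →L[ℂ] V) := by
    ext u
    obtain ⟨d, rfl⟩ := h u
    rw [map_smul, ← hc]
    simp
  have ht : LinearMap.trace ℂ V (L : V →ₗ[ℂ] V) = c := by
    have : (L : V →ₗ[ℂ] V) = c • (1 : V →ₗ[ℂ] V) := by rw [hL]; rfl
    rw [this, map_smul, LinearMap.trace_one, hdim]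
    simp
  rw [ht]
  exact hL

namespace LinearSystem

variable {H H₀ : Type*}
  [NormedAddCommGroup H] [InnerProductSpace ℂ H] [CompleteSpace H]
  [NormedAddCommGroup H₀] [InnerProductSpace ℂ H₀] [CompleteSpace H₀] [FiniteDimensional ℂ H₀]
  (sys : LinearSystem H H₀)

/-- The trace as a continuous functional. -/
noncomputable def traceCLM : (H₀ →L[ℂ] H₀) →L[ℂ] ℂ :=
  LinearMap.toContinuousLinearMap
    (LinearMap.trace ℂ H₀ ∘ₗ ContinuousLinearMap.coeLM ℂ)

theorem traceCLM_apply (L : H₀ →L[ℂ] H₀) :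
    traceCLM L = LinearMap.trace ℂ H₀ (L : H₀ →ₗ[ℂ] H₀) := rfl

theorem eq_traceCLM_smul_one (hdim : Module.finrank ℂ H₀ = 1) (L : H₀ →L[ℂ] H₀) :
    L = traceCLM L • (1 : H₀ →L[ℂ] H₀) := eq_trace_smul_one hdim L

/-- The trace of `φ`, extended to a continuous function on the line. -/
noncomputable def traceφ (t : ℝ) : ℂ := traceCLM (sys.phi (max t 0))

theorem continuous_traceφ : Continuous sys.traceφ :=
  traceCLM.continuous.comp
    (sys.continuousOn_phi.comp_continuous (continuous_id.max continuous_const) fun t => le_max_right t 0)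

theorem traceφ_of_nonneg {t : ℝ} (ht : 0 ≤ t) : sys.traceφ t = traceCLM (sys.phi t) := by
  rw [traceφ, max_eq_left ht]

theorem phi_eq_traceφ (hdim : Module.finrank ℂ H₀ = 1) {t : ℝ} (ht : 0 ≤ t) :
    sys.phi t = sys.traceφ t • (1 : H₀ →L[ℂ] H₀) := by
  rw [sys.traceφ_of_nonneg ht]; exact eq_traceCLM_smul_one hdim _

variable [hcon : sys.IsContractive] {lam : ℂ} (hlam : ‖lam‖ < 1)

/-- The trace of `T_λ(x, x)`. -/
noncomputable def traceT (lam : ℂ) (x : ℝ) : ℂ := traceCLM (sys.T lam x x)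

theorem T_eq_traceT (hdim : Module.finrank ℂ H₀ = 1) (x : ℝ) :
    sys.T lam x x = sys.traceT lam x • (1 : H₀ →L[ℂ] H₀) := eq_traceCLM_smul_one hdim _

include hlam in
theorem continuousOn_traceT : ContinuousOn (sys.traceT lam) (Ioi 0) :=
  traceCLM.continuous.comp_continuousOn ((sys.continuousOn_T hlam).comp
    (f := fun x : ℝ => (x, x)) (by fun_prop) fun x (hx : 0 < x) => ⟨hx.le, hx.le⟩)

include hlam in
/-- Fredholm's formula for the resolvent kernel on the diagonal. -/
theorem fredholmMinor_diag (hdim : Module.finrank ℂ H₀ = 1) {x : ℝ} (hx : 0 < x) {w : ℝ → ℝ}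
    (hb : HankelBound sys.traceφ x w) :
    -lam * fredholmMinor sys.traceφ lam x x x
      = fredholmSum sys.traceφ lam x * sys.traceT lam x := by
  set f : ℝ → ℂ := fun y => -lam * fredholmMinor sys.traceφ lam x y x with hf
  set S := fredholmSum sys.traceφ lam x with hS
  -- -λ times the minor satisfies the Gelfand-Levitan equation with inhomogeneous term multiplied by
  -- the determinant `S`, and so does S · T(x,·). Their difference `D` is a solution of the
  -- homogeneous equation.
  let D : ℝ → H₀ →L[ℂ] H₀ := fun y => f y • (1 : H₀ →L[ℂ] H₀) - S • sys.T lam x y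
  have hfL : MemLp f 2 (volume.restrict (Ioi x)) :=
    (hb.memLp_fredholmMinor sys.continuous_traceφ le_rfl).const_mul (-lam)
  have hfL' : MemLp (fun y => f y • (1 : H₀ →L[ℂ] H₀)) 2 (volume.restrict (Ioi x)) :=
    ((ContinuousLinearMap.id ℂ ℂ).smulRight (1 : H₀ →L[ℂ] H₀)).comp_memLp' hfL
  have hTL := sys.memLp_T hlam hx.le
  have hD : MemLp D 2 (volume.restrict (Ioi x)) := hfL'.sub (hTL.const_smul S)
  have heq : ∀ y, x ≤ y → ‖sys.traceφ (y + x)‖ ≤ w y * w x →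
      D y + lam • ∫ z in Ioi x, D z ∘L sys.phi (z + y) = 0 := fun y hy hyb => by
    have hy0 : 0 ≤ y := hx.le.trans hy
    have i1 : ∫ z in Ioi x, (f z • (1 : H₀ →L[ℂ] H₀)) ∘L sys.phi (z + y)
        = (-lam * ∫ z in Ioi x, sys.traceφ (y + z) * fredholmMinor sys.traceφ lam x z x) •
          (1 : H₀ →L[ℂ] H₀) := by
      rw [← integral_const_mul, ← integral_smul_const]
      refine setIntegral_congr_fun measurableSet_Ioi fun z hz => ?_
      have hz0 : 0 ≤ z + y := add_nonneg (hx.le.trans (le_of_lt hz)) hy0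
      simp only [hf]
      rw [sys.phi_eq_traceφ hdim hz0, add_comm z y]
      ext u
      simp only [ContinuousLinearMap.comp_apply, smul_apply, one_apply_eq_self, smul_smul]
      congr 1
      ring
    have i2 : ∫ z in Ioi x, D z ∘L sys.phi (z + y)
        = (∫ z in Ioi x, (f z • (1 : H₀ →L[ℂ] H₀)) ∘L sys.phi (z + y))
          - S • ∫ z in Ioi x, sys.T lam x z ∘L sys.phi (z + y) := by
      rw [← integral_smul]
      refine Eq.trans ?_ (integral_sub (sys.integrable_comp_phi hx.le hy0 hfL')
        ((sys.integrable_comp_phi hx.le hy0 hTL).smul S))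
      refine integral_congr_ae (Eventually.of_forall fun z => ?_)
      simp only [D, ContinuousLinearMap.sub_comp, ContinuousLinearMap.smul_comp]
    have e1 := (sys.gelfandLevitan_T hlam hx.le hy0).2
    have e2 := hb.fredholmMinor_eq (lam := lam) sys.continuous_traceφ hy le_rfl hyb
    rw [sys.phi_eq_traceφ hdim (add_nonneg hx.le hy0), add_comm x y] at e1
    rw [i2, i1]
    simp only [D, hf]
    rw [e2]
    rw [← hS]
    linear_combination (norm := module) (-S) • e1
  have hae : ∀ᵐ y ∂(volume.restrict (Ioi x)),
      D y + lam • ∫ z in Ioi x, D z ∘L sys.phi (z + y) = 0 := by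
    filter_upwards [hb.ae_good] with y hy using heq y hy.1 (hy.2 x le_rfl).1
  have h0 := sys.integral_comp_phi_eq_zero hlam hx.le hD hae hx.le
  have h1 := heq x le_rfl (hb.diag_le x le_rfl)
  rw [h0, smul_zero, add_zero] at h1
  have h2 := congrArg traceCLM (sub_eq_zero.1 h1)
  rw [map_smul, map_smul, smul_eq_mul, smul_eq_mul, traceCLM_apply 1] at h2
  have h3 : LinearMap.trace ℂ H₀ ((1 : H₀ →L[ℂ] H₀) : H₀ →ₗ[ℂ] H₀) = 1 := by
    have : ((1 : H₀ →L[ℂ] H₀) : H₀ →ₗ[ℂ] H₀) = 1 := rfl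
    rw [this, LinearMap.trace_one, hdim]; simp
  rw [h3, mul_one] at h2
  exact h2

section

variable (hdim : Module.finrank ℂ H₀ = 1)
  (hb : ∀ x : ℝ, 0 < x → ∃ w, HankelBound sys.traceφ x w)

include hlam hdim hb in
theorem fredholmSum_eq_sub_integral {x : ℝ} (hx : 0 < x) :
    IntegrableOn (fun s => fredholmSum sys.traceφ lam s * sys.traceT lam s) (Ioi x) ∧
    fredholmSum sys.traceφ lam x
      = 1 - ∫ s in Ioi x, fredholmSum sys.traceφ lam s * sys.traceT lam s := by
  obtain ⟨w, hw⟩ := hb x hx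
  obtain ⟨h1, h2⟩ := hw.fredholmSum_eq (lam := lam) sys.continuous_traceφ
  have h3 : ∀ s ∈ Ioi x, -lam * fredholmMinor sys.traceφ lam s s s
      = fredholmSum sys.traceφ lam s * sys.traceT lam s := fun s hs =>
    sys.fredholmMinor_diag hlam hdim (hx.trans hs) (hw.mono (le_of_lt hs))
  refine ⟨(IntegrableOn.congr_fun (h1.const_mul (-lam)) h3 measurableSet_Ioi), ?_⟩
  rw [h2, ← setIntegral_congr_fun measurableSet_Ioi h3, integral_const_mul]
  ring

-- The integral equation is used twice: it makes the determinant continuous, hence its integrand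
-- continuous, and then it can be differentiated.
include hlam hdim hb in
theorem hasDerivAt_fredholmSum {x : ℝ} (hx : 0 < x) :
    HasDerivAt (fredholmSum sys.traceφ lam)
      (fredholmSum sys.traceφ lam x * sys.traceT lam x) x := by
  set g := fun s => fredholmSum sys.traceφ lam s * sys.traceT lam s with hg
  set a := x / 2 with ha
  have ha0 : 0 < a := by positivity
  have hax : a < x := by rw [ha]; linarith
  have hint := (sys.fredholmSum_eq_sub_integral hlam hdim hb ha0).1
  have key : ∀ s, a ≤ s → fredholmSum sys.traceφ lam s
      = fredholmSum sys.traceφ lam a + ∫ t in a..s, g t := fun s hs => by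
    rw [(sys.fredholmSum_eq_sub_integral hlam hdim hb (ha0.trans_le hs)).2,
      (sys.fredholmSum_eq_sub_integral hlam hdim hb ha0).2,
      intervalIntegral.integral_of_le hs, ← Ioc_union_Ioi_eq_Ioi hs,
      setIntegral_union Ioc_disjoint_Ioi_same measurableSet_Ioi
        (hint.mono_set Ioc_subset_Ioi_self) (hint.mono_set (Ioi_subset_Ioi hs))]
    ring
  have hii : ∀ s, a ≤ s → IntervalIntegrable g volume a s := fun s hs =>
    (intervalIntegrable_iff_integrableOn_Ioc_of_le hs).2 (hint.mono_set Ioc_subset_Ioi_self)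
  have hcont : ContinuousOn (fredholmSum sys.traceφ lam) (Ioo a (x + 1)) := by
    have h1 : ContinuousOn (fun s => ∫ t in a..s, g t) (Icc a (x + 1)) := by
      have := intervalIntegral.continuousOn_primitive_interval
        (f := g) (a := a) (b := x + 1) (μ := volume) ?_
      · rwa [uIcc_of_le (by linarith)] at this
      · rw [uIcc_of_le (by linarith), integrableOn_Icc_iff_integrableOn_Ioc]
        exact hint.mono_set Ioc_subset_Ioi_self
    exact ((continuousOn_const.add h1).mono Ioo_subset_Icc_self).congr fun s hs => key s hs.1.le
  have hgc : ContinuousAt g x := by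
    have h1 := hcont.continuousAt (Ioo_mem_nhds hax (by linarith))
    have h2 := (sys.continuousOn_traceT hlam).continuousAt (Ioi_mem_nhds hx)
    exact h1.mul h2
  have hmeas : StronglyMeasurableAtFilter g (𝓝 x) volume :=
    ⟨Ioi a, Ioi_mem_nhds hax, hint.aestronglyMeasurable⟩
  have hd := (intervalIntegral.integral_hasDerivAt_right (hii x hax.le) hmeas hgc).const_add
    (fredholmSum sys.traceφ lam a)
  refine hd.congr_of_eventuallyEq ?_
  filter_upwards [Ioi_mem_nhds hax] with s hs using key s (le_of_lt hs)

include hlam hdim hb in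
theorem tendsto_fredholmSum : Tendsto (fredholmSum sys.traceφ lam) atTop (𝓝 1) := by
  have h0 := (sys.fredholmSum_eq_sub_integral hlam hdim hb one_pos).1
  have h1 : Tendsto (fun x : ℝ => ∫ s in Ioi x, fredholmSum sys.traceφ lam s * sys.traceT lam s)
      atTop (𝓝 0) := by
    have h2 := (intervalIntegral_tendsto_integral_Ioi 1 h0 tendsto_id).const_sub
      (∫ s in Ioi 1, fredholmSum sys.traceφ lam s * sys.traceT lam s)
    rw [sub_self] at h2
    refine h2.congr' ?_
    filter_upwards [eventually_ge_atTop 1] with s hs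
    rw [id]
    rw [intervalIntegral.integral_of_le hs, ← Ioc_union_Ioi_eq_Ioi hs,
      setIntegral_union Ioc_disjoint_Ioi_same measurableSet_Ioi
        (h0.mono_set Ioc_subset_Ioi_self) (h0.mono_set (Ioi_subset_Ioi hs))]
    simp
  have h2 := h1.const_sub 1
  rw [sub_zero] at h2
  refine h2.congr' ?_
  filter_upwards [eventually_gt_atTop 0] with s hs
  exact (sys.fredholmSum_eq_sub_integral hlam hdim hb hs).2.symm

include hlam hdim hb in
/-- The logarithm of the Fredholm determinant. -/
theorem exists_log_fredholmSum : ∃ ℓ : ℝ → ℂ, ∀ x : ℝ, 0 < x →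
    Complex.exp (ℓ x) = fredholmSum sys.traceφ lam x ∧ HasDerivAt ℓ (sys.traceT lam x) x := by
  set P : ℝ → ℂ := fun x => ∫ s in (1 : ℝ)..x, sys.traceT lam s with hP
  have hPd : ∀ x : ℝ, 0 < x → HasDerivAt P (sys.traceT lam x) x := fun x hx => by
    have hc := sys.continuousOn_traceT hlam
    refine intervalIntegral.integral_hasDerivAt_right ?_ ?_ (hc.continuousAt (Ioi_mem_nhds hx))
    · exact (hc.mono fun s hs => (lt_min one_pos hx).trans_le hs.1).intervalIntegrable
    · exact hc.stronglyMeasurableAtFilter isOpen_Ioi x hx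
  -- An integrating factor: the quotient of the determinant by exp P is constant.
  set Q : ℝ → ℂ := fun x => fredholmSum sys.traceφ lam x * Complex.exp (-P x) with hQ
  have hQd : ∀ x : ℝ, 0 < x → HasDerivAt Q 0 x := fun x hx => by
    refine ((sys.hasDerivAt_fredholmSum hlam hdim hb hx).mul (hPd x hx).neg.cexp).congr_deriv ?_
    ring
  have hQ1 : ∀ x : ℝ, 0 < x → Q x = Q 1 := fun x hx =>
    (convex_Ioi (0 : ℝ)).is_const_of_fderivWithin_eq_zero (𝕜 := ℝ)
      (fun y hy => (hQd y hy).differentiableAt.differentiableWithinAt)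
      (fun y hy => by
        have h1 := (hQd y hy).hasFDerivAt.hasFDerivWithinAt (s := Ioi (0 : ℝ))
        rw [h1.fderivWithin (isOpen_Ioi.uniqueDiffWithinAt hy)]
        ext; simp) hx (mem_Ioi.2 one_pos)
  have heq : ∀ x : ℝ, 0 < x → fredholmSum sys.traceφ lam x = Q 1 * Complex.exp (P x) :=
    fun x hx => by
      rw [← hQ1 x hx, hQ, mul_assoc, ← Complex.exp_add]
      simp
  -- Otherwise the determinant would vanish identically, whereas it tends to 1 at infinity.
  have hne : Q 1 ≠ 0 := fun h => by
    have h1 : Tendsto (fredholmSum sys.traceφ lam) atTop (𝓝 0) := by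
      refine tendsto_const_nhds.congr' ?_
      filter_upwards [eventually_gt_atTop 0] with s hs
      rw [heq s hs, h, zero_mul]
    exact zero_ne_one (tendsto_nhds_unique h1 (sys.tendsto_fredholmSum hlam hdim hb))
  refine ⟨fun x => Complex.log (Q 1) + P x, fun x hx => ⟨?_, (hPd x hx).const_add _⟩⟩
  rw [Complex.exp_add, Complex.exp_log hne, heq x hx]

end

theorem measurePreserving_add_piIoi (x : ℝ) (n : ℕ) :
    MeasurePreserving (fun (t : Fin n → ℝ) i => t i + x) (piIoi 0 n) (piIoi x n) :=
  measurePreserving_pi (fun _ => halfLine) (fun _ => volume.restrict (Ioi x))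
    fun _ => measurePreserving_add_halfLine x

theorem det_hankelKernel_ae {x : ℝ} (hx : 0 < x) (n : ℕ) :
    (fun t : Fin n → ℝ => Matrix.det (Matrix.of fun i j => sys.hankelKernel x (t i) (t j)))
      =ᵐ[piIoi 0 n] fun t =>
        (hankelMatrix sys.traceφ (fun i => t i + x) fun i => t i + x).det := by
  have h : ∀ᵐ t ∂(piIoi 0 n), ∀ i : Fin n, 0 < t i := eventually_all.2 fun i =>
    (Measure.tendsto_eval_ae_ae (μ := fun _ : Fin n => volume.restrict (Ioi (0 : ℝ)))
      (i := i)).eventually (ae_restrict_mem measurableSet_Ioi)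
  filter_upwards [h] with t ht
  congr 1
  ext i j
  have h1 : t i + x + (t j + x) = 2 * x + t i + t j := by ring
  have h2 : 0 ≤ 2 * x + t i + t j := by have := ht i; have := ht j; positivity
  simp only [hankelMatrix, Matrix.of_apply]
  rw [h1, sys.traceφ_of_nonneg h2]
  rfl

theorem fredholmTerm_hankelKernel {x : ℝ} (hx : 0 < x) (n : ℕ) :
    fredholmTerm (volume.restrict (Ioi (0 : ℝ))) (sys.hankelKernel x) lam n
      = lam ^ n / (n.factorial : ℂ) * fredholmCoeff sys.traceφ x n := by
  rw [fredholmTerm, fredholmCoeff]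
  congr 1
  rw [integral_congr_ae (sys.det_hankelKernel_ae hx n), ← (measurePreserving_add_piIoi x n).map_eq,
    integral_map (measurePreserving_add_piIoi x n).measurable.aemeasurable]
  exact (continuous_det_hankelMatrix sys.continuous_traceφ continuous_id
    continuous_id).aestronglyMeasurable

theorem fredholmConvergent_hankelKernel {x : ℝ} (hx : 0 < x) {w : ℝ → ℝ}
    (hb : HankelBound sys.traceφ x w) :
    FredholmConvergent (volume.restrict (Ioi (0 : ℝ))) (sys.hankelKernel x) lam := by
  refine ⟨fun n => ?_, ?_⟩
  · refine Integrable.congr ?_ (sys.det_hankelKernel_ae hx n).symm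
    exact ((measurePreserving_add_piIoi x n).integrable_comp
      (continuous_det_hankelMatrix sys.continuous_traceφ continuous_id
        continuous_id).aestronglyMeasurable).2 (hb.integrable_det sys.continuous_traceφ n)
  · simp_rw [sys.fredholmTerm_hankelKernel hx]
    exact hb.summable_norm_coeff

theorem hankelDet_eq {x : ℝ} (hx : 0 < x) : sys.hankelDet lam x = fredholmSum sys.traceφ lam x := by
  rw [hankelDet, fredholmDet, fredholmSum]
  simp_rw [sys.fredholmTerm_hankelKernel hx]

end LinearSystem

/-! ### Square integrable majorants from the Hilbert-Schmidt hypotheses. -/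

section HilbertSchmidt

variable {E F : Type*} [NormedAddCommGroup E] [InnerProductSpace ℂ E]
  [NormedAddCommGroup F] [InnerProductSpace ℂ F]

/-- Parseval's identity. -/
theorem HilbertBasis.hasSum_norm_inner_sq {ι : Type*} (b : HilbertBasis ι ℂ E) (v : E) :
    HasSum (fun i => ‖inner ℂ (b i) v‖ ^ 2) (‖v‖ ^ 2) := by
  have h := Complex.hasSum_re (b.hasSum_inner_mul_inner v v)
  rw [inner_self_eq_norm_sq_to_K] at h
  have e : (((‖v‖ : ℝ) : ℂ) ^ 2).re = ‖v‖ ^ 2 := by rw [← Complex.ofReal_pow, Complex.ofReal_re]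
  rw [show ((RCLike.ofReal ‖v‖ : ℂ) ^ 2).re = ‖v‖ ^ 2 from e] at h
  convert h using 2 with i
  rw [← inner_conj_symm v (b i), mul_comm, Complex.mul_conj', ← Complex.ofReal_pow, Complex.ofReal_re]

theorem HilbertBasis.countable_index {ι : Type*} [TopologicalSpace.SeparableSpace E]
    (b : HilbertBasis ι ℂ E) : Countable ι := by
  refine Pairwise.countable_of_isOpen_disjoint (s := fun i => Metric.ball (b i) (1 / 2)) ?_
    (fun i => Metric.isOpen_ball) fun i => ⟨b i, Metric.mem_ball_self (by norm_num)⟩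
  intro i j hij
  refine Metric.ball_disjoint_ball ?_
  have h1 : ‖b i - b j‖ ^ 2 = 2 := by
    rw [@norm_sub_sq ℂ, b.orthonormal.1 i, b.orthonormal.1 j, b.orthonormal.2 hij]
    norm_num
  rw [dist_eq_norm]
  nlinarith [norm_nonneg (b i - b j)]

/-- By Parseval both sums of squares equal the double sum of |⟨e_j, L b_i⟩|², and the order of
summation is immaterial. The basis on the other side is arbitrary. -/
theorem IsHilbertSchmidt.summable_adjoint [CompleteSpace E] [CompleteSpace F] {L : E →L[ℂ] F}
    (hL : IsHilbertSchmidt L) {ι : Type*} (e : HilbertBasis ι ℂ F) :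
    Summable fun j => ‖ContinuousLinearMap.adjoint L (e j)‖ ^ 2 := by
  obtain ⟨w, b, hb⟩ := hL
  have h1 : Summable fun p : w × ι => ‖inner ℂ (e p.2) (L (b p.1))‖ ^ 2 := by
    refine (summable_prod_of_nonneg fun _ => sq_nonneg _).2
      ⟨fun i => (e.hasSum_norm_inner_sq (L (b i))).summable, ?_⟩
    refine hb.congr fun i => ?_
    exact (e.hasSum_norm_inner_sq (L (b i))).tsum_eq.symm
  have h2 := ((summable_prod_of_nonneg fun _ => sq_nonneg _).1 h1.prod_symm).2
  refine h2.congr fun j => ?_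
  rw [← (b.hasSum_norm_inner_sq (ContinuousLinearMap.adjoint L (e j))).tsum_eq]
  refine tsum_congr fun i => ?_
  rw [ContinuousLinearMap.adjoint_inner_right, norm_inner_symm]
  rfl

/-- The majorant is m(t) = (∑ ‖f_j(t)‖²)^{1/2}; monotone convergence shows that m is square
integrable. Stating the bound for finite partial sums spares summability at each point. -/
theorem exists_memLp_majorant {α ι : Type*} [MeasurableSpace α] {μ : Measure α} [Countable ι]
    (f : ι → Lp E 2 μ) (hf : Summable fun j => ‖f j‖ ^ 2) :
    ∃ m : α → ℝ, (∀ t, 0 ≤ m t) ∧ MemLp m 2 μ ∧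
      ∀ᵐ t ∂μ, ∀ s : Finset ι, ∑ j ∈ s, ‖f j t‖ ^ 2 ≤ m t ^ 2 := by
  let A : α → ENNReal := fun t => ∑' j, ‖f j t‖ₑ ^ 2
  have hm : ∀ j, AEMeasurable (fun t => ‖f j t‖ₑ ^ 2) μ := fun j =>
    (Lp.aestronglyMeasurable (f j)).enorm.pow_const 2
  have hA : AEMeasurable A μ := AEMeasurable.tsum hm
  have hAi : ∫⁻ t, A t ∂μ ≠ ⊤ := by
    rw [lintegral_tsum hm]
    have e : ∀ j, ∫⁻ t, ‖f j t‖ₑ ^ 2 ∂μ = ENNReal.ofReal (‖f j‖ ^ 2) := fun j => by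
      rw [lintegral_enorm_sq_eq, ← Lp.enorm_def, ENNReal.ofReal_pow (norm_nonneg _), ofReal_norm]
    simp_rw [e]
    exact hf.tsum_ofReal_ne_top
  have hsq : ∀ t, √(A t).toReal ^ 2 = (A t).toReal := fun t => Real.sq_sqrt ENNReal.toReal_nonneg
  refine ⟨fun t => √(A t).toReal, fun t => Real.sqrt_nonneg _, ?_, ?_⟩
  · rw [memLp_two_iff_integrable_sq
      (hA.ennreal_toReal.sqrt).aestronglyMeasurable]
    simp_rw [hsq]
    exact integrable_toReal_of_lintegral_ne_top hA hAi
  · filter_upwards [ae_lt_top' hA hAi] with t ht s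
    rw [hsq]
    have h1 := ENNReal.toReal_mono ht.ne (ENNReal.sum_le_tsum (f := fun j => ‖f j t‖ₑ ^ 2) s)
    rw [ENNReal.toReal_sum fun j _ => by finiteness] at h1
    simpa using h1

/-- A Hilbert-Schmidt operator into L² acts like an integral kernel with norm at most m(t) at t. The
expansion of ξ in the basis converges almost everywhere along a subsequence, and Cauchy-Schwarz
bounds its partial sums. -/
theorem norm_adjoint_apply_le [CompleteSpace E] [CompleteSpace F] {α ι : Type*}
    [MeasurableSpace α] {μ : Measure α} [Countable ι]
    (L : Lp E 2 μ →L[ℂ] F) (e : HilbertBasis ι ℂ F) {m : α → ℝ} (hm0 : ∀ t, 0 ≤ m t)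
    (hm : ∀ᵐ t ∂μ, ∀ s : Finset ι,
      ∑ j ∈ s, ‖ContinuousLinearMap.adjoint L (e j) t‖ ^ 2 ≤ m t ^ 2) (ξ : F) :
    ∀ᵐ t ∂μ, ‖ContinuousLinearMap.adjoint L ξ t‖ ≤ m t * ‖ξ‖ := by
  set f := fun j => ContinuousLinearMap.adjoint L (e j) with hf
  have h1 : HasSum (fun j => e.repr ξ j • f j) (ContinuousLinearMap.adjoint L ξ) := by
    have := (e.hasSum_repr ξ).mapL (ContinuousLinearMap.adjoint L)
    simpa only [map_smul] using this
  obtain ⟨ns, -, hns⟩ := (tendstoInMeasure_of_tendsto_Lp h1).exists_seq_tendsto_ae'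
  have h2 : ∀ᵐ t ∂μ, ∀ n, (∑ j ∈ ns n, e.repr ξ j • f j : Lp E 2 μ) t
      = ∑ j ∈ ns n, e.repr ξ j • f j t := by
    refine ae_all_iff.2 fun n => ?_
    have h3 : ∀ᵐ t ∂μ, ∀ j, (e.repr ξ j • f j : Lp E 2 μ) t = e.repr ξ j • f j t :=
      ae_all_iff.2 fun j => Lp.coeFn_smul _ _
    filter_upwards [Lp.coeFn_finsetSum (ns n) fun j => e.repr ξ j • f j, h3] with t ht ht3
    rw [ht, Finset.sum_apply]
    exact Finset.sum_congr rfl fun j _ => ht3 j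
  filter_upwards [hns, h2, hm] with t ht ht2 htm
  refine le_of_tendsto ht.norm (Eventually.of_forall fun n => ?_)
  rw [ht2 n]
  calc ‖∑ j ∈ ns n, e.repr ξ j • f j t‖ ≤ ∑ j ∈ ns n, ‖f j t‖ * ‖inner ℂ (e j) ξ‖ := by
        refine (norm_sum_le _ _).trans_eq (Finset.sum_congr rfl fun j _ => ?_)
        rw [norm_smul, e.repr_apply_apply, mul_comm]
    _ ≤ √(∑ j ∈ ns n, ‖f j t‖ ^ 2) * √(∑ j ∈ ns n, ‖inner ℂ (e j) ξ‖ ^ 2) :=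
        Real.sum_mul_le_sqrt_mul_sqrt _ _ _
    _ ≤ √(m t ^ 2) * √(‖ξ‖ ^ 2) := by
        gcongr
        · exact htm _
        · exact e.orthonormal.sum_inner_products_le ξ
    _ = m t * ‖ξ‖ := by rw [Real.sqrt_sq (hm0 t), Real.sqrt_sq (norm_nonneg _)]

end HilbertSchmidt

namespace LinearSystem

variable {H H₀ : Type*}
  [NormedAddCommGroup H] [InnerProductSpace ℂ H] [CompleteSpace H]
  [TopologicalSpace.SeparableSpace H]
  [NormedAddCommGroup H₀] [InnerProductSpace ℂ H₀] [CompleteSpace H₀] [FiniteDimensional ℂ H₀]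
  (sys : LinearSystem H H₀)

/-- Apply the pointwise bound for the adjoint of Θ_x to the vectors ξ = S(t)Bu, for which C S(x+s)ξ
= φ(x+s+t)u. -/
theorem norm_phi_le_of_isTheta {x : ℝ} (hx : 0 ≤ x)
    {L : Lp H₀ 2 (volume.restrict (Ioi (0 : ℝ))) →L[ℂ] H} (hL : sys.IsTheta x L)
    (hs : IsHilbertSchmidt L) (u : H₀) : ∃ m : ℝ → ℝ, (∀ t, 0 ≤ m t) ∧ MemLp m 2 halfLine ∧
      ∀ᵐ s ∂halfLine, ∀ t, 0 ≤ t →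
        ‖sys.phi (x + s + t) u‖ ≤ m s * ‖sys.S t (sys.inputOp u)‖ := by
  obtain ⟨w, e, -⟩ := exists_hilbertBasis ℂ H
  have := e.countable_index
  obtain ⟨m, hm0, hm2, hm⟩ := exists_memLp_majorant _ (hs.summable_adjoint e)
  refine ⟨m, hm0, hm2, ?_⟩
  -- The null set depends on the vector, so only countably many times are treated at once;
  -- continuity in t covers the rest. Absolute values keep the rational times nonnegative.
  have h1 : ∀ᵐ s ∂halfLine, ∀ r : ℚ,
      ‖sys.phi (x + s + |(r : ℝ)|) u‖ ≤ m s * ‖sys.S |(r : ℝ)| (sys.inputOp u)‖ := by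
    refine ae_all_iff.2 fun r => ?_
    have hr := abs_nonneg (r : ℝ)
    have hd := sys.S_inputOp_mem_domain hr u
    filter_upwards [norm_adjoint_apply_le L e hm0 hm (sys.S |(r : ℝ)| (sys.inputOp u)),
      hL _ hd, ae_restrict_mem measurableSet_Ioi] with s hs1 hs2 hs0
    have hs0' : 0 ≤ x + s := add_nonneg hx (le_of_lt hs0)
    rw [hs2, ← sys.S_add_apply hs0' hr, ← sys.phi_apply (add_nonneg hs0' hr)] at hs1
    exact hs1
  filter_upwards [h1, ae_restrict_mem measurableSet_Ioi] with s hs1 hs0 t ht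
  have hs0' : 0 ≤ x + s := add_nonneg hx (le_of_lt hs0)
  have c1 : Continuous fun r : ℝ => ‖sys.phi (x + s + |r|) u‖ := by
    have : Continuous fun r : ℝ => sys.phi (x + s + |r|) :=
      sys.continuousOn_phi.comp_continuous (by fun_prop) fun r => add_nonneg hs0' (abs_nonneg r)
    fun_prop
  have c2 : Continuous fun r : ℝ => m s * ‖sys.S |r| (sys.inputOp u)‖ := by
    have : Continuous fun r : ℝ => (sys.S |r| ∘L sys.inputOp) :=
      (sys.continuousOn_S_comp sys.inputOp).comp_continuous (by fun_prop) fun r => abs_nonneg r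
    have : Continuous fun r : ℝ => (sys.S |r| ∘L sys.inputOp) u := by fun_prop
    exact continuous_const.mul this.norm
  have := Rat.denseRange_cast (𝕜 := ℝ) |>.induction_on
    (p := fun r => ‖sys.phi (x + s + |r|) u‖ ≤ m s * ‖sys.S |r| (sys.inputOp u)‖) t
    (isClosed_le c1 c2) hs1
  rwa [abs_of_nonneg ht] at this

/-- Parseval in H: ‖S(x+t)Bu‖² is the sum of |⟨B†S(x+t)†e_j, u⟩|², which is at most ‖u‖² m(t)². -/
theorem memLp_S_inputOp_of_isXi {x : ℝ} (hx : 0 ≤ x)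
    {L : Lp H₀ 2 (volume.restrict (Ioi (0 : ℝ))) →L[ℂ] H} (hL : sys.IsXi x L)
    (hs : IsHilbertSchmidt L) (u : H₀) :
    MemLp (fun t => ‖sys.S (x + t) (sys.inputOp u)‖) 2 halfLine := by
  obtain ⟨w, e, -⟩ := exists_hilbertBasis ℂ H
  have := e.countable_index
  obtain ⟨m, hm0, hm2, hm⟩ := exists_memLp_majorant _ (hs.summable_adjoint e)
  have h1 : ∀ᵐ t ∂halfLine, ∀ j, (ContinuousLinearMap.adjoint L (e j) : ℝ → H₀) t =
      ContinuousLinearMap.adjoint sys.inputOp (ContinuousLinearMap.adjoint (sys.S (x + t)) (e j)) :=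
    ae_all_iff.2 fun j => hL (e j)
  refine MemLp.of_le_mul (c := ‖u‖) hm2 ?_ ?_
  · have h2 : ContinuousOn (fun t => (sys.S (x + t) ∘L sys.inputOp) u) (Ioi 0) :=
      ((sys.continuousOn_S_comp sys.inputOp).comp (by fun_prop)
        fun t ht => add_nonneg hx (le_of_lt ht)).clm_apply continuousOn_const
    exact h2.norm.aestronglyMeasurable measurableSet_Ioi
  · filter_upwards [h1, hm] with t ht htm
    rw [norm_norm, Real.norm_of_nonneg (hm0 t)]
    refine le_of_sq_le_sq ?_ (mul_nonneg (norm_nonneg _) (hm0 t))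
    refine hasSum_le_of_sum_le (e.hasSum_norm_inner_sq _) fun s => ?_
    calc _ ≤ ∑ j ∈ s, ‖u‖ ^ 2 * ‖(ContinuousLinearMap.adjoint L (e j) : ℝ → H₀) t‖ ^ 2 := by
          refine Finset.sum_le_sum fun j _ => ?_
          rw [ht j, ← ContinuousLinearMap.adjoint_inner_left, ← ContinuousLinearMap.adjoint_inner_left,
            ← mul_pow, mul_comm]
          gcongr
          exact norm_inner_le_norm _ _
      _ = ‖u‖ ^ 2 * ∑ j ∈ s, ‖(ContinuousLinearMap.adjoint L (e j) : ℝ → H₀) t‖ ^ 2 := by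
          rw [Finset.mul_sum]
      _ ≤ ‖u‖ ^ 2 * m t ^ 2 := by gcongr; exact htm s
      _ = _ := by rw [mul_pow]

/-- Θ_x and Ξ_x give the product bound α(s) β(t); the sum α + β makes it symmetric, and a third
summand γ secures the diagonal. -/
theorem exists_hankelBound (hdim : Module.finrank ℂ H₀ = 1)
    (hHS : ∀ x : ℝ, 0 < x → (∃ L, sys.IsTheta x L ∧ IsHilbertSchmidt L) ∧
      (∃ L, sys.IsXi x L ∧ IsHilbertSchmidt L)) {x : ℝ} (hx : 0 < x) :
    ∃ w, HankelBound sys.traceφ x w := by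
  obtain ⟨⟨L, hL, hLs⟩, M, hM, hMs⟩ := hHS x hx
  obtain ⟨v, hv, -⟩ := finrank_eq_one_iff'.1 hdim
  set u : H₀ := ((‖v‖ : ℂ)⁻¹) • v with hu
  have hu1 : ‖u‖ = 1 := norm_smul_inv_norm hv
  obtain ⟨m, hm0, hm2, hm⟩ := sys.norm_phi_le_of_isTheta hx.le hL hLs u
  have hφ : ∀ t, 0 ≤ t → ‖sys.phi t u‖ = ‖sys.traceφ t‖ := fun t ht => by
    rw [sys.phi_eq_traceφ hdim ht]
    simp [norm_smul, hu1]
  have hmp := measurePreserving_add_halfLine x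
  set β : ℝ → ℝ := fun t => ‖sys.S t (sys.inputOp u)‖ with hβ
  have tr : ∀ {f : ℝ → ℝ}, MemLp (fun t => f (t + x)) 2 halfLine →
      MemLp f 2 (volume.restrict (Ioi x)) := fun {f} hf => by
    rw [← hmp.map_eq]
    exact (measurableEmbedding_addRight x).memLp_map_measure_iff.2 hf
  have hβ2 : MemLp β 2 (volume.restrict (Ioi x)) := tr (by
    simpa only [add_comm x] using sys.memLp_S_inputOp_of_isXi hx.le hM hMs u)
  set α : ℝ → ℝ := fun s => m (s - x) with hα
  have hα2 : MemLp α 2 (volume.restrict (Ioi x)) := tr (by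
    simpa only [hα, add_sub_cancel_right] using hm2)
  have hαβ : ∀ᵐ s ∂(volume.restrict (Ioi x)), ∀ t, 0 ≤ t → ‖sys.traceφ (s + t)‖ ≤ α s * β t := by
    rw [← hmp.map_eq, (measurableEmbedding_addRight x).ae_map_iff]
    filter_upwards [hm, ae_restrict_mem measurableSet_Ioi] with s hs hs0 t ht
    have := hs t ht
    rw [hφ _ (add_nonneg (add_nonneg hx.le (le_of_lt hs0)) ht), add_comm x s] at this
    simpa only [hα, add_sub_cancel_right] using this
  have hα0 : ∀ s, 0 ≤ α s := fun s => hm0 _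
  have hβ0 : ∀ s, 0 ≤ β s := fun s => norm_nonneg _
  -- By this choice the diagonal bound holds at every point. Since γ(s)² ≤ α(s) β(s) for almost
  -- every s > x, γ is dominated by α + β there and is square integrable.
  set γ : ℝ → ℝ := fun s => √‖sys.traceφ (s + s)‖ with hγ
  have hγ0 : ∀ s, 0 ≤ γ s := fun s => Real.sqrt_nonneg _
  have hγ2 : MemLp γ 2 (volume.restrict (Ioi x)) := by
    refine MemLp.of_le (hα2.add hβ2) ?_ ?_
    · have := sys.continuous_traceφ
      exact (Continuous.aestronglyMeasurable (by fun_prop))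
    · filter_upwards [hαβ, ae_restrict_mem measurableSet_Ioi] with s hs hxs
      rw [Real.norm_of_nonneg (hγ0 s), Pi.add_apply,
        Real.norm_of_nonneg (add_nonneg (hα0 s) (hβ0 s))]
      refine Real.sqrt_le_iff.2 ⟨add_nonneg (hα0 s) (hβ0 s), (hs s (hx.le.trans (le_of_lt hxs))).trans ?_⟩
      nlinarith [hα0 s, hβ0 s]
  refine ⟨fun s => α s + β s + γ s, fun s => by have := hα0 s; have := hβ0 s; have := hγ0 s; positivity,
    (hα2.add hβ2).add hγ2, ?_, fun s hs => ?_⟩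
  · filter_upwards [hαβ] with t ht s hs
    rw [add_comm s t]
    refine (ht s (hx.le.trans hs)).trans ?_
    rw [mul_comm]
    have := hα0 s; have := hβ0 s; have := hγ0 s
    have := hα0 t; have := hβ0 t; have := hγ0 t
    refine mul_le_mul ?_ ?_ (hα0 t) ?_ <;> linarith
  · have h1 : ‖sys.traceφ (s + s)‖ = γ s * γ s := (Real.mul_self_sqrt (norm_nonneg _)).symm
    rw [h1]
    have := hα0 s; have := hβ0 s; have := hγ0 s
    refine mul_le_mul ?_ ?_ (hγ0 s) ?_ <;> linarith

theorem hankelDet_formula [sys.IsContractive] {lam : ℂ} (hlam : ‖lam‖ < 1)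
    (hdim : Module.finrank ℂ H₀ = 1)
    (hHS : ∀ x : ℝ, 0 < x → (∃ L, sys.IsTheta x L ∧ IsHilbertSchmidt L) ∧
      (∃ L, sys.IsXi x L ∧ IsHilbertSchmidt L)) :
    (∀ x : ℝ, 0 < x →
      FredholmConvergent (volume.restrict (Ioi (0 : ℝ))) (sys.hankelKernel x) lam) ∧
    ∃ ℓ : ℝ → ℂ, ∀ x : ℝ, 0 < x →
      Complex.exp (ℓ x) = sys.hankelDet lam x ∧
      HasDerivAt (fun s : ℝ => ℓ s • (1 : H₀ →L[ℂ] H₀)) (sys.T lam x x) x := by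
  have hb := fun x (hx : 0 < x) => sys.exists_hankelBound hdim hHS hx
  refine ⟨fun x hx => ?_, ?_⟩
  · obtain ⟨w, hw⟩ := hb x hx
    exact sys.fredholmConvergent_hankelKernel hx hw
  · obtain ⟨ℓ, hℓ⟩ := sys.exists_log_fredholmSum hlam hdim hb
    refine ⟨ℓ, fun x hx => ⟨?_, ?_⟩⟩
    · rw [(hℓ x hx).1, sys.hankelDet_eq hx]
    · rw [sys.T_eq_traceT hdim]
      exact (hℓ x hx).2.smul_const _

end LinearSystem

/-! ### The theorem. -/

theorem lemma4p1 {H H₀ : Type*}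
    [NormedAddCommGroup H] [InnerProductSpace ℂ H] [CompleteSpace H]
    [TopologicalSpace.SeparableSpace H]
    [NormedAddCommGroup H₀] [InnerProductSpace ℂ H₀] [CompleteSpace H₀] [FiniteDimensional ℂ H₀]
    (sys : LinearSystem H H₀)
    (KC KB : NNReal) (hKC : sys.ObservationBound KC) (hKC1 : KC ≤ 1)
    (hKB : sys.ControlBound KB) (hKB1 : KB ≤ 1)
    (lam : ℂ) (hlam : ‖lam‖ < 1) :
    -- the kernel is well defined
    (∀ x : ℝ, 0 < x →
      sys.IsR x (sys.R x) ∧ (∀ R' : H →L[ℂ] H, sys.IsR x R' → R' = sys.R x) ∧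
      IsUnit (1 + lam • sys.R x) ∧
      ∀ y : ℝ, x ≤ y → ∀ u : H₀, sys.preT lam x y u ∈ sys.A.domain) ∧
    -- it solves the Gelfand-Levitan equation
    (∀ x : ℝ, 0 < x →
      MemLp (sys.T lam x) 2 (volume.restrict (Ioi x)) ∧
      ∀ y : ℝ, x ≤ y → sys.GelfandLevitanAt lam x y (sys.T lam x)) ∧
    -- it is the only square integrable solution
    (∀ x : ℝ, 0 < x → ∀ F : ℝ → H₀ →L[ℂ] H₀, MemLp F 2 (volume.restrict (Ioi x)) →
      ((∀ᵐ y ∂(volume.restrict (Ioi x)), sys.GelfandLevitanAt lam x y F) →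
        F =ᵐ[volume.restrict (Ioi x)] sys.T lam x) ∧
      ((∀ y : ℝ, x < y → sys.GelfandLevitanAt lam x y F) →
        ∀ y : ℝ, x < y → F y = sys.T lam x y)) ∧
    -- regularity, and the differential equation in the sense of distributions
    (ContinuousOn (fun p : ℝ × ℝ => sys.T lam p.1 p.2) {p | 0 < p.1 ∧ p.1 ≤ p.2} ∧
      (∀ᵐ x ∂(volume.restrict (Ioi (0 : ℝ))),
        DifferentiableAt ℝ (fun s : ℝ => sys.T lam s s) x) ∧
      (∀ a b : ℝ, 0 < a → a ≤ b → IntervalIntegrable (sys.q lam) volume a b ∧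
        (-2 : ℂ) • (sys.T lam b b - sys.T lam a a) = ∫ x in a..b, sys.q lam x) ∧
      ∀ ψ : ℝ × ℝ → ℝ, ContDiff ℝ ∞ ψ → HasCompactSupport ψ →
        tsupport ψ ⊆ {p : ℝ × ℝ | 0 < p.1 ∧ p.1 < p.2} →
        ∫ p : ℝ × ℝ, (iteratedDeriv 2 (fun s => ψ (s, p.2)) p.1
            - iteratedDeriv 2 (fun s => ψ (p.1, s)) p.2) • sys.T lam p.1 p.2
          = ∫ p : ℝ × ℝ, ψ p • (sys.q lam p.1 ∘L sys.T lam p.1 p.2)) ∧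
    -- the differential equation in the classical sense when `φ` is twice continuously differentiable
    (ContDiffOn ℝ 2 sys.phi (Ioi 0) →
      ContDiffOn ℝ 1 (fun x : ℝ => sys.T lam x x) (Ioi 0) ∧
      ContDiffOn ℝ 2 (fun p : ℝ × ℝ => sys.T lam p.1 p.2) {p | 0 < p.1 ∧ p.1 < p.2} ∧
      ∀ x y : ℝ, 0 < x → x < y →
        iteratedDeriv 2 (fun s => sys.T lam s y) x - iteratedDeriv 2 (fun s => sys.T lam x s) y
          - sys.q lam x ∘L sys.T lam x y = 0) ∧
    -- the determinant formula in the scalar Hilbert-Schmidt case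
    (Module.finrank ℂ H₀ = 1 →
      (∀ x : ℝ, 0 < x → (∃ L, sys.IsTheta x L ∧ IsHilbertSchmidt L) ∧
        (∃ L, sys.IsXi x L ∧ IsHilbertSchmidt L)) →
      (∀ x : ℝ, 0 < x →
        FredholmConvergent (volume.restrict (Ioi (0 : ℝ))) (sys.hankelKernel x) lam) ∧
      ∃ ℓ : ℝ → ℂ, ∀ x : ℝ, 0 < x →
        Complex.exp (ℓ x) = sys.hankelDet lam x ∧
        HasDerivAt (fun s : ℝ => ℓ s • (1 : H₀ →L[ℂ] H₀)) (sys.T lam x x) x) := by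
  have : sys.IsContractive := by
    refine ⟨fun ξ hξ => (hKC ξ hξ).trans ?_, fun η => (hKB η).trans ?_⟩
    · gcongr
    · gcongr
  have hsub : {p : ℝ × ℝ | 0 < p.1 ∧ p.1 < p.2} ⊆ quadrant := fun p hp => ⟨hp.1, hp.1.trans hp.2⟩
  refine ⟨fun x hx => ⟨sys.isR_R hx.le, fun R' hR' => hR'.unique sys (sys.isR_R hx.le), ?_,
      fun y hy u => sys.preT_mem_domain hlam hx.le (hx.le.trans hy) u⟩,
    fun x hx => ⟨sys.memLp_T hlam hx.le, fun y hy => sys.gelfandLevitan_T hlam hx.le (hx.le.trans hy)⟩,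
    fun x hx F hF => ⟨fun h => ?_, fun h y hy => ?_⟩,
    ⟨?_, ?_, fun a b ha hab => ?_, fun ψ hψ hs hψsub => ?_⟩,
    fun hφ => ⟨sys.contDiffOn_T_diag hlam hφ, (sys.contDiffOn_T hlam hφ).mono hsub,
      fun x y hx hxy => sys.wave_T hlam hφ hx (hx.trans hxy)⟩,
    fun hdim hHS => sys.hankelDet_formula hlam hdim hHS⟩
  · rw [sys.R_eq_Rop hx.le]
    exact sys.isUnit_one_add_Rop hlam hx.le
  · filter_upwards [h, ae_restrict_mem measurableSet_Ioi] with y hy hxy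
    exact sys.eq_T_of_gelfandLevitan hlam hx.le hF h (hx.le.trans (le_of_lt hxy)) hy
  · refine sys.eq_T_of_gelfandLevitan hlam hx.le hF ?_ (hx.le.trans hy.le) (h y hy)
    filter_upwards [ae_restrict_mem measurableSet_Ioi] with z hz using h z hz
  · exact (sys.continuousOn_T hlam).mono fun p hp => ⟨hp.1.le, hp.1.le.trans hp.2⟩
  · filter_upwards [sys.T_diag_ae_hasDerivAt hlam] with x hx using hx.differentiableAt
  · obtain ⟨h1, h2⟩ := sys.isPrimitive_T_diag hlam ha hab
    exact ⟨h1, by rw [h2, smul_sub]⟩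
  · exact sys.integral_wave_smul_T hlam hψ hs (hψsub.trans hsub)
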